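/- Let $\rho,r\ge 0$ with $r+\frac{\rho}{2}\ge 1$ and $(\rho,r)\ne(0,1)$, let $p>1$, and put $s_0=\frac r2+\frac\rho2$, so that $s_0>\frac12$. Let $L$ and $B$ be the Fourier multiplier operators on $\mathbb R$ with smooth, real-valued, even symbols $l$ and $b$ (so that they map real functions to real functions), and let $c_1,c_2,c_3,c_4>0$ be constants with $$c_1^2(1+\xi^2)^{\rho/2}\le l(\xi)\le c_2^2(1+\xi^2)^{\rho/2},\qquad c_3^2(1+\xi^2)^{-r/2}\le b(\xi)\le c_4^2(1+\xi^2)^{-r/2}\qquad(\xi\in\mathbb R).$$ Consider, for real-valued $u,w$ and $g(u)=-|u|^{p-1}u$, the Cauchy problem $$u_t=w_x,\qquad w_t=Lu_x+B(g(u))_x,\qquad u(x,0)=u_0(x),\quad w(x,0)=w_0(x).$$ For $(u,w)\in H^{s_0}(\mathbb R)\times H^{s_0-\rho/2}(\mathbb R)$ and $|\gamma|<c_1$ put $$\mathcal E(u,w)=\tfrac12\|B^{-1/2}w\|_{L^2}^2+\tfrac12\|B^{-1/2}L^{1/2}u\|_{L^2}^2-\tfrac1{p+1}\|u\|_{L^{p+1}}^{p+1},\qquad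 \mathcal M(u,w)=\int_{\mathbb R}(B^{-1/2}w)(B^{-1/2}u)\,dx,$$ $$\mathcal I_\gamma(u)=\tfrac12\int_{\mathbb R}(B^{-1/2}L^{1/2}u)^2dx-\tfrac{\gamma^2}2\int_{\mathbb R}(B^{-1/2}u)^2dx,\qquad \mathcal Q(u)=\int_{\mathbb R}|u|^{p+1}dx,$$ $$d(\gamma)=\inf\{\mathcal E(u,w)+\gamma\mathcal M(u,w):(u,w)\in H^{s_0}\times H^{s_0-\rho/2},\ u\ne0,\ 2\mathcal I_\gamma(u)-\mathcal Q(u)=0\},$$ $$\Sigma_-(\gamma)=\{(u,w)\in H^{s_0}\times H^{s_0-\rho/2}:\ \mathcal E(u,w)+\gamma\mathcal M(u,w)<d(\gamma),\ 2\mathcal I_\gamma(u)-\mathcal Q(u)<0\}.$$ **Theorem.** Let $|\gamma|<c_1$ and $(u_0,w_0)\in\Sigma_-(\gamma)$, with $u_0=(v_0)_x$ in the sense of distributions for some $v_0\in L^2(\mathbb R)$, and $\gamma\mathcal M(u_0,w_0)\ge0$. Then the solution of the Cauchy problem blows up in finite time: there are a finite $T_{\max}>0$ and a solution $(u,w)\in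 C([0,T_{\max}),H^{s_0}(\mathbb R))\times C([0,T_{\max}),H^{s_0-\rho/2}(\mathbb R))$ (the equations being understood in the sense of distributions in $x$) such that every solution of this class on an interval $[0,T')$ satisfies $T'\le T_{\max}$ and is the restriction of $(u,w)$ to $[0,T')$, and $$\lim_{t\to T_{\max}^-}\big[\|u(t)\|_{H^{s_0}}+\|w(t)\|_{H^{s_0-\rho/2}}\big]=\infty.$$ -/

import Mathlib

open MeasureTheory Filter Topology Set
open scoped FourierTransform SchwartzMap ContDiff RealInnerProductSpace

noncomputable section

namespace DoublyDispersive

/-- The real Hilbert space `L²(ℝ)` of real-valued functions of `x ∈ ℝ`. -/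
abbrev L2 : Type := Lp ℝ 2 (volume : Measure ℝ)

/-- A real `L²` function regarded as a complex one. -/
def complexify (u : L2) : Lp ℂ 2 (volume : Measure ℝ) :=
  Complex.ofRealCLM.compLpL 2 volume u

/-- The Fourier transform in the normalization `û(ξ) = ∫ u(x) e^{-iξx} dx`
(Mathlib's `𝓕` is normalized as `∫ u(x) e^{-2πiηx} dx`). -/
def hat (u : L2) (ξ : ℝ) : ℂ :=
  𝓕 (complexify u) (ξ / (2 * Real.pi))

/-- `u ∈ H^s(ℝ)`, for `s ≥ 0`: the integral `∫ (1 + ξ²)^s |û(ξ)|² dξ` is finite. -/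
def MemH (s : ℝ) (u : L2) : Prop :=
  Integrable (fun ξ : ℝ => (1 + ξ ^ 2) ^ s * ‖hat u ξ‖ ^ 2)

/-- The norm `‖u‖_{H^s} = (∫ (1 + ξ²)^s |û(ξ)|² dξ)^{1/2}`. -/
def normH (s : ℝ) (u : L2) : ℝ :=
  √(∫ ξ : ℝ, (1 + ξ ^ 2) ^ s * ‖hat u ξ‖ ^ 2)

/-- A curve `u` is in `C([0,T), H^s(ℝ))`. -/
def ContinuousInH (s T : ℝ) (u : ℝ → L2) : Prop :=
  (∀ t ∈ Ico 0 T, MemH s (u t)) ∧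
    ∀ t ∈ Ico 0 T, Tendsto (fun τ => normH s (u τ - u t)) (𝓝[Ico 0 T] t) (𝓝 0)

open Classical in
/-- The Fourier multiplier operator with real even symbol `a`: the function whose Fourier
transform is `ξ ↦ a(ξ) û(ξ)`, for those `u` for which this is in `L²` (and the value `0` for
the other `u`). In Mathlib's frequency variable `η = ξ / (2π)` the symbol reads `a(2πη)`.
For `a` even and `u` real the result is real, so that taking the real part only changes the
type. -/
def multiplier (a : ℝ → ℝ) (u : L2) : L2 :=
  if h : MemLp (fun η : ℝ => (a (2 * Real.pi * η) : ℂ) * 𝓕 (complexify u) η) 2 volume then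
    Complex.reCLM.compLpL 2 volume (𝓕⁻ (h.toLp _))
  else 0

/-- The operator `B^{-1/2}`, where `B` has symbol `b`. -/
def invSqrtB (b : ℝ → ℝ) (u : L2) : L2 :=
  multiplier (fun ξ => (√(b ξ))⁻¹) u

/-- The operator `B^{-1/2} L^{1/2}`, where `L` has symbol `l` and `B` has symbol `b`. -/
def invSqrtBSqrtL (l b : ℝ → ℝ) (u : L2) : L2 :=
  multiplier (fun ξ => (√(b ξ))⁻¹ * √(l ξ)) u

open Classical in
/-- The function `g(u) = -|u|^{p-1} u` as an element of `L²` (and `0` if it is not in `L²`,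
which does not occur for bounded `u ∈ L²`, in particular for `u ∈ H^s` with `s > 1/2`). -/
def nonlinearity (p : ℝ) (u : L2) : L2 :=
  if h : MemLp (fun x : ℝ => -|u x| ^ (p - 1) * u x) 2 volume then h.toLp _ else 0

/-- A Schwartz test function, as an element of `L²`. -/
def test (φ : 𝓢(ℝ, ℝ)) : L2 := φ.toLp 2 volume

/-- The derivative of a Schwartz test function, as an element of `L²`. -/
def testDeriv (φ : 𝓢(ℝ, ℝ)) : L2 := (SchwartzMap.derivCLM ℝ ℝ φ).toLp 2 volume

/-- `u = v_x` in the sense of distributions. -/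
def IsWeakDeriv (v u : L2) : Prop :=
  ∀ φ : 𝓢(ℝ, ℝ), ⟪u, test φ⟫ = -⟪v, testDeriv φ⟫

/-- `(u, w)` is a solution on `[0,T)` of the Cauchy problem
`u_t = w_x`, `w_t = L u_x + B (g(u))_x`, `u(0) = u₀`, `w(0) = w₀`, with `g(u) = -|u|^{p-1} u`, in
`C([0,T), H^s) × C([0,T), H^σ)`. The equations hold in the sense of distributions in `x`: they
are tested with Schwartz functions `φ` of `x`, and the derivative in `x` and the symmetric
operator `L` are moved to `φ`. -/
structure IsSolution (l b : ℝ → ℝ) (p s σ : ℝ) (u₀ w₀ : L2) (T : ℝ) (u w : ℝ → L2) : Prop where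
  pos : 0 < T
  continuous_u : ContinuousInH s T u
  continuous_w : ContinuousInH σ T w
  eq_u : ∀ φ : 𝓢(ℝ, ℝ), ∀ t ∈ Ico 0 T,
    HasDerivWithinAt (fun τ => ⟪u τ, test φ⟫) (-⟪w t, testDeriv φ⟫) (Ico 0 T) t
  eq_w : ∀ φ : 𝓢(ℝ, ℝ), ∀ t ∈ Ico 0 T,
    HasDerivWithinAt (fun τ => ⟪w τ, test φ⟫)
      (-⟪u t, multiplier l (testDeriv φ)⟫
        - ⟪multiplier b (nonlinearity p (u t)), testDeriv φ⟫) (Ico 0 T) t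
  init_u : u 0 = u₀
  init_w : w 0 = w₀

/-- `𝒬(u) = ∫ |u|^{p+1} dx`. -/
def Q (p : ℝ) (u : L2) : ℝ := ∫ x : ℝ, |u x| ^ (p + 1)

/-- `ℐ_γ(u) = ½ ∫ (B^{-1/2} L^{1/2} u)² dx - (γ²/2) ∫ (B^{-1/2} u)² dx`. -/
def I (l b : ℝ → ℝ) (γ : ℝ) (u : L2) : ℝ :=
  1 / 2 * (∫ x : ℝ, (invSqrtBSqrtL l b u x) ^ 2) - γ ^ 2 / 2 * ∫ x : ℝ, (invSqrtB b u x) ^ 2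

/-- The energy
`ℰ(u,w) = ½ ‖B^{-1/2} w‖² + ½ ‖B^{-1/2} L^{1/2} u‖² - (1/(p+1)) ‖u‖_{L^{p+1}}^{p+1}`. -/
def energy (l b : ℝ → ℝ) (p : ℝ) (u w : L2) : ℝ :=
  1 / 2 * ‖invSqrtB b w‖ ^ 2 + 1 / 2 * ‖invSqrtBSqrtL l b u‖ ^ 2
    - 1 / (p + 1) * ∫ x : ℝ, |u x| ^ (p + 1)

/-- The momentum `ℳ(u,w) = ∫ (B^{-1/2} w) (B^{-1/2} u) dx`. -/
def momentum (b : ℝ → ℝ) (u w : L2) : ℝ :=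
  ∫ x : ℝ, invSqrtB b w x * invSqrtB b u x

/-- The critical energy constant `d(γ)`: the infimum of `ℰ(u,w) + γ ℳ(u,w)` over all
`(u,w) ∈ H^s × H^σ` with `u ≠ 0` and `2 ℐ_γ(u) - 𝒬(u) = 0`. -/
def criticalEnergy (l b : ℝ → ℝ) (p s σ γ : ℝ) : ℝ :=
  sInf {e : ℝ | ∃ u w : L2, MemH s u ∧ MemH σ w ∧ u ≠ 0 ∧ 2 * I l b γ u - Q p u = 0 ∧
    e = energy l b p u w + γ * momentum b u w}

/-- The set `Σ₋(γ)` of all `(u,w) ∈ H^s × H^σ` with `ℰ(u,w) + γ ℳ(u,w) < d(γ)` and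
`2 ℐ_γ(u) - 𝒬(u) < 0`. -/
def SigmaMinus (l b : ℝ → ℝ) (p s σ γ : ℝ) : Set (L2 × L2) :=
  {z | MemH s z.1 ∧ MemH σ z.2 ∧
    energy l b p z.1 z.2 + γ * momentum b z.1 z.2 < criticalEnergy l b p s σ γ ∧
    2 * I l b γ z.1 - Q p z.1 < 0}

/-- The solution of the Cauchy problem in `C([0,T), H^s) × C([0,T), H^σ)` blows up in finite
time: for some finite `T > 0` there is a solution `(u,w)` on `[0,T)`, every solution (on any time
interval `[0,T')`) is a restriction of it, so that `(u,w)` is unique and `T` is the maximal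
existence time, and `‖u(t)‖_{H^s} + ‖w(t)‖_{H^σ} → ∞` as `t → T⁻`. -/
def BlowsUpInFiniteTime (l b : ℝ → ℝ) (p s σ : ℝ) (u₀ w₀ : L2) : Prop :=
  ∃ (T : ℝ) (u w : ℝ → L2), IsSolution l b p s σ u₀ w₀ T u w ∧
    (∀ (T' : ℝ) (u' w' : ℝ → L2), IsSolution l b p s σ u₀ w₀ T' u' w' →
      T' ≤ T ∧ ∀ t ∈ Ico 0 T', u' t = u t ∧ w' t = w t) ∧
    Tendsto (fun t => normH s (u t) + normH σ (w t)) (𝓝[<] T) atTop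

end DoublyDispersive

end

noncomputable section

namespace DoublyDispersive

/-! ### The Fourier transform of real square-integrable functions -/

/-! In the variables e = B^{-1/2}L^{1/2}u, a = B^{-1/2}w the energy space is L² × L², and the system
reads e_t = iΩa, a_t = iΩe + N. Here iΩ = L^{1/2}∂ₓ, u = Ke with K = B^{1/2}L^{-1/2}, and N = iD
g(u) with iD = B^{1/2}∂ₓ. Blow-up follows from Levine's concavity argument inside a potential well.
Most of the work goes into well-posedness and exact conservation laws for curves that are
differentiable in time only after smoothing.

Local theory. The condition r + ρ/2 ≥ 1 says that u ∈ H^{s₀} has the 1 - r/2 derivatives that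
B^{1/2}∂ₓ consumes, so N is bounded in L² on balls (`Setup.exists_forcing`). Composition with the
power is controlled through translation differences, which are monotone under Lipschitz maps. A
Lipschitz bound for N is not used: KN is the bounded operator iKD applied to g(u), and g is
Lipschitz in L² on bounded functions. Hence the interaction variables, the group applied to e ± a,
are found by a contraction in the L² norm of their K-images, on the closed set of K-images of a ball
(`Setup.exists_local_ode`). The existence time depends only on the size of the data, so at a finite
maximal time the norm tends to infinity (`Setup.exists_maximal_flow`).

Conservation laws. In the interaction picture the unbounded generator disappears and the profiles
are Lipschitz in time, which suffices to differentiate quadratic forms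
(`Flow.hasDerivWithinAt_quadratic`). The integral 𝒬(u) is differentiated by squeezing its increments
between two tangent lines, using convexity (`Flow.hasDerivWithinAt_Q`). Momentum is conserved
because 𝒬 is translation invariant (`inner_eq_zero_of_translation`).

Potential well. If 2ℐ ≤ 𝒬 and u ≠ 0, scaling u down to the constraint gives d(γ) ≤ (p-1)/(p+1) ℐ
(`Setup.criticalEnergy_le_of_le`). Conservation and the definition of d(γ) prevent 2ℐ - 𝒬 from
vanishing while u ≠ 0, and smallness of u is excluded by the Sobolev bound, so the sign persists
(`Flow.nehari_lt`).

Blow-up. Since u₀ is a derivative of an L² function, e = iΩη for some η ∈ L² with η_t = a. For H =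
½‖η‖² this gives H' = G = ⟨η, a⟩ and G' = ‖a‖² - ‖e‖² + 𝒬 ≥ (p+3)/2 ‖a‖² + δ with δ = (p+1)(d - ℰ).
Here δ > 0 because γℳ ≥ 0. By Cauchy–Schwarz G² ≤ 2H‖a‖², so once G ≥ 1 the quotient H/G decreases
at rate at least (p-1)/4, which cannot go on forever (`false_of_virial`). Finally `Flow.isSolution`
and `Setup.exists_flow_of_isSolution` identify flows with distributional solutions. -/

/-- The Fourier transform of a real `L²` function, in Mathlib's normalization. -/
def fourierL2 (u : L2) : Lp ℂ 2 (volume : Measure ℝ) := 𝓕 (complexify u)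

lemma complexify_ae (u : L2) : ∀ᵐ x, complexify u x = (u x : ℂ) :=
  ContinuousLinearMap.coeFn_compLpL Complex.ofRealCLM u

lemma complexify_add (u v : L2) : complexify (u + v) = complexify u + complexify v :=
  map_add _ _ _

lemma complexify_smul (c : ℝ) (u : L2) : complexify (c • u) = (c : ℂ) • complexify u := by
  have h : complexify (c • u) = c • complexify u := map_smul _ _ _
  rw [h]
  refine Lp.ext ?_
  filter_upwards [Lp.coeFn_smul c (complexify u), Lp.coeFn_smul (c : ℂ) (complexify u)]
    with x h1 h2
  rw [h1, h2]
  simp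

lemma norm_complexify (u : L2) : ‖complexify u‖ = ‖u‖ := by
  refine le_antisymm (Lp.norm_le_norm_of_ae_le ?_) (Lp.norm_le_norm_of_ae_le ?_) <;>
  · filter_upwards [complexify_ae u] with x hx
    rw [hx]
    simp

lemma fourierL2_add (u v : L2) : fourierL2 (u + v) = fourierL2 u + fourierL2 v := by
  rw [fourierL2, complexify_add]
  exact FourierTransform.fourier_add _ _

lemma fourierL2_smul (c : ℝ) (u : L2) : fourierL2 (c • u) = (c : ℂ) • fourierL2 u := by
  rw [fourierL2, complexify_smul]
  exact FourierTransform.fourier_smul _ _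

lemma norm_fourierL2 (u : L2) : ‖fourierL2 u‖ = ‖u‖ := by
  rw [fourierL2, Lp.norm_fourier_eq, norm_complexify]

/-- The Fourier transform as a real-linear isometry. -/
def fourierLI : L2 →ₗᵢ[ℝ] Lp ℂ 2 (volume : Measure ℝ) where
  toFun := fourierL2
  map_add' := fourierL2_add
  map_smul' c u := by
    rw [fourierL2_smul]
    refine Lp.ext ?_
    filter_upwards [Lp.coeFn_smul c (fourierL2 u), Lp.coeFn_smul (c : ℂ) (fourierL2 u)]
      with x h1 h2
    rw [RingHom.id_apply, h1, h2]
    simp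
  norm_map' := norm_fourierL2

lemma continuous_fourierL2 : Continuous fourierL2 := fourierLI.continuous

lemma fourierL2_injective : Function.Injective fourierL2 := fourierLI.injective

lemma fourierL2_sub (u v : L2) : fourierL2 (u - v) = fourierL2 u - fourierL2 v :=
  map_sub fourierLI u v

lemma fourierL2_ext {u v : L2} (h : ∀ᵐ η, fourierL2 u η = fourierL2 v η) : u = v :=
  fourierL2_injective (Lp.ext h)

lemma fourierL2_add_ae (u v : L2) :
    ∀ᵐ η, fourierL2 (u + v) η = fourierL2 u η + fourierL2 v η := by
  rw [fourierL2_add]; exact Lp.coeFn_add _ _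

lemma fourierL2_sub_ae (u v : L2) :
    ∀ᵐ η, fourierL2 (u - v) η = fourierL2 u η - fourierL2 v η := by
  rw [fourierL2_sub]; exact Lp.coeFn_sub _ _

lemma fourierL2_smul_ae (c : ℝ) (u : L2) :
    ∀ᵐ η, fourierL2 (c • u) η = (c : ℂ) * fourierL2 u η := by
  rw [fourierL2_smul]; exact Lp.coeFn_smul _ _

/-- Plancherel's identity for real functions. -/
lemma inner_eq_re_integral (u v : L2) :
    ⟪u, v⟫ = (∫ η, inner ℂ (fourierL2 u η) (fourierL2 v η)).re := by
  rw [← L2.inner_def, fourierL2, fourierL2, Lp.inner_fourier_eq, L2.inner_def, L2.inner_def]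
  rw [← Complex.ofReal_re (∫ a, inner ℝ (u a) (v a)), ← integral_complex_ofReal]
  congr 1
  refine integral_congr_ae ?_
  filter_upwards [complexify_ae u, complexify_ae v] with x hu hv
  rw [hu, hv]
  simp [mul_comm]

lemma integrable_inner_fourierL2 (u v : L2) :
    Integrable (fun η => inner ℂ (fourierL2 u η) (fourierL2 v η)) :=
  L2.integrable_inner _ _

lemma inner_eq_integral_re (u v : L2) :
    ⟪u, v⟫ = ∫ η, (inner ℂ (fourierL2 u η) (fourierL2 v η)).re := by
  rw [inner_eq_re_integral]
  exact (integral_re (integrable_inner_fourierL2 u v)).symm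

lemma inner_congr {a b c d : L2}
    (h : ∀ᵐ η, inner ℂ (fourierL2 a η) (fourierL2 b η)
      = inner ℂ (fourierL2 c η) (fourierL2 d η)) : ⟪a, b⟫ = ⟪c, d⟫ := by
  rw [inner_eq_re_integral, inner_eq_re_integral, integral_congr_ae h]

/-- The Schwartz function with complex values underlying a real one. -/
def complexSchwartz (φ : 𝓢(ℝ, ℝ)) : 𝓢(ℝ, ℂ) := φ.postcompCLM Complex.ofRealCLM

lemma complexSchwartz_apply (φ : 𝓢(ℝ, ℝ)) (x : ℝ) : complexSchwartz φ x = (φ x : ℂ) := rfl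

lemma complexify_toLp (φ : 𝓢(ℝ, ℝ)) :
    complexify (φ.toLp 2 volume) = (complexSchwartz φ).toLp 2 volume := by
  refine Lp.ext ?_
  filter_upwards [complexify_ae (φ.toLp 2 volume), φ.coeFn_toLp 2 volume,
    (complexSchwartz φ).coeFn_toLp 2 volume] with x h1 h2 h3
  rw [h1, h2, h3, complexSchwartz_apply]

lemma fourierL2_toLp (φ : 𝓢(ℝ, ℝ)) :
    fourierL2 (φ.toLp 2 volume) = (𝓕 (complexSchwartz φ)).toLp 2 volume := by
  rw [fourierL2, complexify_toLp, SchwartzMap.toLp_fourier_eq]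

lemma fourierL2_toLp_ae (φ : 𝓢(ℝ, ℝ)) :
    ∀ᵐ η, fourierL2 (φ.toLp 2 volume) η = 𝓕 (complexSchwartz φ) η := by
  rw [fourierL2_toLp]
  exact SchwartzMap.coeFn_toLp _ _ _

lemma denseRange_toLp : DenseRange (fun φ : 𝓢(ℝ, ℝ) => (φ.toLp 2 volume : L2)) :=
  SchwartzMap.denseRange_toLpCLM (p := 2) ENNReal.ofNat_ne_top

lemma fourier_complexSchwartz_neg (φ : 𝓢(ℝ, ℝ)) (η : ℝ) :
    𝓕 (complexSchwartz φ) (-η) = starRingEnd ℂ (𝓕 (complexSchwartz φ) η) := by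
  rw [SchwartzMap.fourier_coe, Real.fourier_eq', Real.fourier_eq', ← integral_conj]
  congr 1
  ext x
  simp only [complexSchwartz_apply, smul_eq_mul, map_mul, Complex.conj_ofReal, ← Complex.exp_conj]
  simp

/-- Reflection `f ↦ f(-·)`. -/
def reflect : Lp ℂ 2 (volume : Measure ℝ) → Lp ℂ 2 (volume : Measure ℝ) :=
  Lp.compMeasurePreserving (fun x : ℝ => -x) (Measure.measurePreserving_neg volume)

lemma reflect_ae (f : Lp ℂ 2 (volume : Measure ℝ)) : ∀ᵐ x, reflect f x = f (-x) :=
  Lp.coeFn_compMeasurePreserving f (Measure.measurePreserving_neg volume)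

lemma continuous_reflect : Continuous reflect :=
  (Lp.isometry_compMeasurePreserving (Measure.measurePreserving_neg volume)).continuous

/-- The Fourier transform of a real function is hermitian. -/
lemma fourierL2_hermitian (u : L2) :
    ∀ᵐ η, fourierL2 u (-η) = starRingEnd ℂ (fourierL2 u η) := by
  have key : reflect (fourierL2 u) = Complex.conjCLE.toContinuousLinearMap.compLpL 2 volume
      (fourierL2 u) := by
    refine denseRange_toLp.induction_on (p := fun u => reflect (fourierL2 u) =
      Complex.conjCLE.toContinuousLinearMap.compLpL 2 volume (fourierL2 u)) u ?_ ?_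
    · exact isClosed_eq (continuous_reflect.comp continuous_fourierL2)
        ((ContinuousLinearMap.continuous _).comp continuous_fourierL2)
    · intro φ
      refine Lp.ext ?_
      have h := fourierL2_toLp_ae φ
      have h' := (Measure.measurePreserving_neg (volume : Measure ℝ)).quasiMeasurePreserving.ae h
      filter_upwards [reflect_ae (fourierL2 (φ.toLp 2 volume)), h, h',
        ContinuousLinearMap.coeFn_compLpL Complex.conjCLE.toContinuousLinearMap
          (fourierL2 (φ.toLp 2 volume))] with η h1 h2 h3 h4
      rw [h1, h3, h4, h2, fourier_complexSchwartz_neg]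
      rfl
  filter_upwards [reflect_ae (fourierL2 u),
    ContinuousLinearMap.coeFn_compLpL Complex.conjCLE.toContinuousLinearMap
          (fourierL2 u)] with η h1 h2
  rw [← h1, key, h2]
  rfl

/-- The real part of a complex `L²` function. -/
def reL2 (f : Lp ℂ 2 (volume : Measure ℝ)) : L2 := Complex.reCLM.compLpL 2 volume f

lemma reL2_ae (f : Lp ℂ 2 (volume : Measure ℝ)) : ∀ᵐ x, reL2 f x = (f x).re :=
  ContinuousLinearMap.coeFn_compLpL Complex.reCLM f

lemma reL2_complexify (u : L2) : reL2 (complexify u) = u := by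
  refine Lp.ext ?_
  filter_upwards [reL2_ae (complexify u), complexify_ae u] with x h1 h2
  rw [h1, h2, Complex.ofReal_re]

/-- A hermitian function is the Fourier transform of a real function. -/
lemma fourierL2_re_fourierInv {F : Lp ℂ 2 (volume : Measure ℝ)}
    (hF : ∀ᵐ η, F (-η) = starRingEnd ℂ (F η)) : fourierL2 (reL2 (𝓕⁻ F)) = F := by
  set f : Lp ℂ 2 (volume : Measure ℝ) := 𝓕⁻ F with hf
  set u := reL2 f
  set v := reL2 (-Complex.I • f)
  have hdec : f = complexify u + Complex.I • complexify v := by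
    refine Lp.ext ?_
    filter_upwards [Lp.coeFn_add (complexify u) (Complex.I • complexify v),
      Lp.coeFn_smul Complex.I (complexify v), complexify_ae u, complexify_ae v, reL2_ae f,
      reL2_ae (-Complex.I • f), Lp.coeFn_smul (-Complex.I) f] with x h1 h2 h3 h4 h5 h6 h7
    rw [h1, Pi.add_apply, h2, Pi.smul_apply, h3, h4, h5, h6, h7]
    apply Complex.ext <;> simp
  have hFd : F = fourierL2 u + Complex.I • fourierL2 v := by
    have : F = 𝓕 f := (FourierTransform.fourier_fourierInv_eq F).symm
    rw [this, hdec, FourierTransform.fourier_add, FourierTransform.fourier_smul]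
    rfl
  have hae : ∀ᵐ η, F η = fourierL2 u η + Complex.I * fourierL2 v η := by
    rw [hFd]
    filter_upwards [Lp.coeFn_add (fourierL2 u) (Complex.I • fourierL2 v),
      Lp.coeFn_smul Complex.I (fourierL2 v)] with η h1 h2
    rw [h1, Pi.add_apply, h2, Pi.smul_apply, smul_eq_mul]
  have hae' := (Measure.measurePreserving_neg (volume : Measure ℝ)).quasiMeasurePreserving.ae hae
  -- The transforms of the real and imaginary parts are both hermitian, so comparing F(-η) with the
  -- conjugate of F(η) leaves 2i times the conjugate of v̂ equal to 0.
  have hv : v = 0 := by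
    apply fourierL2_ext
    have h0 : fourierL2 0 = 0 := map_zero fourierLI
    rw [h0]
    filter_upwards [hF, hae, hae', fourierL2_hermitian u, fourierL2_hermitian v,
      Lp.coeFn_zero ℂ 2 (volume : Measure ℝ)] with η h1 h2 h3 h4 h5 h6
    rw [h6]
    rw [h3, h2, h4, h5, map_add, map_mul, Complex.conj_I] at h1
    have h7 : Complex.I * starRingEnd ℂ (fourierL2 v η) = 0 := by
      linear_combination h1 / 2
    simpa using h7
  have hc0 : complexify 0 = 0 := map_zero (Complex.ofRealCLM.compLpL 2 volume)
  have h1 : f = complexify u := by rw [hdec, hv, hc0, smul_zero, add_zero]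
  rw [fourierL2, ← h1]
  exact FourierTransform.fourier_fourierInv_eq F


/-! ### Fourier multipliers -/

/-- `v` is the image of `u` under the Fourier multiplier with symbol `m`. -/
def IsMul (m : ℝ → ℂ) (u v : L2) : Prop :=
  ∀ᵐ η, fourierL2 v η = m (2 * Real.pi * η) * fourierL2 u η

/-- A symbol is hermitian if its multiplier preserves real functions. -/
def Herm (m : ℝ → ℂ) : Prop := ∀ ξ, m (-ξ) = starRingEnd ℂ (m ξ)

lemma Herm.ofReal {a : ℝ → ℝ} (h : ∀ ξ, a (-ξ) = a ξ) : Herm (fun ξ => (a ξ : ℂ)) := by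
  intro ξ; simp [h]

lemma Herm.I_mul {a : ℝ → ℝ} (h : ∀ ξ, a (-ξ) = -a ξ) :
    Herm (fun ξ => Complex.I * (a ξ : ℂ)) := by
  intro ξ; simp [h]

lemma Herm.mul {m n : ℝ → ℂ} (hm : Herm m) (hn : Herm n) : Herm (fun ξ => m ξ * n ξ) := by
  intro ξ; simp only [hm ξ, hn ξ, map_mul]

lemma Herm.exp {a : ℝ → ℝ} (h : ∀ ξ, a (-ξ) = -a ξ) (t : ℝ) :
    Herm (fun ξ => Complex.exp (Complex.I * (t * a ξ : ℝ))) := by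
  intro ξ
  simp [← Complex.exp_conj, h]

namespace IsMul

variable {m n : ℝ → ℂ} {u v u' v' w : L2}

lemma unique (h : IsMul m u v) (h' : IsMul m u v') : v = v' := by
  apply fourierL2_ext
  filter_upwards [h, h'] with η h1 h2
  rw [h1, h2]

lemma comp (h : IsMul m u v) (h' : IsMul n v w) : IsMul (fun ξ => n ξ * m ξ) u w := by
  filter_upwards [h, h'] with η h1 h2
  rw [h2, h1]
  exact (mul_assoc _ _ _).symm

lemma congr (h : IsMul m u v) (hmn : ∀ ξ, m ξ = n ξ) : IsMul n u v := by
  filter_upwards [h] with η h1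
  rw [h1, hmn]

lemma add (h : IsMul m u v) (h' : IsMul m u' v') : IsMul m (u + u') (v + v') := by
  filter_upwards [h, h', fourierL2_add_ae u u', fourierL2_add_ae v v'] with η h1 h2 h3 h4
  rw [h4, h3, h1, h2, mul_add]

lemma smul (c : ℝ) (h : IsMul m u v) : IsMul m (c • u) (c • v) := by
  filter_upwards [h, fourierL2_smul_ae c u, fourierL2_smul_ae c v] with η h1 h2 h3
  rw [h2, h3, h1, mul_left_comm]

/-- Comparison of two multipliers applied to the same function. -/
lemma norm_le_mul (h : IsMul m u v) (h' : IsMul n u v') {C : ℝ}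
    (hmn : ∀ ξ, ‖m ξ‖ ≤ C * ‖n ξ‖) : ‖v‖ ≤ C * ‖v'‖ := by
  rw [← norm_fourierL2 v, ← norm_fourierL2 v']
  refine Lp.norm_le_mul_norm_of_ae_le_mul ?_
  filter_upwards [h, h'] with η h1 h2
  rw [h1, h2, norm_mul, norm_mul, ← mul_assoc]
  exact mul_le_mul_of_nonneg_right (hmn _) (norm_nonneg _)

lemma refl (u : L2) : IsMul (fun _ => 1) u u := by
  filter_upwards with η
  rw [one_mul]

lemma norm_le (h : IsMul m u v) {C : ℝ} (hm : ∀ ξ, ‖m ξ‖ ≤ C) : ‖v‖ ≤ C * ‖u‖ :=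
  h.norm_le_mul (refl u) (by simpa using hm)

/-- The adjoint of a multiplier has the conjugate symbol. -/
lemma inner_left (h : IsMul m u v) (h' : IsMul n u' v')
    (hmn : ∀ ξ, starRingEnd ℂ (m ξ) = n ξ) : ⟪v, u'⟫ = ⟪u, v'⟫ := by
  apply inner_congr
  filter_upwards [h, h'] with η h1 h2
  rw [h1, h2, RCLike.inner_apply, RCLike.inner_apply, map_mul, hmn]
  ring

/-- Pairings agree when the symbols agree. -/
lemma inner_eq_inner {m₁ m₂ m₃ m₄ : ℝ → ℂ} {a a' b b' c d : L2}
    (h1 : IsMul m₁ c a) (h2 : IsMul m₂ d b) (h3 : IsMul m₃ c a') (h4 : IsMul m₄ d b')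
    (hm : ∀ ξ, starRingEnd ℂ (m₁ ξ) * m₂ ξ = starRingEnd ℂ (m₃ ξ) * m₄ ξ) :
    ⟪a, b⟫ = ⟪a', b'⟫ := by
  apply inner_congr
  filter_upwards [h1, h2, h3, h4] with η e1 e2 e3 e4
  rw [e1, e2, e3, e4]
  simp only [RCLike.inner_apply, map_mul]
  linear_combination starRingEnd ℂ (fourierL2 c η) * fourierL2 d η * hm (2 * Real.pi * η)

lemma eq_zero_of_ne_zero (h : IsMul m u 0) (hm : ∀ ξ, m ξ ≠ 0) : u = 0 := by
  apply fourierL2_ext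
  have h0 : fourierL2 0 = 0 := map_zero fourierLI
  unfold IsMul at h
  rw [h0] at h ⊢
  filter_upwards [h, Lp.coeFn_zero ℂ 2 (volume : Measure ℝ)] with η h1 h2
  rw [h2] at h1 ⊢
  have := h1.symm
  simpa [hm] using this

/-- Cancellation of the nonvanishing factor of a multiplier. -/
lemma cancel (h : IsMul (fun ξ => n ξ * m ξ) u w) (h' : IsMul n v w) (hn : ∀ ξ, n ξ ≠ 0) :
    IsMul m u v := by
  filter_upwards [h, h'] with η h1 h2
  exact mul_left_cancel₀ (hn (2 * Real.pi * η)) ((h2.symm.trans h1).trans (mul_assoc _ _ _))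

end IsMul

/-- Existence of the image under a hermitian multiplier. -/
lemma exists_isMul {m : ℝ → ℂ} (hm : Herm m) {u : L2}
    (h : MemLp (fun η : ℝ => m (2 * Real.pi * η) * fourierL2 u η) 2 volume) :
    ∃ v, IsMul m u v ∧ complexify v = 𝓕⁻ (h.toLp _) ∧ v = reL2 (𝓕⁻ (h.toLp _)) := by
  have hF : ∀ᵐ η, h.toLp _ (-η) = starRingEnd ℂ (h.toLp _ η) := by
    have h1 := h.coeFn_toLp
    have h2 := (Measure.measurePreserving_neg (volume : Measure ℝ)).quasiMeasurePreserving.ae h1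
    filter_upwards [h1, h2, fourierL2_hermitian u] with η e1 e2 e3
    rw [e1, e2, e3, map_mul, ← hm]
    congr 2
    ring
  have key := fourierL2_re_fourierInv hF
  refine ⟨reL2 (𝓕⁻ (h.toLp _)), ?_, ?_, rfl⟩
  · unfold IsMul
    rw [key]
    exact h.coeFn_toLp
  · have := congrArg (fun F => 𝓕⁻ F) key
    simp only [fourierL2, FourierTransform.fourierInv_fourier_eq] at this
    exact this

/-- The frozen operator `multiplier a` agrees with the relation `IsMul`. -/
lemma multiplier_eq {a : ℝ → ℝ} {u v : L2} (h : IsMul (fun ξ => (a ξ : ℂ)) u v) :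
    multiplier a u = v := by
  have hM : MemLp (fun η : ℝ => (a (2 * Real.pi * η) : ℂ) * 𝓕 (complexify u) η) 2 volume :=
    (memLp_congr_ae h).mp (Lp.memLp (fourierL2 v))
  have h1 : hM.toLp _ = fourierL2 v := by
    refine Lp.ext ?_
    filter_upwards [hM.coeFn_toLp, h] with η e1 e2
    rw [e1, e2]
    rfl
  unfold multiplier
  rw [dif_pos hM, h1, fourierL2, FourierTransform.fourierInv_fourier_eq]
  exact reL2_complexify v

/-- Bounded measurable hermitian symbols. -/
structure BSym (m : ℝ → ℂ) : Prop where
  meas : Measurable m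
  herm : Herm m
  bdd : ∃ C, ∀ ξ, ‖m ξ‖ ≤ C

lemma BSym.mul {m n : ℝ → ℂ} (hm : BSym m) (hn : BSym n) : BSym (fun ξ => m ξ * n ξ) := by
  obtain ⟨C, hC⟩ := hm.bdd
  obtain ⟨D, hD⟩ := hn.bdd
  refine ⟨hm.meas.mul hn.meas, hm.herm.mul hn.herm, C * D, fun ξ => ?_⟩
  rw [norm_mul]
  exact mul_le_mul (hC ξ) (hD ξ) (norm_nonneg _) ((norm_nonneg _).trans (hC ξ))

lemma BSym.memLp {m : ℝ → ℂ} (hm : BSym m) (u : L2) :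
    MemLp (fun η : ℝ => m (2 * Real.pi * η) * fourierL2 u η) 2 volume := by
  obtain ⟨C, hC⟩ := hm.bdd
  have hmeas : Measurable (fun η : ℝ => m (2 * Real.pi * η)) :=
    hm.meas.comp (measurable_const.mul measurable_id)
  refine (Lp.memLp (fourierL2 u)).of_le_mul (c := C)
    (hmeas.aestronglyMeasurable.mul (Lp.aestronglyMeasurable _)) ?_
  filter_upwards with η
  rw [norm_mul]
  exact mul_le_mul_of_nonneg_right (hC _) (norm_nonneg _)

open Classical in
/-- The bounded operator with symbol `m` (and `0` if `m` is not a bounded symbol). -/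
def op (m : ℝ → ℂ) : L2 →L[ℝ] L2 :=
  if h : BSym m then
    LinearMap.mkContinuous
      { toFun := fun u => (exists_isMul h.herm (h.memLp u)).choose
        map_add' := fun u v =>
          (exists_isMul h.herm (h.memLp (u + v))).choose_spec.1.unique
            ((exists_isMul h.herm (h.memLp u)).choose_spec.1.add
              (exists_isMul h.herm (h.memLp v)).choose_spec.1)
        map_smul' := fun c u =>
          (exists_isMul h.herm (h.memLp (c • u))).choose_spec.1.unique
            ((exists_isMul h.herm (h.memLp u)).choose_spec.1.smul c) }
      h.bdd.choose
      (fun u => (exists_isMul h.herm (h.memLp u)).choose_spec.1.norm_le h.bdd.choose_spec)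
  else 0

lemma BSym.isMul {m : ℝ → ℂ} (h : BSym m) (u : L2) : IsMul m u (op m u) := by
  have : op m u = (exists_isMul h.herm (h.memLp u)).choose := by
    unfold op
    rw [dif_pos h]
    rfl
  rw [this]
  exact (exists_isMul h.herm (h.memLp u)).choose_spec.1

lemma BSym.op_op {m n : ℝ → ℂ} (hm : BSym m) (hn : BSym n) (u : L2) :
    op m (op n u) = op (fun ξ => m ξ * n ξ) u :=
  ((hn.isMul u).comp (hm.isMul _)).unique ((hm.mul hn).isMul u)

lemma BSym.op_comm {m n : ℝ → ℂ} (hm : BSym m) (hn : BSym n) (u : L2) :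
    op m (op n u) = op n (op m u) := by
  rw [hm.op_op hn, hn.op_op hm]
  simp_rw [mul_comm]

lemma BSym.isMul_iff {m : ℝ → ℂ} (h : BSym m) {u v : L2} : IsMul m u v ↔ v = op m u :=
  ⟨fun h' => h'.unique (h.isMul u), fun h' => h' ▸ h.isMul u⟩

lemma BSym.inner_real {a : ℝ → ℝ} (h : BSym (fun ξ => (a ξ : ℂ))) (u v : L2) :
    ⟪op (fun ξ => (a ξ : ℂ)) u, v⟫ = ⟪u, op (fun ξ => (a ξ : ℂ)) v⟫ :=
  (h.isMul u).inner_left (h.isMul v) (by simp)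

lemma BSym.ker_eq_zero {m : ℝ → ℂ} (h : BSym m) (hm : ∀ ξ, m ξ ≠ 0) {u : L2}
    (hu : op m u = 0) : u = 0 :=
  IsMul.eq_zero_of_ne_zero (hu ▸ h.isMul u) hm

lemma BSym.op_injective {m : ℝ → ℂ} (h : BSym m) (hm : ∀ ξ, m ξ ≠ 0) :
    Function.Injective (op m) :=
  (injective_iff_map_eq_zero _).mpr fun _ hu => h.ker_eq_zero hm hu

/-- A bounded multiplier with nonvanishing real symbol has dense range. -/
lemma BSym.denseRange {a : ℝ → ℝ} (h : BSym (fun ξ => (a ξ : ℂ))) (ha : ∀ ξ, a ξ ≠ 0) :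
    DenseRange (op (fun ξ => (a ξ : ℂ))) := by
  -- The operator is symmetric, so the orthogonal complement of its range is its kernel, which is
  -- trivial.
  have h1 : ((op (fun ξ => (a ξ : ℂ))).range)ᗮ = ⊥ := by
    rw [Submodule.eq_bot_iff]
    intro v hv
    refine h.ker_eq_zero (by simpa using ha) ?_
    rw [← inner_self_eq_zero (𝕜 := ℝ), ← h.inner_real]
    exact hv _ ⟨op (fun ξ => (a ξ : ℂ)) v, rfl⟩
  have h2 := Submodule.topologicalClosure_eq_top_iff.mpr h1
  rw [DenseRange, dense_iff_closure_eq]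
  have h3 := congrArg (fun S : Submodule ℝ L2 => (S : Set L2)) h2
  rw [Submodule.topologicalClosure_coe] at h3
  exact h3

/-! ### Translations -/

/-- Translation `u ↦ u(· + h)`. -/
def translate (h : ℝ) : L2 → L2 :=
  Lp.compMeasurePreserving (fun x : ℝ => x + h) (measurePreserving_add_right volume h)

lemma translate_ae (h : ℝ) (u : L2) : ∀ᵐ x, translate h u x = u (x + h) :=
  Lp.coeFn_compMeasurePreserving u (measurePreserving_add_right volume h)

lemma continuous_translate (h : ℝ) : Continuous (translate h) :=
  (Lp.isometry_compMeasurePreserving (measurePreserving_add_right volume h)).continuous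

lemma bSym_exp {a : ℝ → ℝ} (ha : Measurable a) (h : ∀ ξ, a (-ξ) = -a ξ) (t : ℝ) :
    BSym (fun ξ => Complex.exp (Complex.I * (t * a ξ : ℝ))) := by
  refine ⟨?_, Herm.exp h t, 1, fun ξ => ?_⟩
  · exact Complex.measurable_exp.comp (measurable_const.mul
      (Complex.measurable_ofReal.comp (measurable_const.mul ha)))
  · rw [mul_comm, Complex.norm_exp_ofReal_mul_I]

lemma translate_toLp (h : ℝ) (φ : 𝓢(ℝ, ℝ)) :
    ∃ ψ : 𝓢(ℝ, ℝ), translate h (φ.toLp 2 volume) = ψ.toLp 2 volume ∧ ∀ x, ψ x = φ (x + h) := by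
  let ψ : 𝓢(ℝ, ℝ) := SchwartzMap.compSubConstCLM ℝ (-h) φ
  have hψ : ∀ x, ψ x = φ (x + h) := fun x => by simp [ψ]
  refine ⟨ψ, Lp.ext ?_, hψ⟩
  have h2 := (measurePreserving_add_right (volume : Measure ℝ) h).quasiMeasurePreserving.ae
    (φ.coeFn_toLp 2 volume)
  filter_upwards [translate_ae h (φ.toLp 2 volume), h2, ψ.coeFn_toLp 2 volume] with x e1 e2 e3
  rw [e1, e2, e3, hψ]

/-- On Schwartz functions this is a change of variables in the Fourier integral; both sides are
continuous in u. -/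
lemma translate_isMul (h : ℝ) (u : L2) :
    IsMul (fun ξ => Complex.exp (Complex.I * (h * ξ : ℝ))) u (translate h u) := by
  have hB := bSym_exp (a := fun ξ => ξ) measurable_id (fun _ => rfl) h
  rw [hB.isMul_iff]
  refine denseRange_toLp.induction_on (p := fun u => translate h u = op _ u) u
    (isClosed_eq (continuous_translate h) (op _).continuous) ?_
  intro φ
  rw [← hB.isMul_iff]
  obtain ⟨ψ, h1, h2⟩ := translate_toLp h φ
  rw [h1]
  filter_upwards [fourierL2_toLp_ae φ, fourierL2_toLp_ae ψ] with η e1 e2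
  rw [e1, e2, SchwartzMap.fourier_coe, SchwartzMap.fourier_coe, Real.fourier_eq', Real.fourier_eq',
    ← integral_const_mul, ← integral_add_right_eq_self _ (-h)]
  congr 1
  ext x
  simp only [complexSchwartz_apply, h2, smul_eq_mul, neg_add_cancel_right]
  rw [← mul_assoc, ← Complex.exp_add]
  congr 2
  simp
  ring


/-! ### The Sobolev bound -/

/-- A real `L²` function with integrable Fourier transform is bounded. -/
lemma abs_le_integral_norm_fourierL2 (u : L2) (hF : Integrable (fun η => fourierL2 u η)) :
    ∀ᵐ x, |u x| ≤ ∫ η, ‖fourierL2 u η‖ := by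
  set F : ℝ → ℂ := fun η => fourierL2 u η with hFdef
  have hcont : Continuous (𝓕⁻ F) := by
    rw [Real.fourierInv_eq_fourier_comp_neg]
    exact VectorFourier.fourierIntegral_continuous Real.continuous_fourierChar
      (by exact continuous_inner) hF.comp_neg
  have hbound : ∀ x, ‖𝓕⁻ F x‖ ≤ ∫ η, ‖F η‖ := by
    intro x
    rw [Real.fourierInv_eq]
    refine (norm_integral_le_integral_norm _).trans (le_of_eq ?_)
    simp
  have hinv : 𝓕⁻ (fourierL2 u) = complexify u := FourierTransform.fourierInv_fourier_eq _
  -- The L² inverse transform is that of tempered distributions, and moving the transform onto φ and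
  -- back turns it into the integral formula for F. So both candidates have the same pairings and
  -- agree almost everywhere.
  have hpair : ∀ φ : 𝓢(ℝ, ℂ), ∫ x, φ x • complexify u x = ∫ x, φ x • 𝓕⁻ F x := by
    intro φ
    have h1 := congrArg (fun T : 𝓢'(ℝ, ℂ) => T φ)
      (Lp.fourierInv_toTemperedDistribution_eq (fourierL2 u))
    simp only [TemperedDistribution.fourierInv_apply, Lp.toTemperedDistribution_apply, hinv] at h1
    rw [← h1]
    have h2 : ∀ x, (𝓕⁻ φ) x = 𝓕 (φ : ℝ → ℂ) (-x) := by
      intro x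
      rw [SchwartzMap.fourierInv_coe, Real.fourierInv_eq_fourier_neg]
    simp_rw [h2]
    rw [← integral_neg_eq_self (fun x => 𝓕 (φ : ℝ → ℂ) (-x) • fourierL2 u x),
      Real.fourierInv_eq_fourier_comp_neg]
    simp only [neg_neg]
    have h3 := VectorFourier.integral_fourierIntegral_smul_eq_flip (L := innerₗ ℝ)
      Real.continuous_fourierChar (by exact continuous_inner)
      (SchwartzMap.integrable (μ := volume) φ) hF.comp_neg
    rw [flip_innerₗ] at h3
    exact h3
  have hae : ∀ᵐ x, complexify u x = 𝓕⁻ F x := by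
    refine ae_eq_of_integral_contDiff_smul_eq ?_ hcont.locallyIntegrable ?_
    · exact (Lp.memLp (complexify u)).locallyIntegrable (by norm_num)
    · intro g hg hgc
      have hg2 : HasCompactSupport (fun x => (g x : ℂ)) := hgc.comp_left (g := fun y : ℝ => (y : ℂ)) (by simp)
      have : ∫ x, (g x : ℂ) • complexify u x = ∫ x, (g x : ℂ) • 𝓕⁻ F x :=
        hpair (hg2.toSchwartzMap (Complex.ofRealCLM.contDiff.comp hg))
      simpa using this
  filter_upwards [hae, complexify_ae u] with x h1 h2
  have h3 := hbound x
  rw [← h1, h2] at h3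
  simpa using h3

/-! ### Fractional regularity and translations -/

lemma enorm_sq_eq_lintegral (v : L2) : ‖v‖ₑ ^ 2 = ∫⁻ η, ‖fourierL2 v η‖ₑ ^ 2 := by
  have h1 : ‖v‖ₑ = ‖fourierL2 v‖ₑ := by
    rw [← ofReal_norm, ← ofReal_norm, norm_fourierL2]
  rw [h1, Lp.enorm_def, eLpNorm_eq_lintegral_rpow_enorm_toReal (by norm_num) (by norm_num)]
  simp only [ENNReal.toReal_ofNat, ENNReal.rpow_ofNat, one_div]
  rw [← ENNReal.rpow_ofNat, ← ENNReal.rpow_mul]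
  norm_num

lemma translate_sub_enorm_sq (h : ℝ) (u : L2) :
    ‖translate h u - u‖ₑ ^ 2 = ∫⁻ η,
      ‖Complex.exp (Complex.I * (h * (2 * Real.pi * η) : ℝ)) - 1‖ₑ ^ 2 * ‖fourierL2 u η‖ₑ ^ 2 := by
  rw [enorm_sq_eq_lintegral]
  refine lintegral_congr_ae ?_
  filter_upwards [translate_isMul h u, fourierL2_sub_ae (translate h u) u] with η h1 h2
  rw [h2, h1, ← mul_pow, ← enorm_mul, sub_mul, one_mul]

/-- The squared size of `e^{iy} - 1`. -/
def oscSq (y : ℝ) : ENNReal := ‖Complex.exp (Complex.I * (y : ℝ)) - 1‖ₑ ^ 2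

lemma measurable_oscSq : Measurable oscSq := by
  unfold oscSq
  fun_prop

lemma oscSq_abs (y : ℝ) : oscSq |y| = oscSq y := by
  rcases abs_choice y with h | h
  · rw [h]
  · rw [h]
    unfold oscSq
    have : Complex.exp (Complex.I * ((-y : ℝ) : ℂ)) - 1
        = starRingEnd ℂ (Complex.exp (Complex.I * (y : ℂ)) - 1) := by
      rw [map_sub, ← Complex.exp_conj]
      simp
    rw [this, RCLike.enorm_conj]

/-- Controls the weighted integral near h = 0; `oscSq_le_four` controls it at infinity. -/
lemma oscSq_le_sq (y : ℝ) : oscSq y ≤ ENNReal.ofReal (y ^ 2) := by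
  unfold oscSq
  rw [← ofReal_norm, ← ENNReal.ofReal_pow (norm_nonneg _)]
  apply ENNReal.ofReal_le_ofReal
  rw [← sq_abs y]
  gcongr
  exact Real.norm_exp_I_mul_ofReal_sub_one_le

lemma oscSq_le_four (y : ℝ) : oscSq y ≤ ENNReal.ofReal 4 := by
  unfold oscSq
  rw [← ofReal_norm, ← ENNReal.ofReal_pow (norm_nonneg _)]
  apply ENNReal.ofReal_le_ofReal
  have : ‖Complex.exp (Complex.I * (y : ℂ)) - 1‖ ≤ 2 := by
    refine (norm_sub_le _ _).trans ?_
    rw [mul_comm, Complex.norm_exp_ofReal_mul_I, norm_one]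
    norm_num
  nlinarith [norm_nonneg (Complex.exp (Complex.I * (y : ℂ)) - 1)]

lemma lintegral_comp_mul_left_real (f : ℝ → ENNReal) (hf : Measurable f) {a : ℝ} (ha : 0 < a) :
    ∫⁻ x, f (a * x) = ENNReal.ofReal a⁻¹ * ∫⁻ x, f x := by
  have h := Real.map_volume_mul_left (a := a) ha.ne'
  rw [abs_of_pos (inv_pos.mpr ha)] at h
  rw [← lintegral_map hf (measurable_const_mul a), h, lintegral_smul_measure, smul_eq_mul]

/-- The weight `h^{-1-2θ}` on the half-line. -/
def fracWeight (θ h : ℝ) : ENNReal :=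
  (Ioi (0 : ℝ)).indicator (fun h => ENNReal.ofReal (h ^ (-1 - 2 * θ))) h

lemma measurable_fracWeight (θ : ℝ) : Measurable (fracWeight θ) :=
  (ENNReal.measurable_ofReal.comp (measurable_id.pow_const _)).indicator measurableSet_Ioi

/-- The constant in the representation of `|ξ|^{2θ}` by differences. -/
def fracConst (θ : ℝ) : ENNReal := ∫⁻ h, fracWeight θ h * oscSq h

/-- The weight is homogeneous of degree -1 - 2θ, so the substitution h ↦ |ξ|h, with its Jacobian,
extracts exactly |ξ|^{2θ}. -/
lemma lintegral_fracWeight_mul_oscSq (θ ξ : ℝ) (hξ : ξ ≠ 0) :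
    ∫⁻ h, fracWeight θ h * oscSq (h * ξ) = ENNReal.ofReal (|ξ| ^ (2 * θ)) * fracConst θ := by
  have hpos : 0 < |ξ| := abs_pos.mpr hξ
  have h1 : ∀ h, fracWeight θ h * oscSq (h * ξ)
      = ENNReal.ofReal (|ξ| ^ (1 + 2 * θ)) * (fracWeight θ (|ξ| * h) * oscSq (|ξ| * h)) := by
    intro h
    by_cases hh : 0 < h
    · have h2 : 0 < |ξ| * h := mul_pos hpos hh
      have e1 : fracWeight θ h = ENNReal.ofReal (h ^ (-1 - 2 * θ)) := indicator_of_mem hh _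
      have e2 : fracWeight θ (|ξ| * h) = ENNReal.ofReal ((|ξ| * h) ^ (-1 - 2 * θ)) :=
        indicator_of_mem (s := Ioi (0 : ℝ)) h2 _
      have e3 : oscSq (h * ξ) = oscSq (|ξ| * h) := by
        rw [← oscSq_abs (h * ξ), abs_mul, abs_of_pos hh, mul_comm]
      rw [e1, e2, e3, ← mul_assoc, ← ENNReal.ofReal_mul (by positivity),
        Real.mul_rpow hpos.le hh.le, ← mul_assoc, ← Real.rpow_add hpos]
      norm_num
    · have h2 : ¬ 0 < |ξ| * h := fun h3 => hh (pos_of_mul_pos_right h3 hpos.le)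
      have e1 : fracWeight θ h = 0 := indicator_of_notMem (s := Ioi (0 : ℝ)) hh _
      have e2 : fracWeight θ (|ξ| * h) = 0 := indicator_of_notMem (s := Ioi (0 : ℝ)) h2 _
      rw [e1, e2]; simp
  simp_rw [h1]
  rw [lintegral_const_mul' _ _ ENNReal.ofReal_ne_top,
    lintegral_comp_mul_left_real (fun h => fracWeight θ h * oscSq h)
      ((measurable_fracWeight θ).mul measurable_oscSq) hpos, ← mul_assoc,
    ← ENNReal.ofReal_mul (by positivity), Real.rpow_add hpos, Real.rpow_one]
  unfold fracConst
  congr 2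
  field_simp

/-- Near 0 the integrand is at most h^{1-2θ}, integrable because θ < 1; on (1, ∞) it is at most
4h^{-1-2θ}, integrable because θ > 0. -/
lemma fracConst_ne_top {θ : ℝ} (h0 : 0 < θ) (h1 : θ < 1) : fracConst θ ≠ ⊤ := by
  have i1 : IntegrableOn (fun h : ℝ => h ^ (1 - 2 * θ)) (Ioc 0 1) := by
    have := intervalIntegral.intervalIntegrable_rpow' (a := 0) (b := 1) (r := 1 - 2 * θ)
      (by linarith)
    rwa [intervalIntegrable_iff_integrableOn_Ioc_of_le zero_le_one] at this
  have i2 : IntegrableOn (fun h : ℝ => 4 * h ^ (-1 - 2 * θ)) (Ioi 1) :=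
    (integrableOn_Ioi_rpow_of_lt (by linarith) one_pos).const_mul 4
  have e : fracConst θ = (∫⁻ h in Ioc 0 1, fracWeight θ h * oscSq h)
      + ∫⁻ h in Ioi 1, fracWeight θ h * oscSq h := by
    rw [← lintegral_union measurableSet_Ioi (by
      rw [Set.disjoint_left]; intro x hx hx'; exact absurd hx.2 (not_le.mpr hx')),
      Ioc_union_Ioi_eq_Ioi zero_le_one, ← lintegral_indicator measurableSet_Ioi]
    unfold fracConst
    congr 1
    ext h
    by_cases hh : h ∈ Ioi (0 : ℝ)
    · rw [indicator_of_mem hh]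
    · rw [indicator_of_notMem hh, fracWeight, indicator_of_notMem hh, zero_mul]
  rw [e, ENNReal.add_ne_top]
  constructor
  · refine ne_top_of_le_ne_top i1.lintegral_lt_top.ne ?_
    refine setLIntegral_mono' measurableSet_Ioc ?_
    intro h hh
    have hw : fracWeight θ h = ENNReal.ofReal (h ^ (-1 - 2 * θ)) :=
      indicator_of_mem (s := Ioi (0 : ℝ)) hh.1 _
    calc fracWeight θ h * oscSq h
        ≤ ENNReal.ofReal (h ^ (-1 - 2 * θ)) * ENNReal.ofReal (h ^ 2) := by
          rw [hw]; gcongr; exact oscSq_le_sq h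
      _ = ENNReal.ofReal (h ^ (1 - 2 * θ)) := by
          rw [← ENNReal.ofReal_mul (Real.rpow_nonneg hh.1.le _), ← Real.rpow_two,
            ← Real.rpow_add hh.1]
          congr 2; ring
  · refine ne_top_of_le_ne_top i2.lintegral_lt_top.ne ?_
    refine setLIntegral_mono' measurableSet_Ioi ?_
    intro h hh
    have hpos : 0 < h := one_pos.trans hh
    have hw : fracWeight θ h = ENNReal.ofReal (h ^ (-1 - 2 * θ)) :=
      indicator_of_mem (s := Ioi (0 : ℝ)) hpos _
    calc fracWeight θ h * oscSq h
        ≤ ENNReal.ofReal (h ^ (-1 - 2 * θ)) * ENNReal.ofReal 4 := by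
          rw [hw]; gcongr; exact oscSq_le_four h
      _ = ENNReal.ofReal (4 * h ^ (-1 - 2 * θ)) := by
          rw [← ENNReal.ofReal_mul (Real.rpow_nonneg hpos.le _), mul_comm]

/-- The integrand is positive on (0, 1), because the imaginary part sin y of e^{iy} - 1 does not
vanish there. -/
lemma fracConst_ne_zero (θ : ℝ) : fracConst θ ≠ 0 := by
  unfold fracConst
  rw [Ne, lintegral_eq_zero_iff (f := fun h => fracWeight θ h * oscSq h)
    ((measurable_fracWeight θ).mul measurable_oscSq)]
  intro h
  have h1 : volume (Ioo (0 : ℝ) 1) = 0 := by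
    refine measure_mono_null ?_ (ae_iff.mp h)
    intro y hy
    simp only [mem_ofPred_eq, Pi.zero_apply, mul_eq_zero, not_or]
    constructor
    · have hw : fracWeight θ y = ENNReal.ofReal (y ^ (-1 - 2 * θ)) :=
        indicator_of_mem (s := Ioi (0 : ℝ)) hy.1 _
      rw [hw, ENNReal.ofReal_eq_zero, not_le]
      exact Real.rpow_pos_of_pos hy.1 _
    · unfold oscSq
      simp only [ne_eq, OfNat.ofNat_ne_zero, not_false_eq_true, pow_eq_zero_iff, enorm_eq_zero]
      intro h2
      have h3 := congrArg Complex.im (sub_eq_zero.mp h2)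
      rw [mul_comm, Complex.exp_ofReal_mul_I_im, Complex.one_im] at h3
      have := Real.sin_pos_of_pos_of_lt_pi hy.1 (by linarith [hy.2, Real.pi_gt_three])
      exact this.ne' h3
  simp at h1

lemma translate_sub_enorm_sq' (h : ℝ) (u : L2) :
    ‖translate h u - u‖ₑ ^ 2 = ∫⁻ η, oscSq (h * (2 * Real.pi * η)) * ‖fourierL2 u η‖ₑ ^ 2 :=
  translate_sub_enorm_sq h u

/-- Gagliardo's formula for the fractional seminorm: Plancherel for each difference, then Tonelli.
It expresses θ derivatives by translation differences alone, which pointwise Lipschitz maps do not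
increase beyond their constant. -/
lemma lintegral_fracWeight_translate {θ : ℝ} (u : L2) :
    ∫⁻ h, fracWeight θ h * ‖translate h u - u‖ₑ ^ 2
      = fracConst θ * ∫⁻ η, ENNReal.ofReal (|2 * Real.pi * η| ^ (2 * θ)) * ‖fourierL2 u η‖ₑ ^ 2 := by
  have hm : AEMeasurable (fun η => ‖fourierL2 u η‖ₑ ^ 2) volume :=
    (Lp.aestronglyMeasurable (fourierL2 u)).enorm.pow_const 2
  have hm2 : Measurable (fun z : ℝ × ℝ => fracWeight θ z.1 * oscSq (z.1 * (2 * Real.pi * z.2))) :=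
    ((measurable_fracWeight θ).comp measurable_fst).mul
      (measurable_oscSq.comp (measurable_fst.mul (measurable_const.mul measurable_snd)))
  have h0 : ∀ᵐ η : ℝ, η ≠ 0 := by simp [ae_iff, measure_singleton]
  calc ∫⁻ h, fracWeight θ h * ‖translate h u - u‖ₑ ^ 2
      = ∫⁻ h, ∫⁻ η, fracWeight θ h * oscSq (h * (2 * Real.pi * η)) * ‖fourierL2 u η‖ₑ ^ 2 := by
        congr 1
        ext h
        rw [translate_sub_enorm_sq', ← lintegral_const_mul'']
        · simp_rw [mul_assoc]
        · exact (measurable_oscSq.comp (by fun_prop)).aemeasurable.mul hm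
    _ = ∫⁻ η, ∫⁻ h, fracWeight θ h * oscSq (h * (2 * Real.pi * η)) * ‖fourierL2 u η‖ₑ ^ 2 := by
        refine lintegral_lintegral_swap ?_
        exact hm2.aemeasurable.mul (hm.comp_snd)
    _ = ∫⁻ η, fracConst θ
          * (ENNReal.ofReal (|2 * Real.pi * η| ^ (2 * θ)) * ‖fourierL2 u η‖ₑ ^ 2) := by
        refine lintegral_congr_ae ?_
        filter_upwards [h0] with η hη
        rw [lintegral_mul_const'', lintegral_fracWeight_mul_oscSq θ _ (by positivity)]
        · ring
        · exact (hm2.comp (measurable_id.prodMk measurable_const)).aemeasurable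
    _ = _ := by
        rw [lintegral_const_mul'']
        refine AEMeasurable.mul ?_ hm
        exact (ENNReal.measurable_ofReal.comp (by fun_prop)).aemeasurable

lemma lintegral_frac_le_of_lt_one {θ L : ℝ} (h0 : 0 < θ) (h1 : θ < 1) {u g : L2}
    (hL : ∀ h, ‖translate h g - g‖ₑ ≤ ENNReal.ofReal L * ‖translate h u - u‖ₑ) :
    ∫⁻ η, ENNReal.ofReal (|2 * Real.pi * η| ^ (2 * θ)) * ‖fourierL2 g η‖ₑ ^ 2
      ≤ ENNReal.ofReal L ^ 2 *
        ∫⁻ η, ENNReal.ofReal (|2 * Real.pi * η| ^ (2 * θ)) * ‖fourierL2 u η‖ₑ ^ 2 := by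
  rw [← ENNReal.mul_le_mul_iff_right (fracConst_ne_zero θ) (fracConst_ne_top h0 h1),
    ← lintegral_fracWeight_translate, mul_left_comm, ← lintegral_fracWeight_translate,
    ← lintegral_const_mul' _ _ (by simp)]
  refine lintegral_mono fun h => ?_
  rw [mul_left_comm, ← mul_pow]
  gcongr
  exact hL h

/-- For θ = 1 the constant `fracConst` is infinite, so this endpoint is reached through difference
quotients with steps 1/(n+1) instead. -/
lemma tendsto_oscSq_div (ξ : ℝ) :
    Tendsto (fun n : ℕ => ENNReal.ofReal ((n + 1 : ℝ) ^ 2) * oscSq ((n + 1 : ℝ)⁻¹ * ξ)) atTop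
      (𝓝 (ENNReal.ofReal (|ξ| ^ 2))) := by
  have hd : HasDerivAt (fun h : ℝ => Complex.exp (Complex.I * ((h * ξ : ℝ) : ℂ)))
      (Complex.I * ξ) 0 := by
    have h1 : HasDerivAt (fun h : ℝ => Complex.I * ((h * ξ : ℝ) : ℂ)) (Complex.I * ξ) 0 := by
      have h2 : HasDerivAt (fun h : ℝ => h * ξ) ξ 0 := by
        simpa using (hasDerivAt_id (0 : ℝ)).mul_const ξ
      exact h2.ofReal_comp.const_mul Complex.I
    simpa using h1.cexp
  have h2 := hd.tendsto_slope_zero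
  have h3 : Tendsto (fun n : ℕ => (n + 1 : ℝ)⁻¹) atTop (𝓝[≠] 0) := by
    refine tendsto_nhdsWithin_iff.mpr ⟨?_, Eventually.of_forall fun n => ?_⟩
    · simpa using tendsto_one_div_add_atTop_nhds_zero_nat (𝕜 := ℝ)
    · have : (0 : ℝ) < n + 1 := by positivity
      exact (inv_pos.mpr this).ne'
  have h4 := ((h2.comp h3).norm.pow 2)
  have h5 := (ENNReal.continuous_ofReal.tendsto _).comp h4
  refine (h5.congr ?_).trans (by simp)
  intro n
  have hn : (0 : ℝ) < n + 1 := by positivity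
  simp only [Function.comp_apply, zero_add, inv_inv, zero_mul, Complex.ofReal_zero, mul_zero,
    Complex.exp_zero, norm_smul, mul_pow]
  rw [ENNReal.ofReal_mul (by positivity), Real.norm_of_nonneg hn.le]
  congr 1
  rw [ENNReal.ofReal_pow (norm_nonneg _), ofReal_norm]
  rfl

/-- Fatou's lemma for the difference quotients of g, each of which is bounded by the matching
quotient of u and hence by its full first derivative. -/
lemma lintegral_frac_le_one {L : ℝ} {u g : L2}
    (hL : ∀ h, ‖translate h g - g‖ₑ ≤ ENNReal.ofReal L * ‖translate h u - u‖ₑ) :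
    ∫⁻ η, ENNReal.ofReal (|2 * Real.pi * η| ^ 2) * ‖fourierL2 g η‖ₑ ^ 2
      ≤ ENNReal.ofReal L ^ 2 *
        ∫⁻ η, ENNReal.ofReal (|2 * Real.pi * η| ^ 2) * ‖fourierL2 u η‖ₑ ^ 2 := by
  have hm : ∀ v : L2, AEMeasurable (fun η => ‖fourierL2 v η‖ₑ ^ 2) volume := fun v =>
    (Lp.aestronglyMeasurable (fourierL2 v)).enorm.pow_const 2
  have hmo : ∀ h : ℝ, AEMeasurable (fun η => oscSq (h * (2 * Real.pi * η))) volume := fun h =>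
    (measurable_oscSq.comp (by fun_prop)).aemeasurable
  have hmul : ∀ (h : ℝ) (v : L2), AEMeasurable
      (fun η => oscSq (h * (2 * Real.pi * η)) * ‖fourierL2 v η‖ₑ ^ 2) volume :=
    fun h v => (hmo h).mul (hm v)
  have hlim : ∀ η, ENNReal.ofReal (|2 * Real.pi * η| ^ 2) * ‖fourierL2 g η‖ₑ ^ 2
      = liminf (fun n : ℕ => ENNReal.ofReal ((n + 1 : ℝ) ^ 2)
        * oscSq ((n + 1 : ℝ)⁻¹ * (2 * Real.pi * η)) * ‖fourierL2 g η‖ₑ ^ 2) atTop := by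
    intro η
    refine (Tendsto.liminf_eq ?_).symm
    exact ENNReal.Tendsto.mul_const (tendsto_oscSq_div _) (Or.inr (by simp))
  simp_rw [hlim]
  refine (lintegral_liminf_le' fun n => ((hmo _).const_mul _).mul (hm g)).trans ?_
  refine liminf_le_of_le (by isBoundedDefault) (fun b hb => ?_)
  obtain ⟨n, hn⟩ := hb.exists
  refine hn.trans ?_
  have hn0 : (0 : ℝ) < n + 1 := by positivity
  calc ∫⁻ η, ENNReal.ofReal ((n + 1 : ℝ) ^ 2)
        * oscSq ((n + 1 : ℝ)⁻¹ * (2 * Real.pi * η)) * ‖fourierL2 g η‖ₑ ^ 2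
      = ENNReal.ofReal ((n + 1 : ℝ) ^ 2) * ‖translate (n + 1 : ℝ)⁻¹ g - g‖ₑ ^ 2 := by
        rw [translate_sub_enorm_sq', ← lintegral_const_mul'' _ (hmul _ g)]
        simp_rw [mul_assoc]
    _ ≤ ENNReal.ofReal ((n + 1 : ℝ) ^ 2)
          * (ENNReal.ofReal L * ‖translate (n + 1 : ℝ)⁻¹ u - u‖ₑ) ^ 2 := by
        gcongr
        exact hL _
    _ = ENNReal.ofReal L ^ 2 * (ENNReal.ofReal ((n + 1 : ℝ) ^ 2)
          * ‖translate (n + 1 : ℝ)⁻¹ u - u‖ₑ ^ 2) := by ring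
    _ ≤ _ := by
        gcongr
        rw [translate_sub_enorm_sq', ← lintegral_const_mul'' _ (hmul _ u)]
        refine lintegral_mono fun η => ?_
        rw [← mul_assoc]
        gcongr
        refine (mul_le_mul_right (oscSq_le_sq _) _).trans (le_of_eq ?_)
        rw [← ENNReal.ofReal_mul (by positivity), mul_pow, ← mul_assoc, ← mul_pow,
          mul_inv_cancel₀ hn0.ne', one_pow, one_mul, sq_abs]

/-- If the translation differences of `g` are controlled by those of `u`, then so are fractional
derivatives of order `0 < θ ≤ 1`. -/
lemma exists_frac_isMul {θ L : ℝ} (h0 : 0 < θ) (h1 : θ ≤ 1) (hL0 : 0 ≤ L) {u u₁ g : L2}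
    (hL : ∀ h, ‖translate h g - g‖ ≤ L * ‖translate h u - u‖)
    (hu : IsMul (fun ξ => ((|ξ| ^ θ : ℝ) : ℂ)) u u₁) :
    ∃ g₁, IsMul (fun ξ => ((|ξ| ^ θ : ℝ) : ℂ)) g g₁ ∧ ‖g₁‖ ≤ L * ‖u₁‖ := by
  have hL' : ∀ h, ‖translate h g - g‖ₑ ≤ ENNReal.ofReal L * ‖translate h u - u‖ₑ := by
    intro h
    rw [← ofReal_norm, ← ofReal_norm, ← ENNReal.ofReal_mul hL0]
    exact ENNReal.ofReal_le_ofReal (hL h)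
  have key : ∫⁻ η, ENNReal.ofReal (|2 * Real.pi * η| ^ (2 * θ)) * ‖fourierL2 g η‖ₑ ^ 2
      ≤ ENNReal.ofReal L ^ 2 *
        ∫⁻ η, ENNReal.ofReal (|2 * Real.pi * η| ^ (2 * θ)) * ‖fourierL2 u η‖ₑ ^ 2 := by
    rcases h1.lt_or_eq with h1 | rfl
    · exact lintegral_frac_le_of_lt_one h0 h1 hL'
    · simpa using lintegral_frac_le_one hL'
  have hsq : ∀ (v : L2) (η : ℝ), ENNReal.ofReal (|2 * Real.pi * η| ^ (2 * θ))
      * ‖fourierL2 v η‖ₑ ^ 2 = ‖((|2 * Real.pi * η| ^ θ : ℝ) : ℂ) * fourierL2 v η‖ₑ ^ 2 := by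
    intro v η
    rw [enorm_mul, mul_pow]
    congr 1
    rw [← ofReal_norm, ← ENNReal.ofReal_pow (norm_nonneg _), Complex.norm_real,
      Real.norm_of_nonneg (by positivity), ← Real.rpow_natCast, ← Real.rpow_mul (abs_nonneg _)]
    congr 2
    push_cast; ring
  have hu1 : ∫⁻ η, ENNReal.ofReal (|2 * Real.pi * η| ^ (2 * θ)) * ‖fourierL2 u η‖ₑ ^ 2
      = ‖u₁‖ₑ ^ 2 := by
    rw [enorm_sq_eq_lintegral]
    refine lintegral_congr_ae ?_
    filter_upwards [hu] with η h
    rw [h, hsq]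
  rw [hu1] at key
  have hmem : MemLp (fun η : ℝ => ((|2 * Real.pi * η| ^ θ : ℝ) : ℂ) * fourierL2 g η) 2 volume := by
    refine ⟨?_, ?_⟩
    · refine AEStronglyMeasurable.mul ?_ (Lp.aestronglyMeasurable _)
      exact (Complex.measurable_ofReal.comp
        ((by fun_prop : Measurable fun η : ℝ => |2 * Real.pi * η|).pow_const θ)).aestronglyMeasurable
    · rw [eLpNorm_lt_top_iff_lintegral_rpow_enorm_lt_top (by norm_num) (by norm_num)]
      simp only [ENNReal.toReal_ofNat, ENNReal.rpow_ofNat]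
      simp_rw [← hsq]
      refine key.trans_lt (ENNReal.mul_lt_top (by simp) (by simp))
  obtain ⟨g₁, hg₁, -⟩ := exists_isMul (m := fun ξ => ((|ξ| ^ θ : ℝ) : ℂ))
    (Herm.ofReal (fun ξ => by rw [abs_neg])) hmem
  refine ⟨g₁, hg₁, ?_⟩
  have hg1 : ‖g₁‖ₑ ^ 2 ≤ (ENNReal.ofReal L * ‖u₁‖ₑ) ^ 2 := by
    rw [mul_pow]
    refine le_trans (le_of_eq ?_) key
    rw [enorm_sq_eq_lintegral]
    refine lintegral_congr_ae ?_
    filter_upwards [hg₁] with η h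
    rw [h, hsq]
  rw [ENNReal.pow_le_pow_left_iff (by norm_num)] at hg1
  rw [← ofReal_norm, ← ofReal_norm, ← ENNReal.ofReal_mul hL0] at hg1
  exact (ENNReal.ofReal_le_ofReal_iff (by positivity)).mp hg1


/-! ### The power nonlinearity -/

/-- Bernoulli's inequality for b/a: the convex function x^q lies above its tangent at a. -/
lemma rpow_tangent_le {a b q : ℝ} (ha : 0 ≤ a) (hb : 0 ≤ b) (hq : 1 < q) :
    a ^ q + q * a ^ (q - 1) * (b - a) ≤ b ^ q := by
  rcases ha.eq_or_lt with rfl | ha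
  · rw [Real.zero_rpow (by linarith), Real.zero_rpow (by linarith)]
    simpa using Real.rpow_nonneg hb q
  · have h1 := one_add_mul_self_le_rpow_one_add (s := b / a - 1) (p := q)
      (by have := div_nonneg hb ha.le; linarith) hq.le
    rw [add_sub_cancel, Real.div_rpow hb ha.le, le_div_iff₀ (Real.rpow_pos_of_pos ha q)] at h1
    have h2 : a ^ q = a ^ (q - 1) * a := by
      rw [← Real.rpow_add_one ha.ne']; ring_nf
    refine le_trans (le_of_eq ?_) h1
    rw [h2]
    field_simp

lemma abs_rpow_mul_self {p : ℝ} (hp : 1 < p) (x : ℝ) :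
    |x| ^ (p - 1) * x * x = |x| ^ (p + 1) := by
  rw [mul_assoc, ← abs_mul_abs_self x, ← mul_assoc, ← Real.rpow_add_one' (abs_nonneg _) (by linarith),
    ← Real.rpow_add_one' (abs_nonneg _) (by linarith)]
  ring_nf

/-- The tangent line inequality on the half-line for |x| and |y|, combined with xy ≤ |x||y|. It
yields both the momentum law and the derivative of 𝒬. -/
lemma abs_rpow_convex {p : ℝ} (hp : 1 < p) (x y : ℝ) :
    |x| ^ (p + 1) + (p + 1) * (|x| ^ (p - 1) * x * (y - x)) ≤ |y| ^ (p + 1) := by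
  have h1 := rpow_tangent_le (abs_nonneg x) (abs_nonneg y) (q := p + 1) (by linarith)
  have h2 : |x| ^ (p + 1 - 1) = |x| ^ (p - 1) * |x| := by
    rw [← Real.rpow_add_one' (abs_nonneg _) (by linarith)]; ring_nf
  have h3 : x * y ≤ |x| * |y| := by rw [← abs_mul]; exact le_abs_self _
  have h4 : |x| * |x| = x * x := abs_mul_abs_self x
  have h5 : |x| ^ (p - 1) * (x * y) ≤ |x| ^ (p - 1) * (|x| * |y|) :=
    mul_le_mul_of_nonneg_left h3 (Real.rpow_nonneg (abs_nonneg _) _)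
  rw [h2] at h1
  have h6 : (p + 1) * (|x| ^ (p - 1) * x * (y - x))
      = (p + 1) * (|x| ^ (p - 1) * (x * y) - |x| ^ (p - 1) * (|x| * |x|)) := by rw [h4]; ring
  have h7 : (p + 1) * (|x| ^ (p - 1) * |x|) * (|y| - |x|)
      = (p + 1) * (|x| ^ (p - 1) * (|x| * |y|) - |x| ^ (p - 1) * (|x| * |x|)) := by ring
  rw [h6]
  rw [h7] at h1
  nlinarith

lemma rpow_sub_rpow_le {a b M p : ℝ} (hp : 1 < p) (ha : 0 ≤ a) (hab : a ≤ b) (hb : b ≤ M) :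
    b ^ p - a ^ p ≤ p * M ^ (p - 1) * (b - a) := by
  have h1 := rpow_tangent_le (ha.trans hab) ha hp
  have h2 : b ^ (p - 1) ≤ M ^ (p - 1) :=
    Real.rpow_le_rpow (ha.trans hab) hb (by linarith)
  have h3 : p * b ^ (p - 1) * (b - a) ≤ p * M ^ (p - 1) * (b - a) := by
    have := sub_nonneg.mpr hab
    gcongr
  linarith

lemma abs_rpow_mul_of_nonneg {p x : ℝ} (hp : 1 < p) (hx : 0 ≤ x) : |x| ^ (p - 1) * x = x ^ p := by
  rw [abs_of_nonneg hx, ← Real.rpow_add_one' hx (by linarith)]; ring_nf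

lemma abs_rpow_mul_neg {p x : ℝ} : |-x| ^ (p - 1) * -x = -(|x| ^ (p - 1) * x) := by
  rw [abs_neg]; ring

lemma abs_power_sub_le_of_nonneg {p M x y : ℝ} (hp : 1 < p) (hx0 : 0 ≤ x) (hyx : |y| ≤ x)
    (hx : x ≤ M) :
    |(|x| ^ (p - 1) * x) - |y| ^ (p - 1) * y| ≤ p * M ^ (p - 1) * |x - y| := by
  have hM : 0 ≤ M := hx0.trans hx
  have hMp : 0 ≤ M ^ (p - 1) := Real.rpow_nonneg hM _
  rcases le_total 0 y with hy | hy
  · have hyx' : y ≤ x := (le_abs_self y).trans hyx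
    rw [abs_rpow_mul_of_nonneg hp hx0, abs_rpow_mul_of_nonneg hp hy,
      abs_of_nonneg (sub_nonneg.mpr hyx'),
      abs_of_nonneg (sub_nonneg.mpr (Real.rpow_le_rpow hy hyx' (by linarith)))]
    exact rpow_sub_rpow_le hp hy hyx' hx
  · obtain ⟨z, rfl⟩ : ∃ z, y = -z := ⟨-y, by ring⟩
    have hz : 0 ≤ z := by linarith
    have hzx : z ≤ x := by rwa [abs_neg, abs_of_nonneg hz] at hyx
    rw [abs_rpow_mul_neg, abs_rpow_mul_of_nonneg hp hx0, abs_rpow_mul_of_nonneg hp hz,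
      sub_neg_eq_add, sub_neg_eq_add, abs_of_nonneg (by positivity), abs_of_nonneg (by positivity)]
    have e : ∀ w : ℝ, 0 ≤ w → w ≤ M → w ^ p ≤ M ^ (p - 1) * w := by
      intro w hw hwM
      rw [← abs_rpow_mul_of_nonneg hp hw, abs_of_nonneg hw]
      exact mul_le_mul_of_nonneg_right (Real.rpow_le_rpow hw hwM (by linarith)) hw
    have h1 := e x hx0 hx
    have h2 := e z hz (hzx.trans hx)
    have h3 : 0 ≤ M ^ (p - 1) * (x + z) := by positivity
    nlinarith

/-- By symmetry and oddness of the power one may assume |y| ≤ x, which is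
`abs_power_sub_le_of_nonneg`. -/
lemma abs_power_sub_le {p M x y : ℝ} (hp : 1 < p) (hx : |x| ≤ M) (hy : |y| ≤ M) :
    |(|x| ^ (p - 1) * x) - |y| ^ (p - 1) * y| ≤ p * M ^ (p - 1) * |x - y| := by
  have main : ∀ x y : ℝ, |x| ≤ M → |y| ≤ |x| →
      |(|x| ^ (p - 1) * x) - |y| ^ (p - 1) * y| ≤ p * M ^ (p - 1) * |x - y| := by
    intro x y hx hyx
    rcases le_total 0 x with h | h
    · rw [abs_of_nonneg h] at hx hyx
      exact abs_power_sub_le_of_nonneg hp h hyx hx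
    · rw [abs_of_nonpos h] at hx hyx
      have := abs_power_sub_le_of_nonneg (y := -y) hp (neg_nonneg.mpr h) (by rwa [abs_neg]) hx
      rw [abs_rpow_mul_neg, abs_rpow_mul_neg, ← neg_sub', ← neg_sub', abs_neg, abs_neg] at this
      exact this
  rcases le_total |y| |x| with h | h
  · exact main x y hx h
  · rw [abs_sub_comm, abs_sub_comm x]
    exact main y x hy h

/-- `|u| ≤ M` almost everywhere. -/
def AEBdd (M : ℝ) (u : L2) : Prop := ∀ᵐ x, |u x| ≤ M

section Nonlinearity

variable {p M : ℝ} {u v : L2}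

lemma memLp_power (hp : 1 < p) (hu : AEBdd M u) :
    MemLp (fun x : ℝ => -|u x| ^ (p - 1) * u x) 2 volume := by
  have hm : AEStronglyMeasurable (fun x : ℝ => -|u x| ^ (p - 1) * u x) volume := by
    have := (Lp.aestronglyMeasurable u).aemeasurable
    exact (((this.norm.pow_const (p - 1)).neg).mul this).aestronglyMeasurable
  refine (Lp.memLp u).of_le_mul (c := M ^ (p - 1)) hm ?_
  filter_upwards [hu] with x hx
  rw [norm_mul, norm_neg, Real.norm_of_nonneg (Real.rpow_nonneg (abs_nonneg _) _)]
  exact mul_le_mul_of_nonneg_right (Real.rpow_le_rpow (abs_nonneg _) hx (by linarith))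
    (norm_nonneg _)

lemma nonlinearity_ae (hp : 1 < p) (hu : AEBdd M u) :
    ∀ᵐ x, nonlinearity p u x = -|u x| ^ (p - 1) * u x := by
  unfold nonlinearity
  rw [dif_pos (memLp_power hp hu)]
  exact MemLp.coeFn_toLp _

lemma norm_nonlinearity_sub_le (hp : 1 < p) (hu : AEBdd M u) (hv : AEBdd M v) :
    ‖nonlinearity p u - nonlinearity p v‖ ≤ p * M ^ (p - 1) * ‖u - v‖ := by
  refine Lp.norm_le_mul_norm_of_ae_le_mul ?_
  filter_upwards [nonlinearity_ae hp hu, nonlinearity_ae hp hv, hu, hv,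
    Lp.coeFn_sub u v, Lp.coeFn_sub (nonlinearity p u) (nonlinearity p v)] with x h1 h2 h3 h4 h5 h6
  rw [h5, h6, Pi.sub_apply, Pi.sub_apply, h1, h2, Real.norm_eq_abs, Real.norm_eq_abs,
    ← abs_neg (-|u x| ^ (p - 1) * u x - _)]
  convert abs_power_sub_le hp h3 h4 using 2
  ring

/-- A pointwise map commutes with translations, so its Lipschitz bound passes to differences. This
is the hypothesis of `exists_frac_isMul`. -/
lemma norm_translate_nonlinearity_sub_le (hp : 1 < p) (hu : AEBdd M u) (h : ℝ) :
    ‖translate h (nonlinearity p u) - nonlinearity p u‖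
      ≤ p * M ^ (p - 1) * ‖translate h u - u‖ := by
  have hq := (measurePreserving_add_right (volume : Measure ℝ) h).quasiMeasurePreserving
  refine Lp.norm_le_mul_norm_of_ae_le_mul ?_
  filter_upwards [nonlinearity_ae hp hu, hq.ae (nonlinearity_ae hp hu), hu, hq.ae hu,
    Lp.coeFn_sub (translate h u) u, translate_ae h u, translate_ae h (nonlinearity p u),
    Lp.coeFn_sub (translate h (nonlinearity p u)) (nonlinearity p u)]
    with x h1 h2 h3 h4 h5 h6 h7 h8
  rw [h5, h8, Pi.sub_apply, Pi.sub_apply, h6, h7, h1, h2, Real.norm_eq_abs, Real.norm_eq_abs,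
    ← abs_neg (-|u (x + h)| ^ (p - 1) * u (x + h) - _)]
  convert abs_power_sub_le hp h4 h3 using 2
  ring

lemma nonlinearity_zero (hp : 1 < p) : nonlinearity p 0 = 0 := by
  have h0 : AEBdd 0 (0 : L2) := by
    filter_upwards [Lp.coeFn_zero ℝ 2 (volume : Measure ℝ)] with x hx
    rw [hx]; simp
  refine Lp.ext ?_
  filter_upwards [Lp.coeFn_zero ℝ 2 (volume : Measure ℝ), nonlinearity_ae hp h0] with x h1 h2
  rw [h2, h1]; simp

lemma norm_nonlinearity_le (hp : 1 < p) (hM : 0 ≤ M) (hu : AEBdd M u) :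
    ‖nonlinearity p u‖ ≤ p * M ^ (p - 1) * ‖u‖ := by
  have h0 : AEBdd M (0 : L2) := by
    filter_upwards [Lp.coeFn_zero ℝ 2 (volume : Measure ℝ)] with x hx
    rw [hx]; simpa using hM
  have := norm_nonlinearity_sub_le hp hu h0
  rwa [nonlinearity_zero hp, sub_zero, sub_zero] at this

lemma integrable_power (hp : 1 < p) (hu : AEBdd M u) :
    Integrable (fun x => |u x| ^ (p + 1)) := by
  have h1 : Integrable (fun x => ⟪u x, nonlinearity p u x⟫) := L2.integrable_inner _ _
  refine h1.neg.congr ?_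
  filter_upwards [nonlinearity_ae hp hu] with x hx
  rw [← abs_rpow_mul_self hp]
  simp [hx]

lemma inner_nonlinearity_self (hp : 1 < p) (hu : AEBdd M u) :
    ⟪nonlinearity p u, u⟫ = -Q p u := by
  rw [L2.inner_def, Q, ← integral_neg]
  refine integral_congr_ae ?_
  filter_upwards [nonlinearity_ae hp hu] with x hx
  rw [← abs_rpow_mul_self hp]
  simp [hx]
  ring

lemma Q_le (hp : 1 < p) (hu : AEBdd M u) : Q p u ≤ M ^ (p - 1) * ‖u‖ ^ 2 := by
  rw [← real_inner_self_eq_norm_sq, L2.inner_def, ← integral_const_mul]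
  refine integral_mono_ae (integrable_power hp hu) ((L2.integrable_inner u u).const_mul _) ?_
  filter_upwards [hu] with x hx
  rw [← abs_rpow_mul_self hp, real_inner_self_eq_norm_sq, Real.norm_eq_abs, sq_abs, sq, ← mul_assoc]
  have := Real.rpow_le_rpow (abs_nonneg _) hx (z := p - 1) (by linarith)
  nlinarith [mul_self_nonneg (u x)]

/-- Convexity of `𝒬`. -/
lemma Q_convex (hp : 1 < p) (hu : AEBdd M u) (hv : AEBdd M v) :
    Q p u - (p + 1) * ⟪nonlinearity p u, v - u⟫ ≤ Q p v := by
  rw [L2.inner_def, Q, Q, ← integral_const_mul,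
    ← integral_sub (integrable_power hp hu) ((L2.integrable_inner _ _).const_mul _)]
  refine integral_mono_ae ((integrable_power hp hu).sub ((L2.integrable_inner _ _).const_mul _))
    (integrable_power hp hv) ?_
  filter_upwards [nonlinearity_ae hp hu, Lp.coeFn_sub v u] with x h1 h2
  refine le_trans (le_of_eq ?_) (abs_rpow_convex hp (u x) (v x))
  rw [h1, h2]
  simp only [Pi.sub_apply, RCLike.inner_apply, conj_trivial]
  ring

lemma Q_smul (p : ℝ) {c : ℝ} (hc : 0 ≤ c) (u : L2) : Q p (c • u) = c ^ (p + 1) * Q p u := by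
  rw [Q, Q, ← integral_const_mul]
  refine integral_congr_ae ?_
  filter_upwards [Lp.coeFn_smul c u] with x hx
  rw [hx, Pi.smul_apply, smul_eq_mul, abs_mul, abs_of_nonneg hc,
    Real.mul_rpow hc (abs_nonneg _)]

lemma Q_translate (p h : ℝ) (u : L2) : Q p (translate h u) = Q p u := by
  rw [Q, Q, ← integral_add_right_eq_self (fun x => |u x| ^ (p + 1)) h]
  refine integral_congr_ae ?_
  filter_upwards [translate_ae h u] with x hx
  rw [hx]

lemma AEBdd.translate (hu : AEBdd M u) (h : ℝ) : AEBdd M (translate h u) := by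
  have hq := (measurePreserving_add_right (volume : Measure ℝ) h).quasiMeasurePreserving
  filter_upwards [translate_ae h u, hq.ae hu] with x h1 h2
  rwa [h1]

/-- `u_x` is orthogonal to the nonlinearity `g(u)`; the pairing is split between two functions
`a` and `N`. -/
lemma inner_eq_zero_of_translation (hp : 1 < p) (hu : AEBdd M u) {a N : L2}
    (haN : ∀ᵐ η : ℝ, inner ℂ (fourierL2 a η) (fourierL2 N η)
      = Complex.I * (2 * Real.pi * η : ℝ) *
        inner ℂ (fourierL2 u η) (fourierL2 (nonlinearity p u) η)) :
    ⟪a, N⟫ = 0 := by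
  set g := nonlinearity p u
  let F : ℝ → ℝ → ℝ := fun h η => (starRingEnd ℂ (Complex.exp (Complex.I * (h * (2 * Real.pi * η) : ℝ)))
    * inner ℂ (fourierL2 u η) (fourierL2 g η)).re
  let F' : ℝ → ℝ → ℝ := fun h η => (starRingEnd ℂ (Complex.I * (2 * Real.pi * η : ℝ) *
    Complex.exp (Complex.I * (h * (2 * Real.pi * η) : ℝ)))
    * inner ℂ (fourierL2 u η) (fourierL2 g η)).re
  have hF : ∀ h, ⟪translate h u, g⟫ = ∫ η, F h η := by
    intro h
    rw [inner_eq_integral_re]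
    refine integral_congr_ae ?_
    filter_upwards [translate_isMul h u] with η e
    rw [e]
    simp only [F, RCLike.inner_apply, map_mul]
    congr 1
    ring
  have hint := integrable_inner_fourierL2 u g
  have hder : HasDerivAt (fun h => ∫ η, F h η) (∫ η, F' 0 η) 0 := by
    -- The h-derivative of the Fourier integrand has modulus at most |ξ û ĝ|, which is the modulus
    -- of the integrable product attached to a and N; u and g need not each carry half a derivative.
    refine (hasDerivAt_integral_of_dominated_loc_of_deriv_le (F := F) (F' := F')
      (bound := fun η => ‖inner ℂ (fourierL2 a η) (fourierL2 N η)‖) (Metric.ball_mem_nhds 0 one_pos)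
      ?_ ?_ ?_ ?_ (integrable_inner_fourierL2 a N).norm ?_).2
    · refine Eventually.of_forall fun h => ?_
      refine Complex.continuous_re.comp_aestronglyMeasurable
        (AEStronglyMeasurable.mul ?_ hint.aestronglyMeasurable)
      exact Continuous.aestronglyMeasurable (by fun_prop)
    · refine hint.re.congr ?_
      filter_upwards with η
      simp [F]
    · refine Complex.continuous_re.comp_aestronglyMeasurable
        (AEStronglyMeasurable.mul ?_ hint.aestronglyMeasurable)
      exact Continuous.aestronglyMeasurable (by fun_prop)
    · filter_upwards [haN] with η e h _
      rw [e]
      refine (Complex.abs_re_le_norm _).trans (le_of_eq ?_)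
      simp only [norm_mul, map_mul, RCLike.norm_conj]
      rw [mul_comm Complex.I (((h * (2 * Real.pi * η) : ℝ)) : ℂ), Complex.norm_exp_ofReal_mul_I,
        mul_one]
    · filter_upwards with η h _
      have h1 : HasDerivAt (fun h : ℝ => Complex.I * ((h * (2 * Real.pi * η) : ℝ) : ℂ))
          (Complex.I * (2 * Real.pi * η : ℝ)) h := by
        have h2 : HasDerivAt (fun h : ℝ => h * (2 * Real.pi * η)) (2 * Real.pi * η) h := by
          simpa using (hasDerivAt_id h).mul_const (2 * Real.pi * η)
        exact h2.ofReal_comp.const_mul Complex.I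
      have h3 := h1.cexp
      have h4 := ((Complex.conjCLE.toContinuousLinearMap.hasFDerivAt.comp_hasDerivAt h h3).mul_const
        (inner ℂ (fourierL2 u η) (fourierL2 g η)))
      have h5 := Complex.reCLM.hasFDerivAt.comp_hasDerivAt h h4
      rw [mul_comm (Complex.exp _)] at h5
      exact h5
  have hval : ∫ η, F' 0 η = -⟪a, N⟫ := by
    rw [inner_eq_integral_re, ← integral_neg]
    refine integral_congr_ae ?_
    filter_upwards [haN] with η e
    rw [e]
    simp [F']
  -- Convexity at u together with 𝒬(u(· + h)) = 𝒬(u) gives ⟨g(u), u(· + h)⟩ ≥ ⟨g(u), u⟩, so the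
  -- derivative at h = 0 vanishes.
  have hmin : IsLocalMin (fun h => ∫ η, F h η) 0 := by
    refine Eventually.of_forall fun h => ?_
    have h0 : translate 0 u = u := by
      refine Lp.ext ?_
      filter_upwards [translate_ae 0 u] with x hx
      rw [hx, add_zero]
    have h1 := Q_convex hp hu (hu.translate h)
    rw [Q_translate, inner_sub_right] at h1
    change (∫ η, F 0 η) ≤ ∫ η, F h η
    rw [← hF, ← hF, h0, real_inner_comm, real_inner_comm g]
    nlinarith
  have := hmin.hasDerivAt_eq_zero hder
  rw [hval] at this
  linarith

end Nonlinearity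


/-! ### Hilbert space lemmas -/

section Hilbert

variable {H : Type*} [NormedAddCommGroup H] [InnerProductSpace ℝ H]

/-- Characterization of the image of a ball under an injective symmetric operator. -/
lemma exists_preimage_of_bound [CompleteSpace H] (A : H →L[ℝ] H)
    (hA : ∀ x y : H, ⟪A x, y⟫ = ⟪x, A y⟫)
    (hinj : Function.Injective A) {C : ℝ} (hC : 0 ≤ C) {y : H}
    (h : ∀ φ : H, ⟪y, φ⟫ ≤ C * ‖A φ‖) : ∃ v, A v = y ∧ ‖v‖ ≤ C := by
  let E := LinearEquiv.ofInjective (A : H →ₗ[ℝ] H) hinj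
  have hE : ∀ ψ, A (E.symm ψ) = (ψ : H) := fun ψ =>
    congrArg Subtype.val (E.apply_symm_apply ψ)
  have hE' : ∀ φ, E.symm ⟨A φ, ⟨φ, rfl⟩⟩ = φ := fun φ => E.symm_apply_apply φ
  -- The functional Aφ ↦ ⟨y, φ⟩ is bounded by C on the range of A. A norm-preserving extension is
  -- represented by the desired v.
  let f : StrongDual ℝ (LinearMap.range (A : H →ₗ[ℝ] H)) :=
    LinearMap.mkContinuous ((innerₗ H y).comp E.symm.toLinearMap) C (by
      intro ψ
      have h1 := h (E.symm ψ)
      have h2 := h (-(E.symm ψ))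
      rw [inner_neg_right, map_neg, norm_neg, hE] at h2
      rw [hE] at h1
      change |⟪y, E.symm ψ⟫| ≤ C * ‖(ψ : H)‖
      exact abs_le.mpr ⟨by linarith, h1⟩)
  obtain ⟨g, hg, hgn⟩ := exists_extension_norm_eq _ f
  refine ⟨(InnerProductSpace.toDual ℝ H).symm g, ?_, ?_⟩
  · refine ext_inner_right ℝ fun φ => ?_
    rw [hA, InnerProductSpace.toDual_symm_apply]
    have := hg ⟨A φ, ⟨φ, rfl⟩⟩
    rw [this]
    change ⟪y, E.symm ⟨A φ, ⟨φ, rfl⟩⟩⟫ = _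
    rw [hE']
  · rw [LinearIsometryEquiv.norm_map, hgn]
    exact LinearMap.mkContinuous_norm_le _ hC _

/-- Bounded families converging after smoothing converge weakly. -/
lemma tendsto_inner_of_bounded {ι : Type*} {F : Filter ι} (A : H →L[ℝ] H)
    (hA : ∀ x y : H, ⟪A x, y⟫ = ⟪x, A y⟫) (hd : DenseRange A) {x : ι → H} {x₀ : H} {C : ℝ}
    (hx : ∀ᶠ i in F, ‖x i‖ ≤ C) (hAx : Tendsto (fun i => A (x i)) F (𝓝 (A x₀)))
    {φ : ι → H} {φ₀ : H} (hφ : Tendsto φ F (𝓝 φ₀)) :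
    Tendsto (fun i => ⟪x i, φ i⟫) F (𝓝 ⟪x₀, φ₀⟫) := by
  rw [Metric.tendsto_nhds]
  intro ε hε
  set D := |C| + ‖x₀‖ + 1 with hD
  have hDpos : 0 < D := by positivity
  -- Replacing φ₀ by Aψ costs little because the x i are bounded, and A can then be moved onto x i,
  -- where convergence is known. The factor 4D leaves ε/4 for each of four terms.
  obtain ⟨ψ, hψ⟩ := hd.exists_dist_lt φ₀ (show 0 < ε / (4 * D) by positivity)
  have h1 : Tendsto (fun i => ⟪A (x i), ψ⟫) F (𝓝 ⟪A x₀, ψ⟫) := hAx.inner tendsto_const_nhds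
  filter_upwards [hx, Metric.tendsto_nhds.mp h1 (ε / 4) (by positivity),
    Metric.tendsto_nhds.mp hφ (ε / (4 * D)) (by positivity)] with i e1 e2 e3
  rw [Real.dist_eq] at e2 ⊢
  rw [dist_eq_norm] at e3 hψ
  have hxi : ‖x i‖ ≤ D := by rw [hD]; linarith [le_abs_self C, norm_nonneg x₀]
  have hx0 : ‖x₀‖ ≤ D := by rw [hD]; linarith [abs_nonneg C]
  have dec : ⟪x i, φ i⟫ - ⟪x₀, φ₀⟫ = ⟪x i, φ i - φ₀⟫ + ⟪x i, φ₀ - A ψ⟫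
      + (⟪A (x i), ψ⟫ - ⟪A x₀, ψ⟫) - ⟪x₀, φ₀ - A ψ⟫ := by
    rw [hA, hA]
    simp only [inner_sub_right]
    ring
  have b1 : |⟪x i, φ i - φ₀⟫| < ε / 4 := by
    refine (abs_real_inner_le_norm _ _).trans_lt ?_
    calc ‖x i‖ * ‖φ i - φ₀‖ ≤ D * ‖φ i - φ₀‖ := by gcongr
      _ < D * (ε / (4 * D)) := by gcongr
      _ = ε / 4 := by field_simp
  have b2 : ∀ z : H, ‖z‖ ≤ D → |⟪z, φ₀ - A ψ⟫| < ε / 4 := by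
    intro z hz
    refine (abs_real_inner_le_norm _ _).trans_lt ?_
    calc ‖z‖ * ‖φ₀ - A ψ‖ ≤ D * ‖φ₀ - A ψ‖ := by gcongr
      _ < D * (ε / (4 * D)) := by gcongr
      _ = ε / 4 := by field_simp
  have b3 := b2 _ hxi
  have b4 := b2 _ hx0
  rw [dec, abs_lt]
  rw [abs_lt] at b1 b3 b4 e2
  constructor <;> linarith [b1.1, b1.2, b3.1, b3.2, b4.1, b4.2, e2.1, e2.2]

/-- The derivative of a quadratic form along a curve that is Lipschitz and weakly
differentiable. -/
lemma hasDerivWithinAt_quadratic (A Λ : H →L[ℝ] H)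
    (hA : ∀ x y : H, ⟪A x, y⟫ = ⟪x, A y⟫) (hd : DenseRange A)
    (hΛ : ∀ x y : H, ⟪Λ x, y⟫ = ⟪x, Λ y⟫) {V : ℝ → H} {W : H} {S : Set ℝ} {t C : ℝ}
    (hlip : ∀ᶠ s in 𝓝[S] t, ‖V s - V t‖ ≤ C * |s - t|)
    (hder : HasDerivWithinAt (fun s => A (V s)) (A W) S t) :
    HasDerivWithinAt (fun s => ⟪V s, Λ (V s)⟫) (2 * ⟪W, Λ (V t)⟫) S t := by
  rw [hasDerivWithinAt_iff_tendsto_slope] at hder ⊢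
  have hle : 𝓝[S \ {t}] t ≤ 𝓝[S] t := nhdsWithin_mono _ sdiff_subset
  have hlip' := hlip.filter_mono hle
  have hcont : Tendsto V (𝓝[S \ {t}] t) (𝓝 (V t)) := by
    rw [tendsto_iff_norm_sub_tendsto_zero]
    refine squeeze_zero' (Eventually.of_forall fun _ => norm_nonneg _) hlip' ?_
    have : Tendsto (fun s : ℝ => C * |s - t|) (𝓝 t) (𝓝 (C * |t - t|)) :=
      (continuous_const.mul (continuous_id.sub continuous_const).abs).tendsto t
    rw [sub_self, abs_zero, mul_zero] at this
    exact this.mono_left nhdsWithin_le_nhds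
  -- By symmetry of Λ the slope of the quadratic form is this pairing. The slopes of V are bounded
  -- by C and converge after applying A, hence weakly; the other factor converges in norm.
  have h1 : Tendsto (fun s => ⟪slope V t s, Λ (V s + V t)⟫) (𝓝[S \ {t}] t)
      (𝓝 ⟪W, Λ (V t + V t)⟫) := by
    refine tendsto_inner_of_bounded A hA hd (C := C) ?_ ?_
      ((Λ.continuous.tendsto _).comp (hcont.add_const (V t)))
    · filter_upwards [hlip', self_mem_nhdsWithin] with s hs hst
      have hne : 0 < |s - t| := abs_pos.mpr (sub_ne_zero.mpr hst.2)
      rw [slope_def_module, norm_smul, norm_inv, Real.norm_eq_abs, inv_mul_le_iff₀ hne, mul_comm]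
      exact hs
    · refine hder.congr fun s => ?_
      rw [slope_def_module, slope_def_module, map_smul, map_sub]
  have h2 : ⟪W, Λ (V t + V t)⟫ = 2 * ⟪W, Λ (V t)⟫ := by
    rw [map_add, inner_add_right]; ring
  rw [h2] at h1
  refine h1.congr fun s => ?_
  rw [slope_def_module, slope_def_module, real_inner_smul_left, smul_eq_mul]
  congr 1
  rw [map_add, inner_add_right, inner_sub_left, inner_sub_left, ← hΛ (V s) (V t),
    real_inner_comm (V t) (Λ (V s))]
  ring

end Hilbert

/-! ### Calculus on half-open time intervals -/

section Calculus

variable {E : Type*} [NormedAddCommGroup E] [NormedSpace ℝ E] [CompleteSpace E]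

lemma uIcc_subset_Ico {T t s : ℝ} (ht : t ∈ Ico 0 T) (hs : s ∈ Ico 0 T) : uIcc t s ⊆ Ico 0 T :=
  ordConnected_Ico.uIcc_subset ht hs

/-- The integral of a continuous derivative on a half-open interval. -/
lemma integral_eq_sub_of_hasDerivWithinAt_Ico {T : ℝ} {y z : ℝ → E}
    (hz : ContinuousOn z (Ico 0 T))
    (h : ∀ t ∈ Ico 0 T, HasDerivWithinAt y (z t) (Ico 0 T) t) {t s : ℝ} (ht : t ∈ Ico 0 T)
    (hs : s ∈ Ico 0 T) : ∫ τ in t..s, z τ = y s - y t := by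
  have hsub := uIcc_subset_Ico ht hs
  refine intervalIntegral.integral_eq_sub_of_hasDeriv_right
    (fun x hx => ((h x (hsub hx)).continuousWithinAt).mono hsub) ?_
    (hz.mono hsub).intervalIntegrable
  intro x hx
  have hx' : x ∈ Ioo 0 T :=
    ⟨(le_min ht.1 hs.1).trans_lt hx.1, hx.2.trans (max_lt ht.2 hs.2)⟩
  exact ((h x (Ioo_subset_Ico_self hx')).hasDerivAt (Ico_mem_nhds hx'.1 hx'.2)).hasDerivWithinAt

/-- The derivative of the integral of a continuous function on a half-open interval. -/
lemma hasDerivWithinAt_integral_Ico {T : ℝ} {z : ℝ → E} (hz : ContinuousOn z (Ico 0 T))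
    {t : ℝ} (ht : t ∈ Ico 0 T) :
    HasDerivWithinAt (fun s => ∫ τ in (0 : ℝ)..s, z τ) (z t) (Ico 0 T) t := by
  obtain ⟨t', htt', ht'T⟩ := exists_between ht.2
  have h0 : (0 : ℝ) ≤ t' := ht.1.trans htt'.le
  have hcI : ContinuousOn z (Icc 0 t') := hz.mono fun x hx => ⟨hx.1, hx.2.trans_lt ht'T⟩
  have hc : Continuous (IccExtend h0 ((Icc 0 t').domRestrict z)) :=
    (continuousOn_iff_continuous_domRestrict.mp hcI).Icc_extend'
  have he : ∀ x ∈ Icc 0 t', IccExtend h0 ((Icc 0 t').domRestrict z) x = z x := fun x hx => by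
    rw [IccExtend_of_mem h0 _ hx]; rfl
  have hd := (hc.integral_hasStrictDerivAt 0 t).hasDerivAt.hasDerivWithinAt (s := Ico 0 T)
  rw [he t ⟨ht.1, htt'.le⟩] at hd
  have hint : ∀ s ∈ Icc 0 t', (∫ τ in (0 : ℝ)..s, z τ)
      = ∫ τ in (0 : ℝ)..s, IccExtend h0 ((Icc 0 t').domRestrict z) τ := by
    intro s hs
    refine intervalIntegral.integral_congr fun x hx => ?_
    rw [uIcc_of_le hs.1] at hx
    exact (he x ⟨hx.1, hx.2.trans hs.2⟩).symm
  refine hd.congr_of_eventuallyEq ?_ (hint t ⟨ht.1, htt'.le⟩)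
  filter_upwards [self_mem_nhdsWithin, mem_nhdsWithin_of_mem_nhds (Iio_mem_nhds htt')] with s h1 h2
  exact hint s ⟨h1.1, le_of_lt h2⟩

/-- Differentiability can be tested with a separating family of operators. -/
lemma hasDerivWithinAt_of_separating {ι F : Type*} [NormedAddCommGroup F] [NormedSpace ℝ F]
    [CompleteSpace F] (A : ι → E →L[ℝ] F) (hA : ∀ v, (∀ i, A i v = 0) → v = 0) {T : ℝ} {y z : ℝ → E}
    (hz : ContinuousOn z (Ico 0 T))
    (h : ∀ i, ∀ t ∈ Ico 0 T, HasDerivWithinAt (fun s => A i (y s)) (A i (z t)) (Ico 0 T) t)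
    {t : ℝ} (ht : t ∈ Ico 0 T) : HasDerivWithinAt y (z t) (Ico 0 T) t := by
  have hT : (0 : ℝ) ∈ Ico 0 T := ⟨le_rfl, ht.1.trans_lt ht.2⟩
  -- The two sides have the same image under every A i, so they agree; the integral of the
  -- continuous z can then be differentiated in E itself.
  have hy : ∀ s ∈ Ico 0 T, y s = y 0 + ∫ τ in (0 : ℝ)..s, z τ := by
    intro s hs
    rw [← sub_eq_zero]
    refine hA _ fun i => ?_
    have h1 : ∫ τ in (0 : ℝ)..s, A i (z τ) = A i (y s) - A i (y 0) :=
      integral_eq_sub_of_hasDerivWithinAt_Ico ((A i).continuous.comp_continuousOn hz) (h i) hT hs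
    rw [map_sub, map_add, ← (A i).intervalIntegral_comp_comm
      (hz.mono (uIcc_subset_Ico hT hs)).intervalIntegrable, h1]
    abel
  exact ((hasDerivWithinAt_integral_Ico hz ht).const_add (y 0)).congr hy (hy t ht)

end Calculus


/-! ### Symbols of the equation -/

/-- The assumptions on the symbols and the exponents. -/
structure Setup (l b : ℝ → ℝ) (ρ r c₁ c₂ c₃ c₄ p : ℝ) : Prop where
  cont_l : Continuous l
  cont_b : Continuous b
  even_l : ∀ ξ, l (-ξ) = l ξ
  even_b : ∀ ξ, b (-ξ) = b ξ
  hρ : 0 ≤ ρ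
  hr : 0 ≤ r
  hrρ : 1 ≤ r + ρ / 2
  hs : 1 / 2 < r / 2 + ρ / 2
  hc₁ : 0 < c₁
  hc₂ : 0 < c₂
  hc₃ : 0 < c₃
  hc₄ : 0 < c₄
  hl : ∀ ξ, c₁ ^ 2 * (1 + ξ ^ 2) ^ (ρ / 2) ≤ l ξ ∧ l ξ ≤ c₂ ^ 2 * (1 + ξ ^ 2) ^ (ρ / 2)
  hb : ∀ ξ, c₃ ^ 2 * (1 + ξ ^ 2) ^ (-r / 2) ≤ b ξ ∧ b ξ ≤ c₄ ^ 2 * (1 + ξ ^ 2) ^ (-r / 2)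
  hp : 1 < p

/-- The symbol of `B^{1/2} L^{-1/2}`. -/
def symK (l b : ℝ → ℝ) (ξ : ℝ) : ℝ := √(b ξ) / √(l ξ)

/-- The symbol of `-i B^{1/2} ∂ₓ`. -/
def symD (b : ℝ → ℝ) (ξ : ℝ) : ℝ := ξ * √(b ξ)

/-- The symbol of `-i L^{1/2} ∂ₓ`. -/
def symOm (l : ℝ → ℝ) (ξ : ℝ) : ℝ := ξ * √(l ξ)

/-- The symbol of `L^{-1/2}`. -/
def symLam (l : ℝ → ℝ) (ξ : ℝ) : ℝ := (√(l ξ))⁻¹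

/-- A smoothing symbol. -/
def symS (ρ : ℝ) (ξ : ℝ) : ℝ := (1 + ξ ^ 2) ^ (-(2 + ρ))

lemma bSym_real {a : ℝ → ℝ} (hc : Measurable a) (he : ∀ ξ, a (-ξ) = a ξ) {C : ℝ}
    (hC : ∀ ξ, |a ξ| ≤ C) : BSym (fun ξ => (a ξ : ℂ)) :=
  ⟨Complex.measurable_ofReal.comp hc, Herm.ofReal he, C, fun ξ => by simpa using hC ξ⟩

lemma bSym_imag {a : ℝ → ℝ} (hc : Measurable a) (he : ∀ ξ, a (-ξ) = -a ξ) {C : ℝ}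
    (hC : ∀ ξ, |a ξ| ≤ C) : BSym (fun ξ => Complex.I * (a ξ : ℂ)) :=
  ⟨measurable_const.mul (Complex.measurable_ofReal.comp hc), Herm.I_mul he, C,
    fun ξ => by simpa using hC ξ⟩

lemma one_le_bracket (ξ : ℝ) : 1 ≤ 1 + ξ ^ 2 := by nlinarith [sq_nonneg ξ]

lemma bracket_pos (ξ : ℝ) : 0 < 1 + ξ ^ 2 := one_pos.trans_le (one_le_bracket ξ)

lemma bracket_rpow_le_one (ξ : ℝ) {a : ℝ} (ha : a ≤ 0) : (1 + ξ ^ 2) ^ a ≤ 1 :=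
  Real.rpow_le_one_of_one_le_of_nonpos (one_le_bracket ξ) ha

lemma abs_le_bracket (ξ : ℝ) : |ξ| ≤ (1 + ξ ^ 2) ^ (1 / 2 : ℝ) := by
  rw [← Real.sqrt_eq_rpow]
  exact Real.abs_le_sqrt (by linarith)

lemma abs_rpow_le_bracket (ξ : ℝ) {θ : ℝ} (h : 0 ≤ θ) : |ξ| ^ θ ≤ (1 + ξ ^ 2) ^ (θ / 2) := by
  refine (Real.rpow_le_rpow (abs_nonneg _) (abs_le_bracket ξ) h).trans (le_of_eq ?_)
  rw [← Real.rpow_mul (bracket_pos ξ).le]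
  ring_nf

/-- Power series for |y| ≤ 1, triangle inequality otherwise. The quadratic remainder explains why a
smoothing factor must absorb two powers of the phase in `hasDerivAt_op_exp`. -/
lemma exp_sub_bound (y : ℝ) :
    ‖Complex.exp (Complex.I * (y : ℂ)) - 1 - Complex.I * y‖ ≤ 2 * y ^ 2 := by
  have hn : ‖Complex.I * (y : ℂ)‖ = |y| := by simp
  rcases le_total |y| 1 with h | h
  · have := Complex.norm_exp_sub_one_sub_id_le (x := Complex.I * (y : ℂ)) (by rwa [hn])
    rw [hn, sq_abs] at this
    nlinarith [sq_nonneg y]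
  · have h1 := Real.norm_exp_I_mul_ofReal_sub_one_le (x := y)
    have h2 := norm_sub_le (Complex.exp (Complex.I * (y : ℂ)) - 1) (Complex.I * (y : ℂ))
    rw [hn] at h2
    rw [Real.norm_eq_abs] at h1
    have h3 : |y| ≤ y ^ 2 := by rw [← sq_abs]; nlinarith
    linarith

/-- The group with a smoothing factor is differentiable in operator norm. -/
lemma hasDerivAt_op_exp {κ : ℝ → ℂ} {a : ℝ → ℝ} (hκ : BSym κ) (ha : Measurable a)
    (ho : ∀ ξ, a (-ξ) = -a ξ) (hκa : BSym (fun ξ => Complex.I * a ξ * κ ξ)) {C : ℝ}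
    (hC : ∀ ξ, ‖κ ξ‖ * a ξ ^ 2 ≤ C) (t : ℝ) :
    HasDerivAt (fun t => op (fun ξ => κ ξ * Complex.exp (Complex.I * (t * a ξ : ℝ))))
      (op (fun ξ => Complex.I * a ξ * κ ξ * Complex.exp (Complex.I * (t * a ξ : ℝ)))) t := by
  have hC0 : 0 ≤ C := (by positivity : 0 ≤ ‖κ 0‖ * a 0 ^ 2).trans (hC 0)
  have hE : ∀ t, BSym (fun ξ => κ ξ * Complex.exp (Complex.I * (t * a ξ : ℝ))) := fun t =>
    hκ.mul (bSym_exp ha ho t)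
  have hD : BSym (fun ξ => Complex.I * a ξ * κ ξ * Complex.exp (Complex.I * (t * a ξ : ℝ))) :=
    hκa.mul (bSym_exp ha ho t)
  rw [hasDerivAt_iff_isLittleO]
  refine (Asymptotics.IsBigO.of_bound (2 * C) (Eventually.of_forall fun s => ?_)).trans_isLittleO
    (Asymptotics.isLittleO_pow_sub_sub t one_lt_two)
  refine ContinuousLinearMap.opNorm_le_bound _ (by positivity) fun u => ?_
  have hu : IsMul (fun ξ => κ ξ * Complex.exp (Complex.I * (s * a ξ : ℝ))
      - κ ξ * Complex.exp (Complex.I * (t * a ξ : ℝ))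
      - ((s - t : ℝ) : ℂ) * (Complex.I * a ξ * κ ξ * Complex.exp (Complex.I * (t * a ξ : ℝ)))) u
      ((op (fun ξ => κ ξ * Complex.exp (Complex.I * (s * a ξ : ℝ)))
        - op (fun ξ => κ ξ * Complex.exp (Complex.I * (t * a ξ : ℝ)))
        - (s - t) • op (fun ξ => Complex.I * a ξ * κ ξ
          * Complex.exp (Complex.I * (t * a ξ : ℝ)))) u) := by
    simp only [sub_apply, smul_apply]
    filter_upwards [(hE s).isMul u, (hE t).isMul u, hD.isMul u,
      fourierL2_sub_ae (op (fun ξ => κ ξ * Complex.exp (Complex.I * (s * a ξ : ℝ))) u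
        - op (fun ξ => κ ξ * Complex.exp (Complex.I * (t * a ξ : ℝ))) u)
        ((s - t) • op (fun ξ => Complex.I * a ξ * κ ξ
          * Complex.exp (Complex.I * (t * a ξ : ℝ))) u),
      fourierL2_sub_ae (op (fun ξ => κ ξ * Complex.exp (Complex.I * (s * a ξ : ℝ))) u)
        (op (fun ξ => κ ξ * Complex.exp (Complex.I * (t * a ξ : ℝ))) u),
      fourierL2_smul_ae (s - t) (op (fun ξ => Complex.I * a ξ * κ ξ
          * Complex.exp (Complex.I * (t * a ξ : ℝ))) u)] with η e1 e2 e3 e4 e5 e6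
    rw [e4, e5, e6, e1, e2, e3]
    ring
  refine hu.norm_le fun ξ => ?_
  -- Factoring out the unimodular exponential at time t leaves the Taylor remainder at (s - t)a(ξ).
  have hdec : κ ξ * Complex.exp (Complex.I * (s * a ξ : ℝ))
      - κ ξ * Complex.exp (Complex.I * (t * a ξ : ℝ))
      - ((s - t : ℝ) : ℂ) * (Complex.I * a ξ * κ ξ * Complex.exp (Complex.I * (t * a ξ : ℝ)))
      = κ ξ * Complex.exp (Complex.I * (t * a ξ : ℝ)) *
        (Complex.exp (Complex.I * ((s - t) * a ξ : ℝ)) - 1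
          - Complex.I * ((s - t) * a ξ : ℝ)) := by
    have : Complex.exp (Complex.I * (s * a ξ : ℝ)) = Complex.exp (Complex.I * (t * a ξ : ℝ))
        * Complex.exp (Complex.I * ((s - t) * a ξ : ℝ)) := by
      rw [← Complex.exp_add]
      congr 1
      push_cast
      ring
    rw [this]
    push_cast
    ring
  rw [hdec, norm_mul, norm_mul, mul_comm Complex.I ((t * a ξ : ℝ) : ℂ),
    Complex.norm_exp_ofReal_mul_I, mul_one]
  calc ‖κ ξ‖ * _ ≤ ‖κ ξ‖ * (2 * ((s - t) * a ξ) ^ 2) := by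
        gcongr
        exact exp_sub_bound _
    _ = 2 * (‖κ ξ‖ * a ξ ^ 2) * (s - t) ^ 2 := by ring
    _ ≤ 2 * C * ‖‖s - t‖ ^ 2‖ := by
        rw [Real.norm_of_nonneg (sq_nonneg _), Real.norm_eq_abs, sq_abs]
        gcongr
        exact hC ξ

/-! ### Bounds and parity of the symbols -/

namespace Setup

variable {l b : ℝ → ℝ} {ρ r c₁ c₂ c₃ c₄ p : ℝ}

lemma l_pos (S : Setup l b ρ r c₁ c₂ c₃ c₄ p) (ξ : ℝ) : 0 < l ξ :=
  (mul_pos (pow_pos S.hc₁ 2) (Real.rpow_pos_of_pos (bracket_pos ξ) _)).trans_le (S.hl ξ).1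

lemma b_pos (S : Setup l b ρ r c₁ c₂ c₃ c₄ p) (ξ : ℝ) : 0 < b ξ :=
  (mul_pos (pow_pos S.hc₃ 2) (Real.rpow_pos_of_pos (bracket_pos ξ) _)).trans_le (S.hb ξ).1

lemma sqrt_sq_mul_rpow {c : ℝ} (hc : 0 < c) (ξ a : ℝ) :
    √(c ^ 2 * (1 + ξ ^ 2) ^ (a / 2)) = c * (1 + ξ ^ 2) ^ (a / 4) := by
  rw [Real.sqrt_mul (sq_nonneg c), Real.sqrt_sq hc.le, Real.sqrt_eq_rpow,
    ← Real.rpow_mul (bracket_pos ξ).le]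
  ring_nf

lemma sqrt_l_ge (S : Setup l b ρ r c₁ c₂ c₃ c₄ p) (ξ : ℝ) : c₁ * (1 + ξ ^ 2) ^ (ρ / 4) ≤ √(l ξ) := by
  rw [← sqrt_sq_mul_rpow S.hc₁]
  exact Real.sqrt_le_sqrt (S.hl ξ).1

lemma sqrt_l_le (S : Setup l b ρ r c₁ c₂ c₃ c₄ p) (ξ : ℝ) : √(l ξ) ≤ c₂ * (1 + ξ ^ 2) ^ (ρ / 4) := by
  rw [← sqrt_sq_mul_rpow S.hc₂]
  exact Real.sqrt_le_sqrt (S.hl ξ).2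

lemma sqrt_b_ge (S : Setup l b ρ r c₁ c₂ c₃ c₄ p) (ξ : ℝ) : c₃ * (1 + ξ ^ 2) ^ (-r / 4) ≤ √(b ξ) := by
  rw [← sqrt_sq_mul_rpow S.hc₃]
  exact Real.sqrt_le_sqrt (S.hb ξ).1

lemma sqrt_b_le (S : Setup l b ρ r c₁ c₂ c₃ c₄ p) (ξ : ℝ) : √(b ξ) ≤ c₄ * (1 + ξ ^ 2) ^ (-r / 4) := by
  rw [← sqrt_sq_mul_rpow S.hc₄]
  exact Real.sqrt_le_sqrt (S.hb ξ).2

lemma sqrt_l_pos (S : Setup l b ρ r c₁ c₂ c₃ c₄ p) (ξ : ℝ) : 0 < √(l ξ) := Real.sqrt_pos.mpr (S.l_pos ξ)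

lemma sqrt_b_pos (S : Setup l b ρ r c₁ c₂ c₃ c₄ p) (ξ : ℝ) : 0 < √(b ξ) := Real.sqrt_pos.mpr (S.b_pos ξ)

lemma k_pos (S : Setup l b ρ r c₁ c₂ c₃ c₄ p) (ξ : ℝ) : 0 < symK l b ξ := div_pos (S.sqrt_b_pos ξ) (S.sqrt_l_pos ξ)

/-- K gains r/2 + ρ/2 derivatives; with `Setup.k_ge` this makes its range exactly the energy space
of u. -/
lemma k_le (S : Setup l b ρ r c₁ c₂ c₃ c₄ p) (ξ : ℝ) : symK l b ξ ≤ c₄ / c₁ * (1 + ξ ^ 2) ^ (-(r / 2 + ρ / 2) / 2) := by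
  have hj := bracket_pos ξ
  unfold symK
  rw [div_le_iff₀ (S.sqrt_l_pos ξ)]
  have h1 : 0 ≤ c₄ / c₁ * (1 + ξ ^ 2) ^ (-(r / 2 + ρ / 2) / 2) := by
    have := S.hc₁; have := S.hc₄; positivity
  refine le_trans ?_ (mul_le_mul_of_nonneg_left (S.sqrt_l_ge ξ) h1)
  refine (S.sqrt_b_le ξ).trans (le_of_eq ?_)
  have h2 : (1 + ξ ^ 2) ^ (-r / 4)
      = (1 + ξ ^ 2) ^ (-(r / 2 + ρ / 2) / 2) * (1 + ξ ^ 2) ^ (ρ / 4) := by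
    rw [← Real.rpow_add hj]; ring_nf
  rw [h2]
  have := S.hc₁.ne'
  field_simp

lemma k_ge (S : Setup l b ρ r c₁ c₂ c₃ c₄ p) (ξ : ℝ) : c₃ / c₂ * (1 + ξ ^ 2) ^ (-(r / 2 + ρ / 2) / 2) ≤ symK l b ξ := by
  have hj := bracket_pos ξ
  unfold symK
  rw [le_div_iff₀ (S.sqrt_l_pos ξ)]
  have h1 : 0 ≤ c₃ / c₂ * (1 + ξ ^ 2) ^ (-(r / 2 + ρ / 2) / 2) := by
    have := S.hc₂; have := S.hc₃; positivity
  refine (mul_le_mul_of_nonneg_left (S.sqrt_l_le ξ) h1).trans ?_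
  refine le_trans (le_of_eq ?_) (S.sqrt_b_ge ξ)
  have h2 : (1 + ξ ^ 2) ^ (-r / 4)
      = (1 + ξ ^ 2) ^ (-(r / 2 + ρ / 2) / 2) * (1 + ξ ^ 2) ^ (ρ / 4) := by
    rw [← Real.rpow_add hj]; ring_nf
  rw [h2]
  have := S.hc₂.ne'
  field_simp

lemma cont_sqrt_l (S : Setup l b ρ r c₁ c₂ c₃ c₄ p) : Continuous (fun ξ => √(l ξ)) := S.cont_l.sqrt

lemma cont_sqrt_b (S : Setup l b ρ r c₁ c₂ c₃ c₄ p) : Continuous (fun ξ => √(b ξ)) := S.cont_b.sqrt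

lemma cont_k (S : Setup l b ρ r c₁ c₂ c₃ c₄ p) : Continuous (symK l b) :=
  S.cont_sqrt_b.div S.cont_sqrt_l fun ξ => (S.sqrt_l_pos ξ).ne'

lemma cont_d (S : Setup l b ρ r c₁ c₂ c₃ c₄ p) : Continuous (symD b) := continuous_id.mul S.cont_sqrt_b

lemma cont_om (S : Setup l b ρ r c₁ c₂ c₃ c₄ p) : Continuous (symOm l) := continuous_id.mul S.cont_sqrt_l

lemma cont_lam (S : Setup l b ρ r c₁ c₂ c₃ c₄ p) : Continuous (symLam l) := S.cont_sqrt_l.inv₀ fun ξ => (S.sqrt_l_pos ξ).ne'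

lemma cont_symS : Continuous (symS ρ) :=
  (continuous_const.add (continuous_id.pow 2)).rpow_const fun ξ => Or.inl (bracket_pos ξ).ne'

lemma even_k (S : Setup l b ρ r c₁ c₂ c₃ c₄ p) (ξ : ℝ) : symK l b (-ξ) = symK l b ξ := by
  simp only [symK, S.even_b, S.even_l]

lemma odd_d (S : Setup l b ρ r c₁ c₂ c₃ c₄ p) (ξ : ℝ) : symD b (-ξ) = -symD b ξ := by
  simp only [symD, S.even_b, neg_mul]

lemma odd_om (S : Setup l b ρ r c₁ c₂ c₃ c₄ p) (ξ : ℝ) : symOm l (-ξ) = -symOm l ξ := by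
  simp only [symOm, S.even_l, neg_mul]

lemma even_lam (S : Setup l b ρ r c₁ c₂ c₃ c₄ p) (ξ : ℝ) : symLam l (-ξ) = symLam l ξ := by
  simp only [symLam, S.even_l]

lemma even_symS (ξ : ℝ) : symS ρ (-ξ) = symS ρ ξ := by
  simp only [symS, neg_sq]

lemma symS_pos (ξ : ℝ) : 0 < symS ρ ξ := Real.rpow_pos_of_pos (bracket_pos ξ) _

lemma abs_k_le (S : Setup l b ρ r c₁ c₂ c₃ c₄ p) (ξ : ℝ) : |symK l b ξ| ≤ c₄ / c₁ := by
  rw [abs_of_pos (S.k_pos ξ)]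
  refine (S.k_le ξ).trans ?_
  have h := bracket_rpow_le_one ξ (a := -(r / 2 + ρ / 2) / 2) (by linarith [S.hs])
  have := div_pos S.hc₄ S.hc₁
  nlinarith

lemma bSym_k (S : Setup l b ρ r c₁ c₂ c₃ c₄ p) : BSym (fun ξ => (symK l b ξ : ℂ)) :=
  bSym_real S.cont_k.measurable S.even_k S.abs_k_le

lemma bSym_sqrtB (S : Setup l b ρ r c₁ c₂ c₃ c₄ p) : BSym (fun ξ => (√(b ξ) : ℂ)) := by
  refine bSym_real (C := c₄) S.cont_sqrt_b.measurable (fun ξ => by rw [S.even_b]) fun ξ => ?_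
  rw [abs_of_pos (S.sqrt_b_pos ξ)]
  have h := bracket_rpow_le_one ξ (a := -r / 4) (by linarith [S.hr])
  nlinarith [S.sqrt_b_le ξ, S.hc₄]

lemma abs_lam_le (S : Setup l b ρ r c₁ c₂ c₃ c₄ p) (ξ : ℝ) : |symLam l ξ| ≤ c₁⁻¹ := by
  rw [symLam, abs_of_pos (inv_pos.mpr (S.sqrt_l_pos ξ))]
  refine inv_anti₀ S.hc₁ (le_trans ?_ (S.sqrt_l_ge ξ))
  have := Real.one_le_rpow (one_le_bracket ξ) (z := ρ / 4) (by linarith [S.hρ])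
  nlinarith [S.hc₁]

lemma bSym_lam (S : Setup l b ρ r c₁ c₂ c₃ c₄ p) : BSym (fun ξ => (symLam l ξ : ℂ)) :=
  bSym_real S.cont_lam.measurable S.even_lam S.abs_lam_le

lemma bSym_symS (S : Setup l b ρ r c₁ c₂ c₃ c₄ p) : BSym (fun ξ => (symS ρ ξ : ℂ)) := by
  refine bSym_real (C := 1) (cont_symS (ρ := ρ)).measurable even_symS fun ξ => ?_
  rw [abs_of_pos (symS_pos ξ)]
  exact bracket_rpow_le_one ξ (by linarith [S.hρ])

/-- `ξ b / √l` is bounded; this uses `r + ρ/2 ≥ 1`. -/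
lemma abs_kd_le (S : Setup l b ρ r c₁ c₂ c₃ c₄ p) (ξ : ℝ) : |symK l b ξ * symD b ξ| ≤ c₄ ^ 2 / c₁ := by
  have hj := bracket_pos ξ
  have hc1 := S.hc₁
  have hc4 := S.hc₄
  rw [abs_mul, abs_of_pos (S.k_pos ξ), symD, abs_mul, abs_of_pos (S.sqrt_b_pos ξ)]
  calc symK l b ξ * (|ξ| * √(b ξ))
      ≤ (c₄ / c₁ * (1 + ξ ^ 2) ^ (-(r / 2 + ρ / 2) / 2)) *
        ((1 + ξ ^ 2) ^ (1 / 2 : ℝ) * (c₄ * (1 + ξ ^ 2) ^ (-r / 4))) := by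
        have h1 := S.k_le ξ
        have h2 := abs_le_bracket ξ
        have h3 := S.sqrt_b_le ξ
        have h4 := S.sqrt_b_pos ξ
        gcongr
    _ = c₄ ^ 2 / c₁ * (1 + ξ ^ 2) ^ (-(r / 2 + ρ / 2) / 2 + 1 / 2 + -r / 4) := by
        rw [Real.rpow_add hj, Real.rpow_add hj]; ring
    _ ≤ c₄ ^ 2 / c₁ := by
        have h := bracket_rpow_le_one ξ (a := -(r / 2 + ρ / 2) / 2 + 1 / 2 + -r / 4)
          (by linarith [S.hrρ])
        have : 0 ≤ c₄ ^ 2 / c₁ := by positivity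
        nlinarith

lemma bSym_kd (S : Setup l b ρ r c₁ c₂ c₃ c₄ p) : BSym (fun ξ => Complex.I * ((symK l b ξ * symD b ξ : ℝ) : ℂ)) :=
  bSym_imag (S.cont_k.mul S.cont_d).measurable
    (fun ξ => by rw [S.even_k, S.odd_d, mul_neg]) S.abs_kd_le

/-- The exponent in `symS` is large enough to absorb two factors ξ√l, as differentiability of the
smoothed group in operator norm requires. -/
lemma symS_om_sq_le (S : Setup l b ρ r c₁ c₂ c₃ c₄ p) (ξ : ℝ) : symS ρ ξ * symOm l ξ ^ 2 ≤ c₂ ^ 2 := by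
  have hj := bracket_pos ξ
  have hρ := S.hρ
  rw [symOm, mul_pow, Real.sq_sqrt (S.l_pos ξ).le, symS]
  calc (1 + ξ ^ 2) ^ (-(2 + ρ)) * (ξ ^ 2 * l ξ)
      ≤ (1 + ξ ^ 2) ^ (-(2 + ρ)) * ((1 + ξ ^ 2) ^ (1 : ℝ) * (c₂ ^ 2 * (1 + ξ ^ 2) ^ (ρ / 2))) := by
        have h1 := (S.hl ξ).2
        have h2 := (S.l_pos ξ).le
        rw [Real.rpow_one]
        gcongr
        linarith
    _ = c₂ ^ 2 * (1 + ξ ^ 2) ^ (-(2 + ρ) + 1 + ρ / 2) := by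
        rw [Real.rpow_add hj, Real.rpow_add hj]; ring
    _ ≤ c₂ ^ 2 := by
        have h := bracket_rpow_le_one ξ (a := -(2 + ρ) + 1 + ρ / 2) (by linarith)
        nlinarith [sq_nonneg c₂]

lemma symS_d_sq_le (S : Setup l b ρ r c₁ c₂ c₃ c₄ p) (ξ : ℝ) : symS ρ ξ * symD b ξ ^ 2 ≤ c₄ ^ 2 := by
  have hj := bracket_pos ξ
  have hρ := S.hρ
  have hr := S.hr
  rw [symD, mul_pow, Real.sq_sqrt (S.b_pos ξ).le, symS]
  calc (1 + ξ ^ 2) ^ (-(2 + ρ)) * (ξ ^ 2 * b ξ)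
      ≤ (1 + ξ ^ 2) ^ (-(2 + ρ)) * ((1 + ξ ^ 2) ^ (1 : ℝ) * (c₄ ^ 2 * (1 + ξ ^ 2) ^ (-r / 2))) := by
        have h1 := (S.hb ξ).2
        have h2 := (S.b_pos ξ).le
        rw [Real.rpow_one]
        gcongr
        linarith
    _ = c₄ ^ 2 * (1 + ξ ^ 2) ^ (-(2 + ρ) + 1 + -r / 2) := by
        rw [Real.rpow_add hj, Real.rpow_add hj]; ring
    _ ≤ c₄ ^ 2 := by
        have h := bracket_rpow_le_one ξ (a := -(2 + ρ) + 1 + -r / 2) (by linarith)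
        nlinarith [sq_nonneg c₄]

lemma symS_le_one (S : Setup l b ρ r c₁ c₂ c₃ c₄ p) (ξ : ℝ) : symS ρ ξ ≤ 1 :=
  bracket_rpow_le_one ξ (by linarith [S.hρ])

lemma abs_symS_mul_le (S : Setup l b ρ r c₁ c₂ c₃ c₄ p) {y A ξ : ℝ} (h : symS ρ ξ * y ^ 2 ≤ A) : |symS ρ ξ * y| ≤ 1 + A := by
  have h0 := symS_pos (ρ := ρ) ξ
  have h1 := S.symS_le_one ξ
  rw [abs_mul, abs_of_pos h0]
  have h2 : |y| ≤ 1 + y ^ 2 := by rw [← sq_abs]; nlinarith [sq_nonneg (|y| - 1), abs_nonneg y]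
  nlinarith

lemma bSym_symS_om (S : Setup l b ρ r c₁ c₂ c₃ c₄ p) : BSym (fun ξ => Complex.I * ((symS ρ ξ * symOm l ξ : ℝ) : ℂ)) :=
  bSym_imag ((cont_symS (ρ := ρ)).mul S.cont_om).measurable
    (fun ξ => by rw [even_symS, S.odd_om, mul_neg]) fun ξ => S.abs_symS_mul_le (S.symS_om_sq_le ξ)

lemma bSym_symS_d (S : Setup l b ρ r c₁ c₂ c₃ c₄ p) : BSym (fun ξ => Complex.I * ((symS ρ ξ * symD b ξ : ℝ) : ℂ)) :=
  bSym_imag ((cont_symS (ρ := ρ)).mul S.cont_d).measurable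
    (fun ξ => by rw [even_symS, S.odd_d, mul_neg]) fun ξ => S.abs_symS_mul_le (S.symS_d_sq_le ξ)

end Setup


/-! ### Sobolev embedding and the forcing term -/

section Forcing

variable {l b : ℝ → ℝ} {ρ r c₁ c₂ c₃ c₄ p : ℝ}

/-- The energy space embeds into `L^∞`. -/
lemma Setup.exists_sobolev (S : Setup l b ρ r c₁ c₂ c₃ c₄ p) :
    ∃ C, 0 ≤ C ∧ ∀ e, AEBdd (C * ‖e‖) (op (fun ξ => (symK l b ξ : ℂ)) e) := by
  -- The symbol of K is square integrable because r/2 + ρ/2 > 1/2. Cauchy–Schwarz then makes the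
  -- transform of Ke integrable.
  have hk2 : MemLp (fun η : ℝ => symK l b (2 * Real.pi * η)) 2 volume := by
    have hcont : Continuous (fun η : ℝ => symK l b (2 * Real.pi * η)) :=
      S.cont_k.comp (continuous_const.mul continuous_id)
    rw [memLp_two_iff_integrable_sq hcont.aestronglyMeasurable]
    have hs := S.hs
    have h0 : Integrable (fun ξ : ℝ => (c₄ / c₁) ^ 2 * (1 + ‖ξ‖ ^ 2) ^ (-(r + ρ) / 2)) :=
      (integrable_rpow_neg_one_add_norm_sq (by simp; linarith)).const_mul _
    have h1 : Integrable (fun ξ : ℝ => symK l b ξ ^ 2) := by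
      refine h0.mono' (S.cont_k.pow 2).aestronglyMeasurable (Eventually.of_forall fun ξ => ?_)
      rw [Real.norm_of_nonneg (sq_nonneg _), Real.norm_eq_abs, sq_abs]
      have h2 : (1 + ξ ^ 2) ^ (-(r + ρ) / 2) = ((1 + ξ ^ 2) ^ (-(r / 2 + ρ / 2) / 2)) ^ 2 := by
        rw [← Real.rpow_mul_natCast (bracket_pos ξ).le]
        congr 1
        push_cast
        ring
      rw [h2, ← mul_pow]
      exact pow_le_pow_left₀ (S.k_pos ξ).le (S.k_le ξ) 2
    exact h1.comp_mul_left' (by positivity)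
  refine ⟨‖hk2.toLp _‖, norm_nonneg _, fun e => ?_⟩
  have hn := (Lp.memLp (fourierL2 e)).norm
  have hmul : ∀ᵐ η, ‖fourierL2 (op (fun ξ => (symK l b ξ : ℂ)) e) η‖
      = ⟪hk2.toLp _ η, hn.toLp _ η⟫ := by
    filter_upwards [S.bSym_k.isMul e, hk2.coeFn_toLp, hn.coeFn_toLp] with η e1 e2 e3
    rw [e1, e2, e3, norm_mul, Complex.norm_real, Real.norm_of_nonneg (S.k_pos _).le]
    simp [mul_comm]
  have hint : Integrable (fun η => fourierL2 (op (fun ξ => (symK l b ξ : ℂ)) e) η) := by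
    rw [← integrable_norm_iff (Lp.aestronglyMeasurable _)]
    exact (L2.integrable_inner (hk2.toLp _) (hn.toLp _)).congr (hmul.mono fun _ h => h.symm)
  have hle : ∫ η, ‖fourierL2 (op (fun ξ => (symK l b ξ : ℂ)) e) η‖ ≤ ‖hk2.toLp _‖ * ‖e‖ := by
    rw [integral_congr_ae hmul, ← L2.inner_def]
    refine (real_inner_le_norm _ _).trans (le_of_eq ?_)
    congr 1
    rw [Lp.norm_toLp, eLpNorm_norm, ← Lp.norm_def, norm_fourierL2]
  filter_upwards [abs_le_integral_norm_fourierL2 _ hint] with x hx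
  exact hx.trans hle

lemma BSym.I_mul_div {a f : ℝ → ℝ} (ha : Measurable a) (hf : Measurable f)
    (ho : ∀ ξ, a (-ξ) = -a ξ) (he : ∀ ξ, f (-ξ) = f ξ) {C : ℝ} (hC : ∀ ξ, |a ξ / f ξ| ≤ C) :
    BSym (fun ξ => Complex.I * ((a ξ / f ξ : ℝ) : ℂ)) :=
  bSym_imag (ha.div hf) (fun ξ => by rw [ho, he, neg_div]) hC

/-- The derivative `B^{1/2} ∂ₓ g(u)` exists in `L²` for `u` in the energy space. -/
lemma Setup.exists_forcing (S : Setup l b ρ r c₁ c₂ c₃ c₄ p) :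
    ∃ C, 0 ≤ C ∧ ∀ M, 0 ≤ M → ∀ e, AEBdd M (op (fun ξ => (symK l b ξ : ℂ)) e) →
      ∃ N, IsMul (fun ξ => Complex.I * (symD b ξ : ℂ))
        (nonlinearity p (op (fun ξ => (symK l b ξ : ℂ)) e)) N
        ∧ ‖N‖ ≤ C * (p * M ^ (p - 1)) * ‖e‖ := by
  have hp := S.hp
  have hc1 := S.hc₁
  have hc4 := S.hc₄
  -- For r ≥ 2 the symbol ξ√b is bounded and the L² bound of g(u) suffices. For r < 2 it has order θ
  -- = 1 - r/2, so fractional regularity of g(u) is needed.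
  rcases le_or_gt 2 r with hr2 | hr2
  · have hb : ∀ ξ, |symD b ξ| ≤ c₄ := by
      intro ξ
      rw [symD, abs_mul, abs_of_pos (S.sqrt_b_pos ξ)]
      calc |ξ| * √(b ξ) ≤ (1 + ξ ^ 2) ^ (1 / 2 : ℝ) * (c₄ * (1 + ξ ^ 2) ^ (-r / 4)) := by
            have h2 := abs_le_bracket ξ
            have h3 := S.sqrt_b_le ξ
            have h4 := bracket_pos ξ
            gcongr
        _ = c₄ * (1 + ξ ^ 2) ^ (1 / 2 + -r / 4) := by rw [Real.rpow_add (bracket_pos ξ)]; ring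
        _ ≤ c₄ := by
            have h := bracket_rpow_le_one ξ (a := 1 / 2 + -r / 4) (by linarith)
            nlinarith
    have hB := bSym_imag S.cont_d.measurable S.odd_d hb
    refine ⟨c₄ * (c₄ / c₁), by positivity, fun M hM e he => ⟨_, hB.isMul _, ?_⟩⟩
    have h1 := (hB.isMul (nonlinearity p (op (fun ξ => (symK l b ξ : ℂ)) e))).norm_le (C := c₄)
      (by simpa using hb)
    have h2 := norm_nonlinearity_le hp hM he
    have h3 := (S.bSym_k.isMul e).norm_le (C := c₄ / c₁) (by simpa using S.abs_k_le)
    calc _ ≤ c₄ * (p * M ^ (p - 1) * (c₄ / c₁ * ‖e‖)) := by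
          refine h1.trans ?_
          gcongr
          refine h2.trans ?_
          gcongr
      _ = _ := by ring
  · set θ := 1 - r / 2 with hθ
    have hθ0 : 0 < θ := by rw [hθ]; linarith
    have hθ1 : θ ≤ 1 := by rw [hθ]; linarith [S.hr]
    have hm : Measurable (fun ξ : ℝ => |ξ| ^ θ) := measurable_id.abs.pow_const θ
    have hek : ∀ ξ : ℝ, |(-ξ)| ^ θ = |ξ| ^ θ := fun ξ => by rw [abs_neg]
    -- That u has θ derivatives is the assumption r + ρ/2 ≥ 1: the surplus (r/2 + ρ/2) - θ equals r
    -- + ρ/2 - 1.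
    have hb1 : ∀ ξ, |(|ξ| ^ θ * symK l b ξ)| ≤ c₄ / c₁ := by
      intro ξ
      rw [abs_of_nonneg (mul_nonneg (by positivity) (S.k_pos ξ).le)]
      calc |ξ| ^ θ * symK l b ξ
          ≤ (1 + ξ ^ 2) ^ (θ / 2) * (c₄ / c₁ * (1 + ξ ^ 2) ^ (-(r / 2 + ρ / 2) / 2)) := by
            have h1 := abs_rpow_le_bracket ξ hθ0.le
            have h2 := S.k_le ξ
            have h3 := S.k_pos ξ
            have h4 := bracket_pos ξ
            gcongr
        _ = c₄ / c₁ * (1 + ξ ^ 2) ^ (θ / 2 + -(r / 2 + ρ / 2) / 2) := by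
            rw [Real.rpow_add (bracket_pos ξ)]; ring
        _ ≤ c₄ / c₁ := by
            have h := bracket_rpow_le_one ξ (a := θ / 2 + -(r / 2 + ρ / 2) / 2)
              (by rw [hθ]; linarith [S.hrρ])
            have := div_pos hc4 hc1
            nlinarith
    have hB1 : BSym (fun ξ => ((|ξ| ^ θ * symK l b ξ : ℝ) : ℂ)) :=
      bSym_real (hm.mul S.cont_k.measurable) (fun ξ => by rw [hek, S.even_k]) hb1
    have hb2 : ∀ ξ, |symD b ξ / |ξ| ^ θ| ≤ c₄ := by
      intro ξ
      -- At ξ = 0 both the numerator and the divisor vanish, and the quotient is 0 by convention;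
      -- this is harmless since the symbol ξ√b is 0 there too.
      rcases eq_or_ne ξ 0 with rfl | hξ
      · simp [symD, hc4.le]
      have hξ' : 0 < |ξ| := abs_pos.mpr hξ
      rw [abs_div, abs_of_nonneg (by positivity : 0 ≤ |ξ| ^ θ),
        div_le_iff₀ (Real.rpow_pos_of_pos hξ' _), symD, abs_mul, abs_of_pos (S.sqrt_b_pos ξ)]
      have h1 : |ξ| = |ξ| ^ (r / 2) * |ξ| ^ θ := by
        rw [← Real.rpow_add hξ', hθ]; simp
      have h2 : |ξ| ^ (r / 2) * √(b ξ) ≤ c₄ := by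
        calc |ξ| ^ (r / 2) * √(b ξ)
            ≤ (1 + ξ ^ 2) ^ (r / 2 / 2) * (c₄ * (1 + ξ ^ 2) ^ (-r / 4)) := by
              have h1 := abs_rpow_le_bracket ξ (θ := r / 2) (by linarith [S.hr])
              have h2 := S.sqrt_b_le ξ
              have h4 := bracket_pos ξ
              gcongr
          _ = c₄ * (1 + ξ ^ 2) ^ (r / 2 / 2 + -r / 4) := by
              rw [Real.rpow_add (bracket_pos ξ)]; ring
          _ = c₄ := by
              rw [show r / 2 / 2 + -r / 4 = 0 by ring, Real.rpow_zero, mul_one]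
      calc |ξ| * √(b ξ) = (|ξ| ^ (r / 2) * √(b ξ)) * |ξ| ^ θ := by
            conv_lhs => rw [h1]
            ring
        _ ≤ c₄ * |ξ| ^ θ := by gcongr
    have hB2 := BSym.I_mul_div S.cont_d.measurable hm S.odd_d hek hb2
    refine ⟨c₄ * (c₄ / c₁), by positivity, fun M hM e he => ?_⟩
    have hu : IsMul (fun ξ => ((|ξ| ^ θ : ℝ) : ℂ)) (op (fun ξ => (symK l b ξ : ℂ)) e)
        (op (fun ξ => ((|ξ| ^ θ * symK l b ξ : ℝ) : ℂ)) e) := by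
      filter_upwards [S.bSym_k.isMul e, hB1.isMul e] with η e1 e2
      rw [e2, e1]
      push_cast
      ring
    obtain ⟨g₁, hg₁, hn₁⟩ := exists_frac_isMul hθ0 hθ1
      (mul_nonneg (by linarith) (Real.rpow_nonneg hM _))
      (norm_translate_nonlinearity_sub_le hp he) hu
    refine ⟨_, (hg₁.comp (hB2.isMul g₁)).congr fun ξ => ?_, ?_⟩
    · rw [mul_assoc, ← Complex.ofReal_mul]
      congr 2
      rcases eq_or_ne ξ 0 with rfl | hξ
      · simp [symD]
      · exact div_mul_cancel₀ _ (Real.rpow_pos_of_pos (abs_pos.mpr hξ) _).ne'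
    · have h1 := (hB2.isMul g₁).norm_le (C := c₄) (by
        intro ξ
        rw [norm_mul, Complex.norm_I, one_mul, Complex.norm_real]
        exact hb2 ξ)
      have h3 := (hB1.isMul e).norm_le (C := c₄ / c₁) (by
        intro ξ
        rw [Complex.norm_real]
        exact hb1 ξ)
      calc _ ≤ c₄ * (p * M ^ (p - 1) * (c₄ / c₁ * ‖e‖)) := by
            refine h1.trans ?_
            gcongr
            refine hn₁.trans ?_
            gcongr
        _ = _ := by ring

open Classical in
/-- `B^{1/2} ∂ₓ g(u)` as an element of `L²`. -/
def forcing (b : ℝ → ℝ) (p : ℝ) (u : L2) : L2 :=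
  if h : ∃ N, IsMul (fun ξ => Complex.I * (symD b ξ : ℂ)) (nonlinearity p u) N then h.choose else 0

lemma forcing_isMul_of_exists {u : L2}
    (h : ∃ N, IsMul (fun ξ => Complex.I * (symD b ξ : ℂ)) (nonlinearity p u) N) :
    IsMul (fun ξ => Complex.I * (symD b ξ : ℂ)) (nonlinearity p u) (forcing b p u) := by
  unfold forcing
  rw [dif_pos h]
  exact h.choose_spec

lemma Setup.forcing_isMul (S : Setup l b ρ r c₁ c₂ c₃ c₄ p) (e : L2) :
    IsMul (fun ξ => Complex.I * (symD b ξ : ℂ)) (nonlinearity p (op (fun ξ => (symK l b ξ : ℂ)) e))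
      (forcing b p (op (fun ξ => (symK l b ξ : ℂ)) e)) := by
  obtain ⟨C, hC0, hC⟩ := S.exists_sobolev
  obtain ⟨D, hD0, hD⟩ := S.exists_forcing
  obtain ⟨N, hN, -⟩ := hD (C * ‖e‖) (by positivity) e (hC e)
  exact forcing_isMul_of_exists ⟨N, hN⟩

/-- Boundedness on balls is the only norm estimate in L² used for the forcing; its continuity is
used only after applying K, through `Setup.opJ_nonlinearity`. -/
lemma Setup.exists_forcing_bound (S : Setup l b ρ r c₁ c₂ c₃ c₄ p) (R : ℝ) :
    ∃ C, 0 ≤ C ∧ ∀ e : L2, ‖e‖ ≤ R → ‖forcing b p (op (fun ξ => (symK l b ξ : ℂ)) e)‖ ≤ C := by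
  obtain ⟨C, hC0, hC⟩ := S.exists_sobolev
  obtain ⟨D, hD0, hD⟩ := S.exists_forcing
  have hp := S.hp
  refine ⟨D * (p * (C * |R|) ^ (p - 1)) * |R|, by positivity, fun e he => ?_⟩
  obtain ⟨N, hN, hNb⟩ := hD (C * ‖e‖) (by positivity) e (hC e)
  rw [(S.forcing_isMul e).unique hN]
  refine hNb.trans ?_
  have : ‖e‖ ≤ |R| := he.trans (le_abs_self R)
  gcongr

/-- The energy norm enters only through the sup bound; differences are measured in L² of u, which is
the weaker norm in which the contraction runs. -/
lemma Setup.exists_lipschitz (S : Setup l b ρ r c₁ c₂ c₃ c₄ p) (R : ℝ) :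
    ∃ C, 0 ≤ C ∧ ∀ e e' : L2, ‖e‖ ≤ R → ‖e'‖ ≤ R →
      ‖nonlinearity p (op (fun ξ => (symK l b ξ : ℂ)) e)
        - nonlinearity p (op (fun ξ => (symK l b ξ : ℂ)) e')‖
      ≤ C * ‖op (fun ξ => (symK l b ξ : ℂ)) e - op (fun ξ => (symK l b ξ : ℂ)) e'‖ := by
  obtain ⟨C, hC0, hC⟩ := S.exists_sobolev
  have hp := S.hp
  refine ⟨p * (C * |R|) ^ (p - 1), by positivity, fun e e' he he' => ?_⟩
  have hmono : ∀ e : L2, ‖e‖ ≤ R → AEBdd (C * |R|) (op (fun ξ => (symK l b ξ : ℂ)) e) := by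
    intro e he
    filter_upwards [hC e] with x hx
    refine hx.trans ?_
    gcongr
    exact he.trans (le_abs_self R)
  exact norm_nonlinearity_sub_le hp (hmono e he) (hmono e' he')

end Forcing

/-! ### The unitary group -/

/-- The group `e^{i t ξ √l}`. -/
def grp (l : ℝ → ℝ) (t : ℝ) : L2 →L[ℝ] L2 :=
  op (fun ξ => Complex.exp (Complex.I * (t * symOm l ξ : ℝ)))

section Group

variable {l b : ℝ → ℝ} {ρ r c₁ c₂ c₃ c₄ p : ℝ}

lemma Setup.bSym_grp (S : Setup l b ρ r c₁ c₂ c₃ c₄ p) (t : ℝ) : BSym (fun ξ => Complex.exp (Complex.I * (t * symOm l ξ : ℝ))) :=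
  bSym_exp S.cont_om.measurable S.odd_om t

lemma Setup.grp_isMul (S : Setup l b ρ r c₁ c₂ c₃ c₄ p) (t : ℝ) (u : L2) :
    IsMul (fun ξ => Complex.exp (Complex.I * (t * symOm l ξ : ℝ))) u (grp l t u) :=
  (S.bSym_grp t).isMul u

lemma norm_exp_I_mul (y : ℝ) : ‖Complex.exp (Complex.I * (y : ℂ))‖ = 1 := by
  rw [mul_comm, Complex.norm_exp_ofReal_mul_I]

lemma Setup.grp_add (S : Setup l b ρ r c₁ c₂ c₃ c₄ p) (s t : ℝ) (u : L2) : grp l (s + t) u = grp l s (grp l t u) := by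
  refine ((S.grp_isMul (s + t) u).unique ?_)
  refine ((S.grp_isMul t u).comp (S.grp_isMul s _)).congr fun ξ => ?_
  rw [← Complex.exp_add]
  congr 1
  push_cast
  ring

lemma Setup.grp_zero (S : Setup l b ρ r c₁ c₂ c₃ c₄ p) (u : L2) : grp l 0 u = u := by
  refine ((S.grp_isMul 0 u).unique ?_)
  exact (IsMul.refl u).congr fun ξ => by simp

lemma Setup.grp_neg_grp (S : Setup l b ρ r c₁ c₂ c₃ c₄ p) (t : ℝ) (u : L2) : grp l (-t) (grp l t u) = u := by
  rw [← S.grp_add, neg_add_cancel, S.grp_zero]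

lemma Setup.grp_grp_neg (S : Setup l b ρ r c₁ c₂ c₃ c₄ p) (t : ℝ) (u : L2) : grp l t (grp l (-t) u) = u := by
  rw [← S.grp_add, add_neg_cancel, S.grp_zero]

lemma Setup.norm_grp_le (S : Setup l b ρ r c₁ c₂ c₃ c₄ p) (t : ℝ) (u : L2) : ‖grp l t u‖ ≤ ‖u‖ := by
  simpa using (S.grp_isMul t u).norm_le (C := 1) fun ξ => (norm_exp_I_mul _).le

lemma Setup.norm_grp (S : Setup l b ρ r c₁ c₂ c₃ c₄ p) (t : ℝ) (u : L2) : ‖grp l t u‖ = ‖u‖ := by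
  refine le_antisymm (S.norm_grp_le t u) ?_
  have := S.norm_grp_le (-t) (grp l t u)
  rwa [S.grp_neg_grp] at this

lemma Setup.inner_grp_left (S : Setup l b ρ r c₁ c₂ c₃ c₄ p) (t : ℝ) (u v : L2) : ⟪grp l t u, v⟫ = ⟪u, grp l (-t) v⟫ := by
  refine (S.grp_isMul t u).inner_left (S.grp_isMul (-t) v) fun ξ => ?_
  rw [← Complex.exp_conj]
  congr 1
  simp

lemma Setup.grp_op_comm (S : Setup l b ρ r c₁ c₂ c₃ c₄ p) {m : ℝ → ℂ} (hm : BSym m) (t : ℝ) (u : L2) :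
    grp l t (op m u) = op m (grp l t u) :=
  (S.bSym_grp t).op_comm hm u

lemma symS_ne_zero (ξ : ℝ) : (symS ρ ξ : ℂ) ≠ 0 := by
  exact_mod_cast (Setup.symS_pos (ρ := ρ) ξ).ne'

/-- The smoothed group is differentiable in operator norm. -/
lemma Setup.hasDerivAt_smooth_grp (S : Setup l b ρ r c₁ c₂ c₃ c₄ p) {t : ℝ} :
    HasDerivAt (fun t => op (fun ξ => (symS ρ ξ : ℂ)
        * Complex.exp (Complex.I * (t * symOm l ξ : ℝ))))
      (op (fun ξ => Complex.I * symOm l ξ * (symS ρ ξ : ℂ)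
        * Complex.exp (Complex.I * (t * symOm l ξ : ℝ)))) t := by
  refine hasDerivAt_op_exp (C := c₂ ^ 2) S.bSym_symS S.cont_om.measurable S.odd_om ?_ ?_ t
  · have := S.bSym_symS_om
    have he : (fun ξ => Complex.I * ((symS ρ ξ * symOm l ξ : ℝ) : ℂ))
      = fun ξ => Complex.I * symOm l ξ * (symS ρ ξ : ℂ) := by
      ext ξ; push_cast; ring
    rwa [he] at this
  · intro ξ
    rw [Complex.norm_real, Real.norm_of_nonneg (Setup.symS_pos ξ).le]
    exact S.symS_om_sq_le ξ

lemma Setup.smooth_grp_apply (S : Setup l b ρ r c₁ c₂ c₃ c₄ p) (t : ℝ) (u : L2) :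
    op (fun ξ => (symS ρ ξ : ℂ) * Complex.exp (Complex.I * (t * symOm l ξ : ℝ))) u
      = grp l t (op (fun ξ => (symS ρ ξ : ℂ)) u) := by
  rw [S.grp_op_comm S.bSym_symS]
  exact (S.bSym_symS.op_op (S.bSym_grp t) u).symm

/-- The group is strongly continuous. -/
lemma Setup.continuous_grp_apply (S : Setup l b ρ r c₁ c₂ c₃ c₄ p) (u : L2) : Continuous (fun t => grp l t u) := by
  rw [continuous_iff_continuousAt]
  intro t
  rw [ContinuousAt, Metric.tendsto_nhds]
  intro ε hε
  have hd : DenseRange (op (fun ξ => (symS ρ ξ : ℂ))) :=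
    S.bSym_symS.denseRange fun ξ => (Setup.symS_pos ξ).ne'
  -- The group acts by isometries, so continuity on the dense range of the smoothing operator is
  -- enough.
  obtain ⟨v, hv⟩ := hd.exists_dist_lt u (show 0 < ε / 3 by positivity)
  have h1 : ContinuousAt (fun s => grp l s (op (fun ξ => (symS ρ ξ : ℂ)) v)) t := by
    simp_rw [← S.smooth_grp_apply]
    exact S.hasDerivAt_smooth_grp.continuousAt.clm_apply continuousAt_const
  filter_upwards [Metric.tendsto_nhds.mp h1 (ε / 3) (by positivity)] with s hs
  have e1 : dist (grp l s u) (grp l s (op (fun ξ => (symS ρ ξ : ℂ)) v)) < ε / 3 := by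
    rw [dist_eq_norm, ← map_sub, S.norm_grp, ← dist_eq_norm]; exact hv
  have e2 : dist (grp l t u) (grp l t (op (fun ξ => (symS ρ ξ : ℂ)) v)) < ε / 3 := by
    rw [dist_eq_norm, ← map_sub, S.norm_grp, ← dist_eq_norm]; exact hv
  have e3 := dist_triangle4_right (grp l s u) (grp l t u)
    (grp l s (op (fun ξ => (symS ρ ξ : ℂ)) v)) (grp l t (op (fun ξ => (symS ρ ξ : ℂ)) v))
  linarith

/-- The group is jointly continuous. -/
lemma Setup.continuous_grp (S : Setup l b ρ r c₁ c₂ c₃ c₄ p) : Continuous (fun z : ℝ × L2 => grp l z.1 z.2) := by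
  rw [continuous_iff_continuousAt]
  rintro ⟨t, u⟩
  rw [ContinuousAt, tendsto_iff_norm_sub_tendsto_zero]
  have h1 : Tendsto (fun z : ℝ × L2 => ‖z.2 - u‖ + ‖grp l z.1 u - grp l t u‖) (𝓝 (t, u)) (𝓝 0) := by
    have hc : Continuous (fun z : ℝ × L2 => ‖z.2 - u‖ + ‖grp l z.1 u - grp l t u‖) :=
      (continuous_snd.sub continuous_const).norm.add
        (((S.continuous_grp_apply u).comp continuous_fst).sub continuous_const).norm
    have := hc.tendsto (t, u)
    simpa using this
  refine squeeze_zero (fun _ => norm_nonneg _) (fun z => ?_) h1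
  have : grp l z.1 z.2 - grp l t u = grp l z.1 (z.2 - u) + (grp l z.1 u - grp l t u) := by
    rw [map_sub]; abel
  rw [this]
  refine (norm_add_le _ _).trans ?_
  rw [S.norm_grp]

lemma Setup.continuousOn_grp (S : Setup l b ρ r c₁ c₂ c₃ c₄ p) {A : Set ℝ} {f : ℝ → ℝ} {u : ℝ → L2} (hf : Continuous f)
    (hu : ContinuousOn u A) : ContinuousOn (fun t => grp l (f t) (u t)) A :=
  Continuous.comp_continuousOn (g := fun z : ℝ × L2 => grp l z.1 z.2) (f := fun t => (f t, u t))
    S.continuous_grp (ContinuousOn.prodMk hf.continuousOn hu)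

end Group


/-! ### The evolution equation -/

section Evolution

variable {l b : ℝ → ℝ} {ρ r c₁ c₂ c₃ c₄ p : ℝ}

local notation "𝐊" => op (fun ξ => (symK l b ξ : ℂ))
local notation "𝐒" => op (fun ξ => (symS ρ ξ : ℂ))
local notation "𝐖" => op (fun ξ => Complex.I * ((symS ρ ξ * symOm l ξ : ℝ) : ℂ))
local notation "𝐗" => op (fun ξ => Complex.I * ((symS ρ ξ * symD b ξ : ℝ) : ℂ))
local notation "𝐉" => op (fun ξ => Complex.I * ((symK l b ξ * symD b ξ : ℝ) : ℂ))

/-- The flow of the equation in the variables `e = B^{-1/2} L^{1/2} u`, `a = B^{-1/2} w`. -/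
structure Flow (l b : ℝ → ℝ) (ρ p T : ℝ) (e a : ℝ → L2) : Prop where
  cont_e : ContinuousOn e (Ico 0 T)
  cont_a : ContinuousOn a (Ico 0 T)
  der_e : ∀ t ∈ Ico 0 T, HasDerivWithinAt (fun s => op (fun ξ => (symS ρ ξ : ℂ)) (e s))
    (op (fun ξ => Complex.I * ((symS ρ ξ * symOm l ξ : ℝ) : ℂ)) (a t)) (Ico 0 T) t
  der_a : ∀ t ∈ Ico 0 T, HasDerivWithinAt (fun s => op (fun ξ => (symS ρ ξ : ℂ)) (a s))
    (op (fun ξ => Complex.I * ((symS ρ ξ * symOm l ξ : ℝ) : ℂ)) (e t)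
      + op (fun ξ => Complex.I * ((symS ρ ξ * symD b ξ : ℝ) : ℂ))
        (nonlinearity p (op (fun ξ => (symK l b ξ : ℂ)) (e t)))) (Ico 0 T) t

lemma IsMul.unique' {m n : ℝ → ℂ} {u v v' : L2} (h : IsMul m u v) (h' : IsMul n u v')
    (hmn : ∀ ξ, m ξ = n ξ) : v = v' :=
  (h.congr hmn).unique h'

lemma Setup.opK_injective (S : Setup l b ρ r c₁ c₂ c₃ c₄ p) : Function.Injective 𝐊 :=
  S.bSym_k.op_injective fun ξ => by exact_mod_cast (S.k_pos ξ).ne'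

lemma Setup.opS_injective (S : Setup l b ρ r c₁ c₂ c₃ c₄ p) : Function.Injective 𝐒 :=
  S.bSym_symS.op_injective fun ξ => symS_ne_zero ξ

lemma Setup.opK_denseRange (S : Setup l b ρ r c₁ c₂ c₃ c₄ p) : DenseRange 𝐊 := S.bSym_k.denseRange fun ξ => (S.k_pos ξ).ne'

lemma Setup.inner_opK (S : Setup l b ρ r c₁ c₂ c₃ c₄ p) (x y : L2) : ⟪𝐊 x, y⟫ = ⟪x, 𝐊 y⟫ := S.bSym_k.inner_real x y

lemma Setup.opK_opX (S : Setup l b ρ r c₁ c₂ c₃ c₄ p) (g : L2) : 𝐊 (𝐗 g) = 𝐒 (𝐉 g) := by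
  refine ((S.bSym_symS_d.isMul g).comp (S.bSym_k.isMul _)).unique'
    ((S.bSym_kd.isMul g).comp (S.bSym_symS.isMul _)) fun ξ => ?_
  push_cast
  ring

/-- Product rule for the group at time σs applied to y(s). The generator is unbounded, so the
smoothing operator is applied and only their bounded product occurs. -/
lemma Setup.hasDerivWithinAt_opS_grp (S : Setup l b ρ r c₁ c₂ c₃ c₄ p) {y : ℝ → L2} {y' : L2} {A : Set ℝ} {t : ℝ}
    (hy : HasDerivWithinAt y y' A t) (σ : ℝ) :
    HasDerivWithinAt (fun s => 𝐒 (grp l (σ * s) (y s)))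
      (σ • 𝐖 (grp l (σ * t) (y t)) + 𝐒 (grp l (σ * t) y')) A t := by
  have h1 : HasDerivAt (fun s => σ * s) σ t := by
    simpa using (hasDerivAt_id t).const_mul σ
  have h2 := (S.hasDerivAt_smooth_grp (t := σ * t)).scomp t h1
  have h3 := h2.hasDerivWithinAt.clm_apply (s := A) hy
  have hW : BSym (fun ξ => Complex.I * symOm l ξ * (symS ρ ξ : ℂ)
      * Complex.exp (Complex.I * ((σ * t) * symOm l ξ : ℝ))) := by
    have he : (fun ξ => Complex.I * ((symS ρ ξ * symOm l ξ : ℝ) : ℂ))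
      = fun ξ => Complex.I * symOm l ξ * (symS ρ ξ : ℂ) := by
      ext ξ; push_cast; ring
    have := S.bSym_symS_om
    rw [he] at this
    exact this.mul (S.bSym_grp _)
  have hWe : 𝐖 (grp l (σ * t) (y t)) = op (fun ξ => Complex.I * symOm l ξ * (symS ρ ξ : ℂ)
      * Complex.exp (Complex.I * ((σ * t) * symOm l ξ : ℝ))) (y t) := by
    refine ((S.grp_isMul (σ * t) (y t)).comp (S.bSym_symS_om.isMul _)).unique' (hW.isMul _)
      fun ξ => ?_
    push_cast
    ring
  have hfun : (fun s => 𝐒 (grp l (σ * s) (y s)))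
      = fun s => op (fun ξ => (symS ρ ξ : ℂ)
        * Complex.exp (Complex.I * ((σ * s) * symOm l ξ : ℝ))) (y s) := by
    ext1 s
    rw [S.smooth_grp_apply, S.grp_op_comm S.bSym_symS]
  rw [hfun, hWe, ← S.grp_op_comm S.bSym_symS, ← S.smooth_grp_apply]
  exact h3

/-- The image of a ball under `𝐊`. -/
def ballK (l b : ℝ → ℝ) (R : ℝ) : Set L2 :=
  {y | ∃ v, op (fun ξ => (symK l b ξ : ℂ)) v = y ∧ ‖v‖ ≤ R}

/-- Duality replaces the condition on K⁻¹y by closed half-space conditions on y, one for each φ.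
Hence the sets are closed in L² and stable under averaging. -/
lemma Setup.mem_ballK_iff (S : Setup l b ρ r c₁ c₂ c₃ c₄ p) {C : ℝ} (hC : 0 ≤ C) {y : L2} :
    y ∈ ballK l b C ↔ ∀ φ, ⟪y, φ⟫ ≤ C * ‖𝐊 φ‖ := by
  constructor
  · rintro ⟨v, rfl, hv⟩ φ
    rw [S.inner_opK]
    exact (real_inner_le_norm _ _).trans (by gcongr)
  · intro h
    exact exists_preimage_of_bound 𝐊 S.inner_opK S.opK_injective hC h

lemma Setup.isClosed_ballK (S : Setup l b ρ r c₁ c₂ c₃ c₄ p) {C : ℝ} (hC : 0 ≤ C) : IsClosed (ballK l b C) := by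
  have : ballK l b C = ⋂ φ, {y | ⟪y, φ⟫ ≤ C * ‖𝐊 φ‖} := by
    ext y
    rw [S.mem_ballK_iff hC, mem_iInter]
    rfl
  rw [this]
  exact isClosed_iInter fun φ => isClosed_le (continuous_id.inner continuous_const)
    continuous_const

/-- Only pairings with φ are integrated, so no continuity of K⁻¹z is needed to bound K⁻¹ of the
integral. -/
lemma Setup.integral_mem_ballK (S : Setup l b ρ r c₁ c₂ c₃ c₄ p) {C : ℝ} (hC : 0 ≤ C) {z : ℝ → L2} {s t : ℝ}
    (hz : ContinuousOn z (uIcc s t)) (h : ∀ τ ∈ uIcc s t, z τ ∈ ballK l b C) :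
    ∫ τ in s..t, z τ ∈ ballK l b (C * |t - s|) := by
  rw [S.mem_ballK_iff (by positivity)]
  intro φ
  have h1 : ⟪∫ τ in s..t, z τ, φ⟫ = ∫ τ in s..t, ⟪z τ, φ⟫ := by
    have := (innerSL ℝ φ).intervalIntegral_comp_comm (hz.intervalIntegrable (μ := volume))
    simp only [innerSL_apply_apply] at this
    rw [real_inner_comm, ← this]
    exact intervalIntegral.integral_congr fun τ _ => real_inner_comm _ _
  rw [h1]
  refine (le_abs_self _).trans ?_
  have h2 : ∀ τ ∈ uIoc s t, ‖⟪z τ, φ⟫‖ ≤ C * ‖𝐊 φ‖ := by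
    intro τ hτ
    have hm := h τ (uIoc_subset_uIcc hτ)
    rw [S.mem_ballK_iff hC] at hm
    have h3 := hm (-φ)
    rw [inner_neg_right, map_neg, norm_neg] at h3
    exact abs_le.mpr ⟨by linarith, hm φ⟩
  have := intervalIntegral.norm_integral_le_of_norm_le_const h2
  rw [Real.norm_eq_abs] at this
  linarith

lemma ballK_add {R R' : ℝ} {y y' : L2} (h : y ∈ ballK l b R) (h' : y' ∈ ballK l b R') :
    y + y' ∈ ballK l b (R + R') := by
  obtain ⟨v, rfl, hv⟩ := h
  obtain ⟨v', rfl, hv'⟩ := h'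
  exact ⟨v + v', map_add _ _ _, (norm_add_le _ _).trans (add_le_add hv hv')⟩

lemma ballK_mono {R R' : ℝ} (h : R ≤ R') : ballK l b R ⊆ ballK l b R' := by
  rintro y ⟨v, hv, hvR⟩
  exact ⟨v, hv, hvR.trans h⟩

/-- The state `u` recovered from the interaction variables. -/
def stateU (l : ℝ → ℝ) (t : ℝ) (y : L2 × L2) : L2 :=
  (1 / 2 : ℝ) • (grp l t y.1 + grp l (-t) y.2)

/-- The vector field of the equation in the interaction variables. -/
def field (l b : ℝ → ℝ) (p t : ℝ) (y : L2 × L2) : L2 × L2 :=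
  (grp l (-t) (op (fun ξ => Complex.I * ((symK l b ξ * symD b ξ : ℝ) : ℂ))
      (nonlinearity p (stateU l t y))),
    -grp l t (op (fun ξ => Complex.I * ((symK l b ξ * symD b ξ : ℝ) : ℂ))
      (nonlinearity p (stateU l t y))))

lemma Setup.stateU_opK (S : Setup l b ρ r c₁ c₂ c₃ c₄ p) (t : ℝ) (v₁ v₂ : L2) :
    stateU l t (𝐊 v₁, 𝐊 v₂) = 𝐊 ((1 / 2 : ℝ) • (grp l t v₁ + grp l (-t) v₂)) := by
  unfold stateU
  rw [S.grp_op_comm S.bSym_k, S.grp_op_comm S.bSym_k, map_smul, map_add]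

lemma Setup.norm_half_grp_le (S : Setup l b ρ r c₁ c₂ c₃ c₄ p) {R : ℝ} (t : ℝ) {v₁ v₂ : L2} (h₁ : ‖v₁‖ ≤ R) (h₂ : ‖v₂‖ ≤ R) :
    ‖(1 / 2 : ℝ) • (grp l t v₁ + grp l (-t) v₂)‖ ≤ R := by
  rw [norm_smul]
  have := norm_add_le (grp l t v₁) (grp l (-t) v₂)
  rw [S.norm_grp, S.norm_grp] at this
  norm_num
  linarith

lemma Setup.stateU_mem (S : Setup l b ρ r c₁ c₂ c₃ c₄ p) {R : ℝ} (t : ℝ) {y : L2 × L2} (h₁ : y.1 ∈ ballK l b R)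
    (h₂ : y.2 ∈ ballK l b R) : stateU l t y ∈ ballK l b R := by
  obtain ⟨y₁, y₂⟩ := y
  obtain ⟨v₁, rfl, hv₁⟩ := h₁
  obtain ⟨v₂, rfl, hv₂⟩ := h₂
  exact ⟨_, (S.stateU_opK t v₁ v₂).symm, S.norm_half_grp_le t hv₁ hv₂⟩

/-- After K the derivative in the forcing costs nothing: the symbol of iKD is bounded. This identity
links the L² bound on N with the Lipschitz bound on KN. -/
lemma Setup.opJ_nonlinearity (S : Setup l b ρ r c₁ c₂ c₃ c₄ p) (e : L2) : 𝐉 (nonlinearity p (𝐊 e)) = 𝐊 (forcing b p (𝐊 e)) := by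
  refine (S.bSym_kd.isMul _).unique' ((S.forcing_isMul e).comp (S.bSym_k.isMul _)) fun ξ => ?_
  push_cast
  ring

lemma Setup.exists_field_mem (S : Setup l b ρ r c₁ c₂ c₃ c₄ p) (R : ℝ) : ∃ C, 0 ≤ C ∧ ∀ (t : ℝ) (y : L2 × L2),
    y.1 ∈ ballK l b R → y.2 ∈ ballK l b R →
      (field l b p t y).1 ∈ ballK l b C ∧ (field l b p t y).2 ∈ ballK l b C := by
  obtain ⟨C, hC0, hC⟩ := S.exists_forcing_bound R
  refine ⟨C, hC0, fun t y h₁ h₂ => ?_⟩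
  obtain ⟨e, he, heR⟩ := S.stateU_mem t h₁ h₂
  unfold field
  rw [← he, S.opJ_nonlinearity, S.grp_op_comm S.bSym_k, S.grp_op_comm S.bSym_k]
  refine ⟨⟨_, rfl, ?_⟩, ⟨-grp l t (forcing b p (𝐊 e)), map_neg _ _, ?_⟩⟩
  · rw [S.norm_grp]; exact hC e heR
  · rw [norm_neg, S.norm_grp]; exact hC e heR

lemma Setup.norm_stateU_sub_le (S : Setup l b ρ r c₁ c₂ c₃ c₄ p) (t : ℝ) (y y' : L2 × L2) :
    ‖stateU l t y - stateU l t y'‖ ≤ ‖y - y'‖ := by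
  have h : stateU l t y - stateU l t y'
      = (1 / 2 : ℝ) • (grp l t (y - y').1 + grp l (-t) (y - y').2) := by
    unfold stateU
    rw [Prod.fst_sub, Prod.snd_sub, map_sub, map_sub, ← smul_sub]
    congr 1
    abel
  rw [h]
  exact S.norm_half_grp_le t (norm_fst_le _) (norm_snd_le _)

lemma Setup.norm_opJ_le (S : Setup l b ρ r c₁ c₂ c₃ c₄ p) (g : L2) : ‖𝐉 g‖ ≤ c₄ ^ 2 / c₁ * ‖g‖ :=
  (S.bSym_kd.isMul g).norm_le fun ξ => by
    rw [norm_mul, Complex.norm_I, one_mul, Complex.norm_real]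
    exact S.abs_kd_le ξ

/-- States that are K-images of a ball are uniformly bounded functions, where g is Lipschitz in L²;
iKD is bounded and the group isometric. -/
lemma Setup.exists_field_lipschitz (S : Setup l b ρ r c₁ c₂ c₃ c₄ p) (R : ℝ) : ∃ C : NNReal, ∀ t : ℝ,
    LipschitzOnWith C (field l b p t) {y | y.1 ∈ ballK l b R ∧ y.2 ∈ ballK l b R} := by
  obtain ⟨C, hC0, hC⟩ := S.exists_lipschitz R
  have hc : 0 ≤ c₄ ^ 2 / c₁ := by have := S.hc₁; positivity
  refine ⟨⟨c₄ ^ 2 / c₁ * C, by positivity⟩, fun t => LipschitzOnWith.of_dist_le_mul ?_⟩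
  rintro y ⟨h₁, h₂⟩ y' ⟨h₁', h₂'⟩
  obtain ⟨e, he, heR⟩ := S.stateU_mem t h₁ h₂
  obtain ⟨e', he', heR'⟩ := S.stateU_mem t h₁' h₂'
  have hJ : ‖𝐉 (nonlinearity p (stateU l t y)) - 𝐉 (nonlinearity p (stateU l t y'))‖
      ≤ c₄ ^ 2 / c₁ * C * ‖y - y'‖ := by
    rw [← map_sub]
    refine (S.norm_opJ_le _).trans ?_
    have h3 := hC e e' heR heR'
    rw [he, he'] at h3
    rw [mul_assoc]
    gcongr
    exact h3.trans (by gcongr; exact S.norm_stateU_sub_le t y y')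
  rw [dist_eq_norm, dist_eq_norm, Prod.norm_def]
  unfold field
  refine max_le ?_ ?_
  · rw [Prod.fst_sub, ← map_sub, S.norm_grp]
    exact hJ
  · rw [Prod.snd_sub, ← neg_sub', norm_neg, ← map_sub, S.norm_grp]
    exact hJ

lemma Setup.continuousOn_stateU (S : Setup l b ρ r c₁ c₂ c₃ c₄ p) {A : Set ℝ} {y : ℝ → L2 × L2} (hy : ContinuousOn y A) :
    ContinuousOn (fun t => stateU l t (y t)) A :=
  ContinuousOn.const_smul ((S.continuousOn_grp continuous_id hy.fst).add
    (S.continuousOn_grp continuous_neg hy.snd)) (1 / 2 : ℝ)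

lemma Setup.continuousOn_nonlinearity (S : Setup l b ρ r c₁ c₂ c₃ c₄ p) {R : ℝ} {A : Set ℝ} {u : ℝ → L2} (hu : ContinuousOn u A)
    (hR : ∀ t ∈ A, u t ∈ ballK l b R) : ContinuousOn (fun t => nonlinearity p (u t)) A := by
  obtain ⟨C, hC0, hC⟩ := S.exists_lipschitz R
  have hL : LipschitzOnWith ⟨C, hC0⟩ (nonlinearity p) (ballK l b R) := by
    refine LipschitzOnWith.of_dist_le_mul ?_
    rintro y ⟨v, rfl, hv⟩ y' ⟨v', rfl, hv'⟩
    rw [dist_eq_norm, dist_eq_norm]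
    exact hC v v' hv hv'
  exact hL.continuousOn.comp hu hR

lemma Setup.continuousOn_field (S : Setup l b ρ r c₁ c₂ c₃ c₄ p) {R : ℝ} {A : Set ℝ} {y : ℝ → L2 × L2} (hy : ContinuousOn y A)
    (hR : ∀ t ∈ A, (y t).1 ∈ ballK l b R ∧ (y t).2 ∈ ballK l b R) :
    ContinuousOn (fun t => field l b p t (y t)) A := by
  have h1 : ContinuousOn (fun t => 𝐉 (nonlinearity p (stateU l t (y t)))) A :=
    (ContinuousLinearMap.continuous 𝐉).comp_continuousOn
      (S.continuousOn_nonlinearity (S.continuousOn_stateU hy)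
        fun t ht => S.stateU_mem t (hR t ht).1 (hR t ht).2)
  exact (S.continuousOn_grp continuous_neg h1).prodMk (S.continuousOn_grp continuous_id h1).neg

/-- Local existence in the interaction variables, on an interval whose length depends only on the
size of the data. -/
lemma Setup.exists_local_ode (S : Setup l b ρ r c₁ c₂ c₃ c₄ p) {R : ℝ} (hR : 0 < R) : ∃ τ, 0 < τ ∧ ∀ v₁ v₂ : L2, ‖v₁‖ ≤ R → ‖v₂‖ ≤ R →
    ∃ y : ℝ → L2 × L2, y 0 = (𝐊 v₁, 𝐊 v₂) ∧
      (∀ t ∈ Ico 0 τ, (y t).1 ∈ ballK l b (2 * R) ∧ (y t).2 ∈ ballK l b (2 * R)) ∧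
      ∀ t ∈ Ico 0 τ, HasDerivWithinAt y (field l b p t (y t)) (Ico 0 τ) t := by
  obtain ⟨L, hL⟩ := S.exists_field_lipschitz (2 * R)
  obtain ⟨C, hC0, hC⟩ := S.exists_field_mem (2 * R)
  -- The first entry makes the Picard map a contraction with factor 1/2, the second keeps it within
  -- K-radius 2R. Both depend on R only.
  set τ : ℝ := min (1 / (2 * (L + 1))) (R / (C + 1)) with hτdef
  have hτ : 0 < τ := by
    have : (0 : ℝ) ≤ L := L.2
    refine lt_min (by positivity) (by positivity)
  have hτL : (L : ℝ) * τ ≤ 1 / 2 := by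
    have hL0 : (0 : ℝ) ≤ L := L.2
    calc (L : ℝ) * τ ≤ L * (1 / (2 * (L + 1))) := by gcongr; exact min_le_left _ _
      _ ≤ 1 / 2 := by
        rw [mul_one_div, div_le_div_iff₀ (by positivity) (by norm_num)]
        linarith
  have hτC : C * τ ≤ R := by
    calc C * τ ≤ C * (R / (C + 1)) := by gcongr; exact min_le_right _ _
      _ ≤ R := by
        rw [mul_div_assoc', div_le_iff₀ (by positivity)]
        nlinarith
  refine ⟨τ, hτ, fun v₁ v₂ h₁ h₂ => ?_⟩
  set y₀ : L2 × L2 := (𝐊 v₁, 𝐊 v₂)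
  let D : Set (L2 × L2) := {y | y.1 ∈ ballK l b (2 * R) ∧ y.2 ∈ ballK l b (2 * R)}
  have hD : IsClosed D := by
    have := S.isClosed_ballK (C := 2 * R) (by positivity)
    exact (this.preimage continuous_fst).inter (this.preimage continuous_snd)
  -- Curves bounded in the strong norm, metrized by the weak one; the space is complete because
  -- K-images of balls are closed in L².
  let X := {y : C(Icc (0 : ℝ) τ, L2 × L2) // ∀ t, y t ∈ D}
  have hXc : IsClosed {y : C(Icc (0 : ℝ) τ, L2 × L2) | ∀ t, y t ∈ D} := by
    have : {y : C(Icc (0 : ℝ) τ, L2 × L2) | ∀ t, y t ∈ D}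
        = ⋂ t, (fun y : C(Icc (0 : ℝ) τ, L2 × L2) => y t) ⁻¹' D := by
      ext y; simp
    rw [this]
    exact isClosed_iInter fun t => hD.preimage (continuous_eval_const t)
  have : CompleteSpace X := hXc.completeSpace_coe
  have hy0 : y₀ ∈ D := ⟨⟨v₁, rfl, by linarith⟩, ⟨v₂, rfl, by linarith⟩⟩
  have : Nonempty X := ⟨⟨ContinuousMap.const _ y₀, fun _ => hy0⟩⟩
  let ext : X → ℝ → L2 × L2 := fun y => IccExtend hτ.le (y.1 : Icc (0 : ℝ) τ → L2 × L2)
  have hextc : ∀ y : X, Continuous (ext y) := fun y => y.1.continuous.Icc_extend'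
  have hextD : ∀ (y : X) (t : ℝ), ext y t ∈ D := fun y t => y.2 _
  have hfc : ∀ y : X, Continuous (fun t => field l b p t (ext y t)) := by
    intro y
    rw [← continuousOn_univ]
    exact S.continuousOn_field (hextc y).continuousOn fun t _ => hextD y t
  let Y : X → ℝ → L2 × L2 := fun y t => y₀ + ∫ s in (0 : ℝ)..t, field l b p s (ext y s)
  have hYd : ∀ (y : X) (t : ℝ), HasDerivAt (Y y) (field l b p t (ext y t)) t := fun y t =>
    ((hfc y).integral_hasStrictDerivAt 0 t).hasDerivAt.const_add y₀
  have hYc : ∀ y : X, Continuous (Y y) := fun y =>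
    continuous_iff_continuousAt.mpr fun t => (hYd y t).continuousAt
  have hYD : ∀ (y : X), ∀ t ∈ Icc 0 τ, Y y t ∈ D := by
    intro y t ht
    have hfst : (∫ s in (0 : ℝ)..t, field l b p s (ext y s)).1
        = ∫ s in (0 : ℝ)..t, (field l b p s (ext y s)).1 :=
      ((ContinuousLinearMap.fst ℝ L2 L2).intervalIntegral_comp_comm
        ((hfc y).intervalIntegrable 0 t)).symm
    have hsnd : (∫ s in (0 : ℝ)..t, field l b p s (ext y s)).2
        = ∫ s in (0 : ℝ)..t, (field l b p s (ext y s)).2 :=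
      ((ContinuousLinearMap.snd ℝ L2 L2).intervalIntegral_comp_comm
        ((hfc y).intervalIntegrable 0 t)).symm
    have hle : R + C * |t - 0| ≤ 2 * R := by
      rw [sub_zero, abs_of_nonneg ht.1]
      nlinarith [ht.2]
    constructor
    · refine ballK_mono hle (ballK_add ⟨v₁, rfl, h₁⟩ ?_)
      rw [hfst]
      exact S.integral_mem_ballK hC0 (hfc y).fst.continuousOn
        fun s _ => (hC s _ (hextD y s).1 (hextD y s).2).1
    · refine ballK_mono hle (ballK_add ⟨v₂, rfl, h₂⟩ ?_)
      rw [hsnd]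
      exact S.integral_mem_ballK hC0 (hfc y).snd.continuousOn
        fun s _ => (hC s _ (hextD y s).1 (hextD y s).2).2
  let Φ : X → X := fun y => ⟨⟨fun t => Y y t, (hYc y).comp continuous_subtype_val⟩,
    fun t => hYD y t t.2⟩
  have hΦ : ContractingWith (1 / 2) Φ := by
    refine ⟨by norm_num, LipschitzWith.of_dist_le_mul fun y y' => ?_⟩
    rw [Subtype.dist_eq]
    refine (ContinuousMap.dist_le (by positivity)).mpr fun t => ?_
    change dist (Y y t) (Y y' t) ≤ _
    have hsub : Y y t - Y y' t
        = ∫ s in (0 : ℝ)..t, (field l b p s (ext y s) - field l b p s (ext y' s)) := by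
      rw [intervalIntegral.integral_sub ((hfc y).intervalIntegrable 0 t)
        ((hfc y').intervalIntegrable 0 t)]
      simp only [Y]
      abel
    have hb : ∀ s ∈ uIoc 0 (t : ℝ), ‖field l b p s (ext y s) - field l b p s (ext y' s)‖
        ≤ L * dist y y' := by
      intro s _
      rw [← dist_eq_norm]
      refine ((hL s).dist_le_mul _ (hextD y s) _ (hextD y' s)).trans ?_
      gcongr
      exact ContinuousMap.dist_apply_le_dist (f := y.1) (g := y'.1) _
    rw [dist_eq_norm, hsub]
    refine (intervalIntegral.norm_integral_le_of_norm_le_const hb).trans ?_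
    rw [sub_zero, abs_of_nonneg t.2.1]
    have hd : 0 ≤ dist y y' := dist_nonneg
    have hL0 : (0 : ℝ) ≤ L := L.2
    calc (L : ℝ) * dist y y' * t ≤ (L : ℝ) * dist y y' * τ := by gcongr; exact t.2.2
      _ = (L * τ) * dist y y' := by ring
      _ ≤ 1 / 2 * dist y y' := by gcongr
      _ = ((1 / 2 : NNReal) : ℝ) * dist y y' := by norm_num
  set y := hΦ.fixedPoint Φ
  have hfix : Φ y = y := hΦ.fixedPoint_isFixedPt
  have heq : ∀ t ∈ Icc 0 τ, Y y t = ext y t := by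
    intro t ht
    have h3 : (Φ y).1 ⟨t, ht⟩ = y.1 ⟨t, ht⟩ := by rw [hfix]
    change _ = IccExtend hτ.le _ t
    rw [IccExtend_of_mem _ _ ht]
    exact h3
  refine ⟨Y y, by simp [Y], fun t ht => hYD y t ⟨ht.1, ht.2.le⟩, fun t ht => ?_⟩
  rw [heq t ⟨ht.1, ht.2.le⟩]
  exact (hYd y t).hasDerivWithinAt

end Evolution


/-! ### Local flows and the interaction variables -/

section LocalFlow

variable {l b : ℝ → ℝ} {ρ r c₁ c₂ c₃ c₄ p : ℝ}

local notation "𝐊" => op (fun ξ => (symK l b ξ : ℂ))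
local notation "𝐒" => op (fun ξ => (symS ρ ξ : ℂ))
local notation "𝐖" => op (fun ξ => Complex.I * ((symS ρ ξ * symOm l ξ : ℝ) : ℂ))
local notation "𝐗" => op (fun ξ => Complex.I * ((symS ρ ξ * symD b ξ : ℝ) : ℂ))
local notation "𝐉" => op (fun ξ => Complex.I * ((symK l b ξ * symD b ξ : ℝ) : ℂ))

lemma Setup.continuous_nonlinearity_opK (S : Setup l b ρ r c₁ c₂ c₃ c₄ p) :
    Continuous (fun e => nonlinearity p (𝐊 e)) := by
  refine continuous_iff_continuousAt.mpr fun e₀ => ?_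
  have hc : ContinuousOn (fun e => nonlinearity p (𝐊 e)) (Metric.ball 0 (‖e₀‖ + 1)) := by
    obtain ⟨C, hC0, hC⟩ := S.exists_lipschitz (‖e₀‖ + 1)
    have hL : LipschitzOnWith ⟨C, hC0⟩ (nonlinearity p) (ballK l b (‖e₀‖ + 1)) := by
      refine LipschitzOnWith.of_dist_le_mul ?_
      rintro y ⟨v, rfl, hv⟩ y' ⟨v', rfl, hv'⟩
      rw [dist_eq_norm, dist_eq_norm]
      exact hC v v' hv hv'
    exact hL.continuousOn.comp (ContinuousLinearMap.continuous 𝐊).continuousOn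
      fun e he => ⟨e, rfl, (mem_ball_zero_iff.mp he).le⟩
  exact hc.continuousAt (Metric.isOpen_ball.mem_nhds (by simp))

lemma Setup.eq_of_opK_mem (S : Setup l b ρ r c₁ c₂ c₃ c₄ p) {v : L2} {R : ℝ}
    (h : 𝐊 v ∈ ballK l b R) : ‖v‖ ≤ R := by
  obtain ⟨v', hv', hR⟩ := h
  rwa [← S.opK_injective hv']

lemma Setup.opW_opK (S : Setup l b ρ r c₁ c₂ c₃ c₄ p) (v : L2) : 𝐖 (𝐊 v) = 𝐊 (𝐖 v) :=
  S.bSym_symS_om.op_comm S.bSym_k v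

lemma Setup.opS_opK (S : Setup l b ρ r c₁ c₂ c₃ c₄ p) (v : L2) : 𝐒 (𝐊 v) = 𝐊 (𝐒 v) :=
  S.bSym_symS.op_comm S.bSym_k v

/-- The fixed point lives among K-images; the flow itself is obtained by lifting it through K and
undoing the interaction picture. -/
lemma Setup.exists_flow (S : Setup l b ρ r c₁ c₂ c₃ c₄ p) {R : ℝ} (hR : 0 < R) :
    ∃ τ, 0 < τ ∧ ∀ e₀ a₀ : L2, ‖e₀‖ + ‖a₀‖ ≤ R →
      ∃ e a, Flow l b ρ p τ e a ∧ e 0 = e₀ ∧ a 0 = a₀ := by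
  obtain ⟨τ, hτ, H⟩ := S.exists_local_ode hR
  obtain ⟨C, hC0, hC⟩ := S.exists_field_mem (p := p) (2 * R)
  refine ⟨τ, hτ, fun e₀ a₀ h₀ => ?_⟩
  -- The system diagonalizes in e ± a, which satisfy (e ± a)_t = ±iΩ(e ± a) ± N.
  obtain ⟨y, hy0, hyD, hyd⟩ := H (e₀ + a₀) (e₀ - a₀) ((norm_add_le _ _).trans h₀)
    ((norm_sub_le _ _).trans h₀)
  have hyc : ContinuousOn y (Ico 0 τ) := fun t ht => (hyd t ht).continuousWithinAt
  have hfc : ContinuousOn (fun t => field l b p t (y t)) (Ico 0 τ) := S.continuousOn_field hyc hyD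
  have hint : ∀ t ∈ Ico 0 τ, ∀ s ∈ Ico 0 τ, ∫ σ in t..s, field l b p σ (y σ) = y s - y t :=
    fun t ht s hs => integral_eq_sub_of_hasDerivWithinAt_Ico hfc hyd ht hs
  have hV : ∀ t, ∃ V : L2 × L2, t ∈ Ico 0 τ →
      (𝐊 V.1 = (y t).1 ∧ 𝐊 V.2 = (y t).2 ∧ ‖V.1‖ ≤ 2 * R ∧ ‖V.2‖ ≤ 2 * R) := by
    intro t
    by_cases ht : t ∈ Ico 0 τ
    · obtain ⟨⟨v₁, h1, h1'⟩, ⟨v₂, h2, h2'⟩⟩ := hyD t ht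
      exact ⟨(v₁, v₂), fun _ => ⟨h1, h2, h1', h2'⟩⟩
    · exact ⟨0, fun h => absurd h ht⟩
  choose V hV using hV
  -- Inverting K is not continuous, but increments of y are integrals of the field, whose values are
  -- K-images of a ball of radius C; so the lift is C-Lipschitz.
  have hVc : ContinuousOn V (Ico 0 τ) := by
    have hL : LipschitzOnWith ⟨C, hC0⟩ V (Ico 0 τ) := by
      refine LipschitzOnWith.of_dist_le_mul fun s hs t ht => ?_
      have hsub := uIcc_subset_Ico ht hs
      have hI : IntervalIntegrable (fun σ => field l b p σ (y σ)) volume t s :=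
        (hfc.mono hsub).intervalIntegrable
      have hm1 : 𝐊 ((V s).1 - (V t).1) ∈ ballK l b (C * |s - t|) := by
        rw [map_sub, (hV s hs).1, (hV t ht).1, ← Prod.fst_sub, ← hint t ht s hs]
        have h1 : (∫ σ in t..s, field l b p σ (y σ)).1 = ∫ σ in t..s, (field l b p σ (y σ)).1 :=
          ((ContinuousLinearMap.fst ℝ L2 L2).intervalIntegral_comp_comm hI).symm
        rw [h1]
        exact S.integral_mem_ballK hC0 (hfc.mono hsub).fst
          fun σ hσ => (hC σ _ (hyD σ (hsub hσ)).1 (hyD σ (hsub hσ)).2).1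
      have hm2 : 𝐊 ((V s).2 - (V t).2) ∈ ballK l b (C * |s - t|) := by
        rw [map_sub, (hV s hs).2.1, (hV t ht).2.1, ← Prod.snd_sub, ← hint t ht s hs]
        have h1 : (∫ σ in t..s, field l b p σ (y σ)).2 = ∫ σ in t..s, (field l b p σ (y σ)).2 :=
          ((ContinuousLinearMap.snd ℝ L2 L2).intervalIntegral_comp_comm hI).symm
        rw [h1]
        exact S.integral_mem_ballK hC0 (hfc.mono hsub).snd
          fun σ hσ => (hC σ _ (hyD σ (hsub hσ)).1 (hyD σ (hsub hσ)).2).2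
      rw [dist_eq_norm, Prod.norm_def, Real.dist_eq]
      exact max_le (S.eq_of_opK_mem hm1) (S.eq_of_opK_mem hm2)
    exact hL.continuousOn
  have hG1 := S.continuousOn_grp continuous_id hVc.fst
  have hG2 := S.continuousOn_grp continuous_neg hVc.snd
  set e : ℝ → L2 := fun t => (1 / 2 : ℝ) • (grp l t (V t).1 + grp l (-t) (V t).2) with he
  set a : ℝ → L2 := fun t => (1 / 2 : ℝ) • (grp l t (V t).1 - grp l (-t) (V t).2) with ha
  have hec : ContinuousOn e (Ico 0 τ) := ContinuousOn.const_smul (hG1.add hG2) (1 / 2 : ℝ)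
  have hac : ContinuousOn a (Ico 0 τ) := ContinuousOn.const_smul (hG1.sub hG2) (1 / 2 : ℝ)
  have hKe : ∀ t ∈ Ico 0 τ, 𝐊 (e t) = (1 / 2 : ℝ) • (grp l t (y t).1 + grp l (-t) (y t).2) := by
    intro t ht
    rw [he, map_smul, map_add, ← S.grp_op_comm S.bSym_k, ← S.grp_op_comm S.bSym_k, (hV t ht).1,
      (hV t ht).2.1]
  have hKa : ∀ t ∈ Ico 0 τ, 𝐊 (a t) = (1 / 2 : ℝ) • (grp l t (y t).1 - grp l (-t) (y t).2) := by
    intro t ht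
    rw [ha, map_smul, map_sub, ← S.grp_op_comm S.bSym_k, ← S.grp_op_comm S.bSym_k, (hV t ht).1,
      (hV t ht).2.1]
  clear_value e a
  have hst : ∀ t ∈ Ico 0 τ, stateU l t (y t) = 𝐊 (e t) := fun t ht => (hKe t ht).symm
  have hd1 : ∀ t ∈ Ico 0 τ, HasDerivWithinAt (fun s => 𝐒 (grp l s (y s).1))
      (𝐖 (grp l t (y t).1) + 𝐒 (𝐉 (nonlinearity p (𝐊 (e t))))) (Ico 0 τ) t := by
    intro t ht
    have h1 := S.hasDerivWithinAt_opS_grp (hyd t ht).fst 1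
    simp only [one_mul, one_smul] at h1
    simpa only [field, S.grp_grp_neg, hst t ht] using h1
  have hd2 : ∀ t ∈ Ico 0 τ, HasDerivWithinAt (fun s => 𝐒 (grp l (-s) (y s).2))
      (-𝐖 (grp l (-t) (y t).2) - 𝐒 (𝐉 (nonlinearity p (𝐊 (e t))))) (Ico 0 τ) t := by
    intro t ht
    have h1 := S.hasDerivWithinAt_opS_grp (hyd t ht).snd (-1)
    simp only [neg_mul, one_mul, neg_smul, one_smul] at h1
    simpa only [field, map_neg, S.grp_neg_grp, hst t ht, ← sub_eq_add_neg] using h1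
  refine ⟨e, a, ⟨hec, hac, ?_, ?_⟩, ?_, ?_⟩
  · intro t ht
    refine hasDerivWithinAt_of_separating (ι := Unit) (fun _ => 𝐊)
      (fun v hv => S.opK_injective (by rw [hv (), map_zero])) (z := fun t => 𝐖 (a t))
      ((ContinuousLinearMap.continuous 𝐖).comp_continuousOn hac) (fun _ t ht => ?_) ht
    have h1 := ((hd1 t ht).add (hd2 t ht)).const_smul (1 / 2 : ℝ)
    refine (h1.congr_deriv ?_).congr_of_mem (fun s hs => ?_) ht
    · rw [← S.opW_opK, hKa t ht, map_smul, map_sub]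
      congr 1
      abel
    · rw [← S.opS_opK, hKe s hs, map_smul, map_add]
      rfl
  · intro t ht
    refine hasDerivWithinAt_of_separating (ι := Unit) (fun _ => 𝐊)
      (fun v hv => S.opK_injective (by rw [hv (), map_zero]))
      (z := fun t => 𝐖 (e t) + 𝐗 (nonlinearity p (𝐊 (e t))))
      (((ContinuousLinearMap.continuous 𝐖).comp_continuousOn hec).add
        ((ContinuousLinearMap.continuous 𝐗).comp_continuousOn
          (S.continuous_nonlinearity_opK.comp_continuousOn hec))) (fun _ t ht => ?_) ht
    have h1 := ((hd1 t ht).sub (hd2 t ht)).const_smul (1 / 2 : ℝ)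
    refine (h1.congr_deriv ?_).congr_of_mem (fun s hs => ?_) ht
    · rw [map_add, ← S.opW_opK, S.opK_opX, hKe t ht, map_smul, map_add]
      module
    · rw [← S.opS_opK, hKa s hs, map_smul, map_sub]
      rfl
  · have h0 : (0 : ℝ) ∈ Ico 0 τ := ⟨le_rfl, hτ⟩
    refine S.opK_injective ?_
    rw [hKe 0 h0, hy0, neg_zero, S.grp_zero, S.grp_zero, ← map_add, ← map_smul]
    congr 1
    module
  · have h0 : (0 : ℝ) ∈ Ico 0 τ := ⟨le_rfl, hτ⟩
    refine S.opK_injective ?_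
    rw [hKa 0 h0, hy0, neg_zero, S.grp_zero, S.grp_zero, ← map_sub, ← map_smul]
    congr 1
    module

/-- The profiles `G(-σt)(e + σa)` of a flow. -/
def profile (l : ℝ → ℝ) (e a : ℝ → L2) (σ t : ℝ) : L2 := grp l (-(σ * t)) (e t + σ • a t)

lemma Flow.continuousOn_nonlinearity (S : Setup l b ρ r c₁ c₂ c₃ c₄ p) {T : ℝ} {e a : ℝ → L2}
    (F : Flow l b ρ p T e a) : ContinuousOn (fun t => nonlinearity p (𝐊 (e t))) (Ico 0 T) :=
  S.continuous_nonlinearity_opK.comp_continuousOn F.cont_e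

/-- In the interaction picture the generator cancels and only the forcing remains. The proof smooths
twice: once because a flow is differentiable only after smoothing, once to differentiate the group;
injectivity removes both. -/
lemma Flow.hasDerivWithinAt_profile (S : Setup l b ρ r c₁ c₂ c₃ c₄ p) {T : ℝ} {e a : ℝ → L2}
    (F : Flow l b ρ p T e a) {σ : ℝ} (hσ : σ * σ = 1) {t : ℝ} (ht : t ∈ Ico 0 T) :
    HasDerivWithinAt (fun s => 𝐊 (profile l e a σ s))
      (σ • grp l (-(σ * t)) (𝐉 (nonlinearity p (𝐊 (e t))))) (Ico 0 T) t := by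
  refine hasDerivWithinAt_of_separating (ι := Unit) (fun _ => 𝐒 ∘L 𝐒)
    (fun v hv => S.opS_injective (S.opS_injective (by
      rw [map_zero, map_zero]; exact hv ())))
    (z := fun t => σ • grp l (-(σ * t)) (𝐉 (nonlinearity p (𝐊 (e t)))))
    ((S.continuousOn_grp (by fun_prop) ((ContinuousLinearMap.continuous 𝐉).comp_continuousOn
      (F.continuousOn_nonlinearity S))).const_smul σ) (fun _ t ht => ?_) ht
  have h1 : HasDerivWithinAt (fun s => 𝐒 (e s + σ • a s))
      (σ • (𝐖 (e t + σ • a t) + 𝐗 (nonlinearity p (𝐊 (e t))))) (Ico 0 T) t := by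
    refine (((F.der_e t ht).add ((F.der_a t ht).const_smul σ)).congr_deriv ?_).congr_of_mem
      (fun s _ => ?_) ht
    · rw [map_add, map_smul]
      simp only [smul_add, smul_smul, hσ, one_smul]
      abel
    · rw [map_add, map_smul]
      rfl
  have h2 := S.hasDerivWithinAt_opS_grp h1 (-σ)
  have h3 := (ContinuousLinearMap.hasFDerivAt 𝐊).comp_hasDerivWithinAt t h2
  refine (h3.congr_deriv ?_).congr_of_mem (fun s _ => ?_) ht
  · generalize e t + σ • a t = x
    generalize hg : nonlinearity p (𝐊 (e t)) = g
    have hc : 𝐖 (grp l (-σ * t) (𝐒 x)) = 𝐒 (grp l (-σ * t) (𝐖 x)) := by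
      rw [S.grp_op_comm S.bSym_symS, S.bSym_symS_om.op_comm S.bSym_symS,
        S.grp_op_comm S.bSym_symS_om]
    have hc' : 𝐊 (𝐒 (grp l (-σ * t) (𝐗 g))) = 𝐒 (𝐒 (grp l (-σ * t) (𝐉 g))) := by
      rw [← S.opS_opK, ← S.grp_op_comm S.bSym_k, S.opK_opX, S.grp_op_comm S.bSym_symS]
    simp only [neg_mul] at hc hc'
    simp only [map_add, map_smul, smul_add, neg_mul, neg_smul, ContinuousLinearMap.comp_apply, hc,
      hc', neg_add_cancel_left]
  · simp only [profile, Function.comp_apply, ContinuousLinearMap.comp_apply]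
    rw [S.opS_opK, S.opS_opK, neg_mul, S.grp_op_comm S.bSym_symS]

lemma Setup.stateU_profile (S : Setup l b ρ r c₁ c₂ c₃ c₄ p) (e a : ℝ → L2) (t : ℝ) :
    stateU l t (𝐊 (profile l e a 1 t), 𝐊 (profile l e a (-1) t)) = 𝐊 (e t) := by
  rw [S.stateU_opK]
  simp only [profile, one_mul, one_smul, neg_mul, neg_neg, neg_smul]
  rw [S.grp_grp_neg, S.grp_neg_grp]
  congr 1
  module

lemma Flow.hasDerivWithinAt_field (S : Setup l b ρ r c₁ c₂ c₃ c₄ p) {T : ℝ} {e a : ℝ → L2}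
    (F : Flow l b ρ p T e a) {t : ℝ} (ht : t ∈ Ico 0 T) :
    HasDerivWithinAt (fun s => (𝐊 (profile l e a 1 s), 𝐊 (profile l e a (-1) s)))
      (field l b p t (𝐊 (profile l e a 1 t), 𝐊 (profile l e a (-1) t))) (Ico 0 T) t := by
  refine ((F.hasDerivWithinAt_profile S (by norm_num) ht).prodMk
    (F.hasDerivWithinAt_profile S (by norm_num) ht)).congr_deriv ?_
  simp only [field, S.stateU_profile, one_mul, one_smul, neg_mul, neg_neg, neg_smul]

lemma Setup.norm_profile_le (S : Setup l b ρ r c₁ c₂ c₃ c₄ p) (e a : ℝ → L2) {σ : ℝ}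
    (hσ : |σ| ≤ 1) (t : ℝ) : ‖profile l e a σ t‖ ≤ ‖e t‖ + ‖a t‖ := by
  rw [profile, S.norm_grp]
  refine (norm_add_le _ _).trans ?_
  rw [norm_smul, Real.norm_eq_abs]
  nlinarith [norm_nonneg (a t)]

/-- On compact intervals both flows give interaction variables in a common K-ball, where the field
is Lipschitz in L². Uniqueness for the ordinary differential equation and injectivity of K and of
the group give the claim. -/
lemma Flow.unique (S : Setup l b ρ r c₁ c₂ c₃ c₄ p) {T : ℝ} {e a e' a' : ℝ → L2}
    (F : Flow l b ρ p T e a) (F' : Flow l b ρ p T e' a') (he : e 0 = e' 0) (ha : a 0 = a' 0)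
    {t : ℝ} (ht : t ∈ Ico 0 T) : e t = e' t ∧ a t = a' t := by
  have hsub : Icc 0 t ⊆ Ico 0 T := fun s hs => ⟨hs.1, hs.2.trans_lt ht.2⟩
  have hbdd : ∀ {e a : ℝ → L2}, Flow l b ρ p T e a → ∃ R, ∀ s ∈ Icc 0 t, ‖e s‖ + ‖a s‖ ≤ R := by
    intro e a F
    obtain ⟨R, hR⟩ := isCompact_Icc.exists_bound_of_continuousOn
      ((F.cont_e.norm.add F.cont_a.norm).mono hsub)
    exact ⟨R, fun s hs => (le_abs_self _).trans (hR s hs)⟩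
  obtain ⟨R₁, hR₁⟩ := hbdd F
  obtain ⟨R₂, hR₂⟩ := hbdd F'
  obtain ⟨C, hC⟩ := S.exists_field_lipschitz (max R₁ R₂)
  have hder : ∀ {e a : ℝ → L2}, Flow l b ρ p T e a → ∀ s ∈ Ico 0 t,
      HasDerivWithinAt (fun s => (𝐊 (profile l e a 1 s), 𝐊 (profile l e a (-1) s)))
      (field l b p s (𝐊 (profile l e a 1 s), 𝐊 (profile l e a (-1) s))) (Ici s) s := by
    intro e a F s hs
    have h1 := F.hasDerivWithinAt_field S (hsub ⟨hs.1, hs.2.le⟩)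
    refine h1.mono_of_mem_nhdsWithin ?_
    filter_upwards [self_mem_nhdsWithin,
      mem_nhdsWithin_of_mem_nhds (Iio_mem_nhds (hs.2.trans ht.2))] with q hq hq'
    exact ⟨hs.1.trans hq, hq'⟩
  have hcont : ∀ {e a : ℝ → L2}, Flow l b ρ p T e a → ContinuousOn
      (fun s => (𝐊 (profile l e a 1 s), 𝐊 (profile l e a (-1) s))) (Icc 0 t) :=
    fun F s hs => ((F.hasDerivWithinAt_field S (hsub hs)).continuousWithinAt).mono hsub
  have hEq := ODE_solution_unique_of_mem_Icc_right (a := 0) (b := t) (v := field l b p)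
    (s := fun _ => {y | y.1 ∈ ballK l b (max R₁ R₂) ∧ y.2 ∈ ballK l b (max R₁ R₂)})
    (fun s _ => hC s) (hcont F) (hder F)
    (fun s hs => ⟨⟨_, rfl, (S.norm_profile_le e a (by simp) s).trans
        ((hR₁ s ⟨hs.1, hs.2.le⟩).trans (le_max_left _ _))⟩,
      ⟨_, rfl, (S.norm_profile_le e a (by simp) s).trans
        ((hR₁ s ⟨hs.1, hs.2.le⟩).trans (le_max_left _ _))⟩⟩)
    (hcont F') (hder F')
    (fun s hs => ⟨⟨_, rfl, (S.norm_profile_le e' a' (by simp) s).trans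
        ((hR₂ s ⟨hs.1, hs.2.le⟩).trans (le_max_right _ _))⟩,
      ⟨_, rfl, (S.norm_profile_le e' a' (by simp) s).trans
        ((hR₂ s ⟨hs.1, hs.2.le⟩).trans (le_max_right _ _))⟩⟩)
    (by simp only [profile, he, ha])
  have h := hEq ⟨ht.1, le_rfl⟩
  simp only [Prod.mk.injEq] at h
  have hinj : ∀ {s : ℝ} {x x' : L2}, grp l s x = grp l s x' → x = x' := by
    intro s x x' hx
    rw [← S.grp_neg_grp s x, hx, S.grp_neg_grp]
  have h1 := hinj (S.opK_injective h.1)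
  have h2 := hinj (S.opK_injective h.2)
  simp only [one_smul, neg_smul] at h1 h2
  constructor
  · have : (2 : ℝ) • e t = (2 : ℝ) • e' t := by
      calc (2 : ℝ) • e t = (e t + a t) + (e t + -a t) := by module
        _ = (2 : ℝ) • e' t := by rw [h1, h2]; module
    exact smul_right_injective L2 (two_ne_zero) this
  · have : (2 : ℝ) • a t = (2 : ℝ) • a' t := by
      calc (2 : ℝ) • a t = (e t + a t) - (e t + -a t) := by module
        _ = (2 : ℝ) • a' t := by rw [h1, h2]; module
    exact smul_right_injective L2 (two_ne_zero) this

end LocalFlow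

/-! ### Maximal flows -/

section MaximalFlow

variable {l b : ℝ → ℝ} {ρ r c₁ c₂ c₃ c₄ p : ℝ}

/-- The conditions of `Flow` at a single time. -/
structure FlowAt (l b : ℝ → ℝ) (ρ p : ℝ) (e a : ℝ → L2) (t : ℝ) : Prop where
  cont_e : ContinuousWithinAt e (Ici 0) t
  cont_a : ContinuousWithinAt a (Ici 0) t
  der_e : HasDerivWithinAt (fun s => op (fun ξ => (symS ρ ξ : ℂ)) (e s))
    (op (fun ξ => Complex.I * ((symS ρ ξ * symOm l ξ : ℝ) : ℂ)) (a t)) (Ici 0) t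
  der_a : HasDerivWithinAt (fun s => op (fun ξ => (symS ρ ξ : ℂ)) (a s))
    (op (fun ξ => Complex.I * ((symS ρ ξ * symOm l ξ : ℝ) : ℂ)) (e t)
      + op (fun ξ => Complex.I * ((symS ρ ξ * symD b ξ : ℝ) : ℂ))
        (nonlinearity p (op (fun ξ => (symK l b ξ : ℂ)) (e t)))) (Ici 0) t

lemma Ico_eventuallyEq_Ici {T t : ℝ} (ht : t < T) : Ico 0 T =ᶠ[𝓝 t] Ici 0 := by
  filter_upwards [Iio_mem_nhds ht] with s hs
  exact propext ⟨fun h => h.1, fun h => ⟨h, hs⟩⟩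

/-- The conditions become local in time and no longer mention T, which makes restricting, shifting
and gluing routine. -/
lemma flow_iff {T : ℝ} {e a : ℝ → L2} :
    Flow l b ρ p T e a ↔ ∀ t ∈ Ico 0 T, FlowAt l b ρ p e a t := by
  constructor
  · intro F t ht
    have h := Ico_eventuallyEq_Ici ht.2
    exact ⟨(continuousWithinAt_congr_set h).mp (F.cont_e t ht),
      (continuousWithinAt_congr_set h).mp (F.cont_a t ht),
      (hasDerivWithinAt_congr_set h).mp (F.der_e t ht),
      (hasDerivWithinAt_congr_set h).mp (F.der_a t ht)⟩
  · intro F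
    refine ⟨fun t ht => ?_, fun t ht => ?_, fun t ht => ?_, fun t ht => ?_⟩
    · exact (continuousWithinAt_congr_set (Ico_eventuallyEq_Ici ht.2)).mpr (F t ht).cont_e
    · exact (continuousWithinAt_congr_set (Ico_eventuallyEq_Ici ht.2)).mpr (F t ht).cont_a
    · exact (hasDerivWithinAt_congr_set (Ico_eventuallyEq_Ici ht.2)).mpr (F t ht).der_e
    · exact (hasDerivWithinAt_congr_set (Ico_eventuallyEq_Ici ht.2)).mpr (F t ht).der_a

lemma FlowAt.congr {e a e' a' : ℝ → L2} {t : ℝ} (F : FlowAt l b ρ p e a t) (ht : 0 ≤ t)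
    (he : e' =ᶠ[𝓝[Ici 0] t] e) (ha : a' =ᶠ[𝓝[Ici 0] t] a) : FlowAt l b ρ p e' a' t := by
  have h1 : e' t = e t := he.self_of_nhdsWithin ht
  have h2 : a' t = a t := ha.self_of_nhdsWithin ht
  refine ⟨F.cont_e.congr_of_eventuallyEq he h1, F.cont_a.congr_of_eventuallyEq ha h2, ?_, ?_⟩
  · rw [h2]
    exact F.der_e.congr_of_eventuallyEq (he.fun_comp _) (congrArg _ h1)
  · rw [h1]
    exact F.der_a.congr_of_eventuallyEq (ha.fun_comp _) (congrArg _ h2)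

lemma FlowAt.comp_add {e a : ℝ → L2} {t t₁ : ℝ} (F : FlowAt l b ρ p e a (t + t₁)) (ht₁ : 0 ≤ t₁) :
    FlowAt l b ρ p (fun s => e (s + t₁)) (fun s => a (s + t₁)) t := by
  have hm : MapsTo (fun s : ℝ => s + t₁) (Ici 0) (Ici 0) :=
    fun s (hs : 0 ≤ s) => add_nonneg hs ht₁
  have hc : ContinuousWithinAt (fun s : ℝ => s + t₁) (Ici 0) t := by fun_prop
  have hd : HasDerivWithinAt (fun s : ℝ => s + t₁) 1 (Ici 0) t :=
    (hasDerivWithinAt_id t _).add_const t₁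
  refine ⟨F.cont_e.comp (f := fun s : ℝ => s + t₁) hc hm,
    F.cont_a.comp (f := fun s : ℝ => s + t₁) hc hm, ?_, ?_⟩
  · simpa [Function.comp_def] using F.der_e.scomp t hd hm
  · simpa [Function.comp_def] using F.der_a.scomp t hd hm

/-- The strict inequality puts t - t₁ in the interior of [0, ∞), where one-sided and two-sided
derivatives agree. -/
lemma FlowAt.comp_sub {e a : ℝ → L2} {t t₁ : ℝ} (F : FlowAt l b ρ p e a (t - t₁)) (ht : t₁ < t) :
    FlowAt l b ρ p (fun s => e (s - t₁)) (fun s => a (s - t₁)) t := by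
  have hn : Ici (0 : ℝ) ∈ 𝓝 (t - t₁) := Ici_mem_nhds (sub_pos.mpr ht)
  have hc : ContinuousAt (fun s : ℝ => s - t₁) t := by fun_prop
  have hd : HasDerivAt (fun s : ℝ => s - t₁) 1 t := (hasDerivAt_id t).sub_const t₁
  refine ⟨((F.cont_e.continuousAt hn).comp (f := fun s : ℝ => s - t₁) hc).continuousWithinAt,
    ((F.cont_a.continuousAt hn).comp (f := fun s : ℝ => s - t₁) hc).continuousWithinAt, ?_, ?_⟩
  · simpa [Function.comp_def] using
      ((F.der_e.hasDerivAt hn).scomp (h := fun s : ℝ => s - t₁) t hd).hasDerivWithinAt (s := Ici 0)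
  · simpa [Function.comp_def] using
      ((F.der_a.hasDerivAt hn).scomp (h := fun s : ℝ => s - t₁) t hd).hasDerivWithinAt (s := Ici 0)

lemma Flow.mono {T T' : ℝ} {e a : ℝ → L2} (F : Flow l b ρ p T e a) (h : T' ≤ T) :
    Flow l b ρ p T' e a :=
  flow_iff.mpr fun t ht => flow_iff.mp F t ⟨ht.1, ht.2.trans_le h⟩

lemma Flow.congr {T : ℝ} {e a e' a' : ℝ → L2} (F : Flow l b ρ p T e a)
    (he : EqOn e' e (Ico 0 T)) (ha : EqOn a' a (Ico 0 T)) : Flow l b ρ p T e' a' := by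
  refine flow_iff.mpr fun t ht => (flow_iff.mp F t ht).congr ht.1 ?_ ?_
  · filter_upwards [self_mem_nhdsWithin, mem_nhdsWithin_of_mem_nhds (Iio_mem_nhds ht.2)] with s hs hs'
    exact he ⟨hs, hs'⟩
  · filter_upwards [self_mem_nhdsWithin, mem_nhdsWithin_of_mem_nhds (Iio_mem_nhds ht.2)] with s hs hs'
    exact ha ⟨hs, hs'⟩

/-- The second flow starts at t₁ < T, so it overlaps the first and agrees with it by uniqueness;
around T the glued curve is therefore just the shifted second flow. -/
lemma Flow.extend (S : Setup l b ρ r c₁ c₂ c₃ c₄ p) {T τ t₁ : ℝ} {e a e₂ a₂ : ℝ → L2}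
    (F : Flow l b ρ p T e a) (F₂ : Flow l b ρ p τ e₂ a₂) (ht₁ : t₁ ∈ Ico 0 T)
    (he : e₂ 0 = e t₁) (ha : a₂ 0 = a t₁) :
    Flow l b ρ p (t₁ + τ) (fun t => if t < T then e t else e₂ (t - t₁))
      (fun t => if t < T then a t else a₂ (t - t₁)) := by
  have hsh : Flow l b ρ p (T - t₁) (fun s => e (s + t₁)) (fun s => a (s + t₁)) :=
    flow_iff.mpr fun t ht => (flow_iff.mp F (t + t₁) ⟨by linarith [ht.1, ht₁.1],
      by linarith [ht.2]⟩).comp_add ht₁.1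
  have huniq : ∀ s, t₁ ≤ s → s < T → s < t₁ + τ → e s = e₂ (s - t₁) ∧ a s = a₂ (s - t₁) := by
    intro s h1 h2 h3
    have h := (hsh.mono (min_le_left _ τ)).unique S (F₂.mono (min_le_right _ _))
      (by simp [he]) (by simp [ha]) (t := s - t₁)
      ⟨by linarith, lt_min (by linarith) (by linarith)⟩
    simpa using h
  refine flow_iff.mpr fun t ht => ?_
  by_cases htT : t < T
  · refine (flow_iff.mp F t ⟨ht.1, htT⟩).congr ht.1 ?_ ?_
    · filter_upwards [mem_nhdsWithin_of_mem_nhds (Iio_mem_nhds htT)] with s hs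
      exact if_pos hs
    · filter_upwards [mem_nhdsWithin_of_mem_nhds (Iio_mem_nhds htT)] with s hs
      exact if_pos hs
  · have ht₁t : t₁ < t := ht₁.2.trans_le (not_lt.mp htT)
    refine ((flow_iff.mp F₂ (t - t₁) ⟨by linarith, by linarith [ht.2]⟩).comp_sub ht₁t).congr
      ht.1 ?_ ?_
    · filter_upwards [mem_nhdsWithin_of_mem_nhds (Ioo_mem_nhds ht₁t ht.2)] with s hs
      by_cases hsT : s < T
      · simp only [if_pos hsT]
        exact (huniq s hs.1.le hsT hs.2).1
      · simp only [if_neg hsT]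
    · filter_upwards [mem_nhdsWithin_of_mem_nhds (Ioo_mem_nhds ht₁t ht.2)] with s hs
      by_cases hsT : s < T
      · simp only [if_pos hsT]
        exact (huniq s hs.1.le hsT hs.2).2
      · simp only [if_neg hsT]

/-- Every datum has either a global flow, or a maximal one whose norm tends to infinity. -/
theorem Setup.exists_maximal_flow (S : Setup l b ρ r c₁ c₂ c₃ c₄ p) (e₀ a₀ : L2) :
    ∃ e a : ℝ → L2, e 0 = e₀ ∧ a 0 = a₀ ∧ ((∀ T, Flow l b ρ p T e a) ∨
      ∃ T, 0 < T ∧ Flow l b ρ p T e a ∧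
        (∀ T' e' a', Flow l b ρ p T' e' a' → e' 0 = e₀ → a' 0 = a₀ → T' ≤ T) ∧
        Tendsto (fun t => ‖e t‖ + ‖a t‖) (𝓝[<] T) atTop) := by
  classical
  let P : ℝ → Prop := fun T => ∃ e a, Flow l b ρ p T e a ∧ e 0 = e₀ ∧ a 0 = a₀
  obtain ⟨τ₀, hτ₀, hP₀⟩ : ∃ τ, 0 < τ ∧ P τ := by
    obtain ⟨τ, hτ, H⟩ := S.exists_flow (p := p) (R := ‖e₀‖ + ‖a₀‖ + 1) (by positivity)
    exact ⟨τ, hτ, H e₀ a₀ (by linarith)⟩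
  -- By uniqueness all flows with these data that reach t share one value there; where none does,
  -- the value is irrelevant.
  have hch : ∀ t, ∃ z : L2 × L2, ∀ T e' a', t ∈ Ico 0 T → Flow l b ρ p T e' a' → e' 0 = e₀ →
      a' 0 = a₀ → e' t = z.1 ∧ a' t = z.2 := by
    intro t
    by_cases h : ∃ T e' a', t ∈ Ico 0 T ∧ Flow l b ρ p T e' a' ∧ e' 0 = e₀ ∧ a' 0 = a₀
    · obtain ⟨T', e', a', ht', F', he', ha'⟩ := h
      refine ⟨(e' t, a' t), fun T e'' a'' ht F'' he'' ha'' => ?_⟩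
      exact (F''.mono (min_le_left T T')).unique S (F'.mono (min_le_right T T'))
        (he''.trans he'.symm) (ha''.trans ha'.symm) ⟨ht.1, lt_min ht.2 ht'.2⟩
    · refine ⟨0, fun T e' a' ht F' he' ha' => absurd ⟨T, e', a', ht, F', he', ha'⟩ h⟩
  choose z hz using hch
  have hflow : ∀ T, P T → Flow l b ρ p T (fun t => (z t).1) (fun t => (z t).2) := by
    rintro T ⟨e', a', F', he', ha'⟩
    exact F'.congr (fun t ht => (hz t T e' a' ht F' he' ha').1.symm)
      (fun t ht => (hz t T e' a' ht F' he' ha').2.symm)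
  have h00 : (z 0).1 = e₀ ∧ (z 0).2 = a₀ := by
    obtain ⟨e', a', F', he', ha'⟩ := hP₀
    have := hz 0 τ₀ e' a' ⟨le_rfl, hτ₀⟩ F' he' ha'
    exact ⟨this.1.symm.trans he', this.2.symm.trans ha'⟩
  refine ⟨fun t => (z t).1, fun t => (z t).2, h00.1, h00.2, ?_⟩
  by_cases hB : BddAbove {T | P T}
  · right
    have hne : {T | P T}.Nonempty := ⟨τ₀, hP₀⟩
    set T := sSup {T | P T} with hT
    have hTpos : 0 < T := hτ₀.trans_le (le_csSup hB hP₀)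
    have F : Flow l b ρ p T (fun t => (z t).1) (fun t => (z t).2) := by
      refine flow_iff.mpr fun t ht => ?_
      obtain ⟨T', hT', htT'⟩ := exists_lt_of_lt_csSup hne ht.2
      exact flow_iff.mp (hflow T' hT') t ⟨ht.1, htT'⟩
    refine ⟨T, hTpos, F, fun T' e' a' F' he' ha' => le_csSup hB ⟨e', a', F', he', ha'⟩, ?_⟩
    refine tendsto_atTop.mpr fun R => ?_
    obtain ⟨τ, hτ, H⟩ := S.exists_flow (p := p) (R := max R 1) (by positivity)
    filter_upwards [Ioo_mem_nhdsLT (show max 0 (T - τ) < T from max_lt hTpos (by linarith))]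
      with t ht
    -- If the norm were below R at a time closer to T than τ, the guaranteed existence time for data
    -- of that size would continue the flow past T.
    by_contra! hlt
    have ht0 : 0 < t := (le_max_left _ _).trans_lt ht.1
    have htτ : T - τ < t := (le_max_right _ _).trans_lt ht.1
    obtain ⟨e₂, a₂, F₂, he₂, ha₂⟩ := H (z t).1 (z t).2 (hlt.le.trans (le_max_left _ _))
    have hE := F.extend S F₂ ⟨ht0.le, ht.2⟩ he₂ ha₂
    have : t + τ ≤ T := le_csSup hB ⟨_, _, hE, by simp [hTpos, h00.1], by simp [hTpos, h00.2]⟩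
    linarith
  · left
    intro T
    obtain ⟨T', hT', hlt⟩ := not_bddAbove_iff.mp hB T
    exact (hflow T' hT').mono hlt.le

end MaximalFlow

/-! ### Conservation laws -/

lemma IsMul.inner_left_neg {m n : ℝ → ℂ} {u v u' v' : L2} (h : IsMul m u v) (h' : IsMul n u' v')
    (hmn : ∀ ξ, starRingEnd ℂ (m ξ) = -n ξ) : ⟪v, u'⟫ = -⟪u, v'⟫ := by
  have hn : IsMul (fun ξ => -n ξ) u' ((-1 : ℝ) • v') := by
    filter_upwards [h', fourierL2_smul_ae (-1) v'] with η h1 h2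
    rw [h2, h1]
    simp
  rw [h.inner_left hn hmn, inner_smul_right, neg_one_mul]

lemma AEBdd.mono {M M' : ℝ} (h : M ≤ M') {u : L2} (hu : AEBdd M u) : AEBdd M' u :=
  Eventually.mono hu fun _ hx => hx.trans h

section Conservation

variable {l b : ℝ → ℝ} {ρ r c₁ c₂ c₃ c₄ p : ℝ}

local notation "𝐊" => op (fun ξ => (symK l b ξ : ℂ))
local notation "𝐒" => op (fun ξ => (symS ρ ξ : ℂ))
local notation "𝐖" => op (fun ξ => Complex.I * ((symS ρ ξ * symOm l ξ : ℝ) : ℂ))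
local notation "𝐉" => op (fun ξ => Complex.I * ((symK l b ξ * symD b ξ : ℝ) : ℂ))
local notation "𝚲" => op (fun ξ => (symLam l ξ : ℂ))

lemma eventually_mem_Icc_nhdsWithin {T t : ℝ} (ht : t ∈ Ico 0 T) :
    ∃ t', t ∈ Icc 0 t' ∧ Icc 0 t' ⊆ Ico 0 T ∧ ∀ᶠ s in 𝓝[Ico 0 T] t, s ∈ Icc 0 t' := by
  refine ⟨(t + T) / 2, ⟨ht.1, by linarith [ht.2]⟩,
    fun s hs => ⟨hs.1, hs.2.trans_lt (by linarith [ht.2])⟩, ?_⟩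
  filter_upwards [self_mem_nhdsWithin,
    mem_nhdsWithin_of_mem_nhds (Iio_mem_nhds (show t < (t + T) / 2 by linarith [ht.2]))] with s hs hs'
  exact ⟨hs.1, (mem_Iio.mp hs').le⟩

lemma exists_norm_le_Icc {T t' : ℝ} {e : ℝ → L2} (he : ContinuousOn e (Ico 0 T))
    (h : Icc 0 t' ⊆ Ico 0 T) : ∃ R, ∀ s ∈ Icc 0 t', ‖e s‖ ≤ R :=
  isCompact_Icc.exists_bound_of_continuousOn (he.mono h)

lemma Flow.exists_forcing_bound (S : Setup l b ρ r c₁ c₂ c₃ c₄ p) {T : ℝ} {e a : ℝ → L2}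
    (F : Flow l b ρ p T e a) {t' : ℝ} (h : Icc 0 t' ⊆ Ico 0 T) :
    ∃ C, 0 ≤ C ∧ ∀ s ∈ Icc 0 t', ‖forcing b p (𝐊 (e s))‖ ≤ C := by
  obtain ⟨R, hR⟩ := exists_norm_le_Icc F.cont_e h
  obtain ⟨C, hC0, hC⟩ := S.exists_forcing_bound (p := p) R
  exact ⟨C, hC0, fun s hs => hC _ (hR s hs)⟩

lemma Flow.hasDerivWithinAt_opK_profile (S : Setup l b ρ r c₁ c₂ c₃ c₄ p) {T : ℝ} {e a : ℝ → L2}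
    (F : Flow l b ρ p T e a) {σ : ℝ} (hσ : σ * σ = 1) {t : ℝ} (ht : t ∈ Ico 0 T) :
    HasDerivWithinAt (fun s => 𝐊 (profile l e a σ s))
      (𝐊 (σ • grp l (-(σ * t)) (forcing b p (𝐊 (e t))))) (Ico 0 T) t := by
  refine (F.hasDerivWithinAt_profile S hσ ht).congr_deriv ?_
  rw [S.opJ_nonlinearity, map_smul, S.grp_op_comm S.bSym_k]

/-- The equation for K-smoothed profiles is integrated; since its right side consists of K-images of
a locally bounded forcing, `Setup.integral_mem_ballK` bounds the unsmoothed increments. -/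
lemma Flow.profile_lipschitz (S : Setup l b ρ r c₁ c₂ c₃ c₄ p) {T : ℝ} {e a : ℝ → L2}
    (F : Flow l b ρ p T e a) {σ : ℝ} (hσ : σ * σ = 1) {t : ℝ} (ht : t ∈ Ico 0 T) :
    ∃ C, ∀ᶠ s in 𝓝[Ico 0 T] t, ‖profile l e a σ s - profile l e a σ t‖ ≤ C * |s - t| := by
  obtain ⟨t', htt', hsub, hev⟩ := eventually_mem_Icc_nhdsWithin ht
  obtain ⟨C, hC0, hC⟩ := F.exists_forcing_bound S hsub
  refine ⟨C, ?_⟩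
  have hσ1 : |σ| = 1 := by
    have : |σ| * |σ| = 1 := by rw [abs_mul_abs_self, hσ]
    nlinarith [abs_nonneg σ]
  have hcont : ContinuousOn (fun t => σ • grp l (-(σ * t)) (𝐉 (nonlinearity p (𝐊 (e t)))))
      (Ico 0 T) :=
    (S.continuousOn_grp (by fun_prop) ((ContinuousLinearMap.continuous 𝐉).comp_continuousOn
      (F.continuousOn_nonlinearity S))).const_smul σ
  filter_upwards [hev, self_mem_nhdsWithin] with s hs hsT
  have hIcc : uIcc t s ⊆ Icc 0 t' := ordConnected_Icc.uIcc_subset htt' hs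
  refine S.eq_of_opK_mem ?_
  rw [map_sub, ← integral_eq_sub_of_hasDerivWithinAt_Ico hcont
    (fun t ht => F.hasDerivWithinAt_profile S hσ ht) ht hsT]
  refine S.integral_mem_ballK hC0 (hcont.mono (hIcc.trans hsub)) fun τ hτ => ?_
  refine ⟨σ • grp l (-(σ * τ)) (forcing b p (𝐊 (e τ))), ?_, ?_⟩
  · rw [S.opJ_nonlinearity, map_smul, S.grp_op_comm S.bSym_k]
  · rw [norm_smul, Real.norm_eq_abs, hσ1, one_mul, S.norm_grp]
    exact hC τ (hIcc hτ)

/-- The group is unitary and commutes with f, so e + σa may be replaced by its profile, whose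
derivative contains no unbounded operator. -/
lemma Flow.hasDerivWithinAt_quadratic (S : Setup l b ρ r c₁ c₂ c₃ c₄ p) {T : ℝ} {e a : ℝ → L2}
    (F : Flow l b ρ p T e a) {f : ℝ → ℝ} (hf : BSym (fun ξ => (f ξ : ℂ))) {σ : ℝ}
    (hσ : σ * σ = 1) {t : ℝ} (ht : t ∈ Ico 0 T) :
    HasDerivWithinAt (fun s => ⟪e s + σ • a s, op (fun ξ => (f ξ : ℂ)) (e s + σ • a s)⟫)
      (2 * (σ * ⟪forcing b p (𝐊 (e t)), op (fun ξ => (f ξ : ℂ)) (e t + σ • a t)⟫))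
      (Ico 0 T) t := by
  obtain ⟨C, hC⟩ := F.profile_lipschitz S hσ ht
  have h := DoublyDispersive.hasDerivWithinAt_quadratic 𝐊 (op (fun ξ => (f ξ : ℂ))) S.inner_opK
    S.opK_denseRange hf.inner_real hC (F.hasDerivWithinAt_opK_profile S hσ ht)
  refine (h.congr_deriv ?_).congr_of_mem (fun s _ => ?_) ht
  · rw [profile, ← S.grp_op_comm hf, inner_smul_left, S.inner_grp_left, S.grp_neg_grp]
    rfl
  · rw [profile, ← S.grp_op_comm hf, S.inner_grp_left, S.grp_neg_grp]

/-- A quarter of the sum of the two forms at e ± a with f = 1. -/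
lemma Flow.hasDerivWithinAt_kinetic (S : Setup l b ρ r c₁ c₂ c₃ c₄ p) {T : ℝ} {e a : ℝ → L2}
    (F : Flow l b ρ p T e a) {t : ℝ} (ht : t ∈ Ico 0 T) :
    HasDerivWithinAt (fun s => 1 / 2 * ‖a s‖ ^ 2 + 1 / 2 * ‖e s‖ ^ 2)
      ⟪forcing b p (𝐊 (e t)), a t⟫ (Ico 0 T) t := by
  have hb : BSym (fun _ : ℝ => ((1 : ℝ) : ℂ)) :=
    bSym_real measurable_const (fun _ => rfl) (C := 1) (fun _ => by simp)
  have h1 : ∀ u : L2, op (fun _ : ℝ => ((1 : ℝ) : ℂ)) u = u := fun u =>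
    ((hb.isMul u).congr (fun _ => Complex.ofReal_one)).unique (IsMul.refl u)
  have hp := F.hasDerivWithinAt_quadratic S hb (σ := 1) (by norm_num) ht
  have hm := F.hasDerivWithinAt_quadratic S hb (σ := -1) (by norm_num) ht
  refine (((hp.add hm).const_mul (1 / 4)).congr_deriv ?_).congr_of_mem (fun s _ => ?_) ht
  · simp only [h1, inner_add_right, inner_smul_right]
    ring
  · simp only [h1, Pi.add_apply, inner_add_right, inner_add_left, inner_smul_right,
      inner_smul_left, ← real_inner_self_eq_norm_sq, conj_trivial, real_inner_comm (e s) (a s)]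
    ring

/-- Since 𝚲e = B^{-1/2}u and N = B^{1/2}∂ₓg(u), the powers of B cancel and this is ∫ u ∂ₓg(u) = 0.
-/
lemma Setup.inner_opLam_forcing (S : Setup l b ρ r c₁ c₂ c₃ c₄ p) (e : L2) :
    ⟪𝚲 e, forcing b p (𝐊 e)⟫ = 0 := by
  obtain ⟨C, -, hC⟩ := S.exists_sobolev
  refine inner_eq_zero_of_translation S.hp (hC e) ?_
  filter_upwards [S.bSym_lam.isMul e, S.forcing_isMul e, S.bSym_k.isMul e] with η h1 h2 h3
  rw [h1, h2, h3]
  simp only [RCLike.inner_apply, map_mul, Complex.conj_ofReal, symLam, symK, symD]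
  push_cast
  ring

/-- Polarization: the momentum is a quarter of the difference of the 𝚲-forms at e ± a, and its
derivative is the vanishing pairing of N with 𝚲e. -/
lemma Flow.hasDerivWithinAt_momentum (S : Setup l b ρ r c₁ c₂ c₃ c₄ p) {T : ℝ} {e a : ℝ → L2}
    (F : Flow l b ρ p T e a) {t : ℝ} (ht : t ∈ Ico 0 T) :
    HasDerivWithinAt (fun s => ⟪a s, 𝚲 (e s)⟫) 0 (Ico 0 T) t := by
  have hp := F.hasDerivWithinAt_quadratic S S.bSym_lam (σ := 1) (by norm_num) ht
  have hm := F.hasDerivWithinAt_quadratic S S.bSym_lam (σ := -1) (by norm_num) ht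
  refine (((hp.sub hm).const_mul (1 / 4)).congr_deriv ?_).congr_of_mem (fun s _ => ?_) ht
  · have h0 := S.inner_opLam_forcing (p := p) (e t)
    rw [real_inner_comm] at h0
    simp only [map_add, map_smul, inner_add_right, inner_smul_right, h0]
    ring
  · have hc : ⟪e s, 𝚲 (a s)⟫ = ⟪a s, 𝚲 (e s)⟫ := by
      rw [← S.bSym_lam.inner_real, real_inner_comm]
    simp only [map_add, map_smul, Pi.sub_apply, inner_add_right, inner_add_left, inner_smul_right,
      inner_smul_left, conj_trivial, hc]
    ring

lemma Flow.momentum_eq (S : Setup l b ρ r c₁ c₂ c₃ c₄ p) {T : ℝ} {e a : ℝ → L2}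
    (F : Flow l b ρ p T e a) {t : ℝ} (ht : t ∈ Ico 0 T) :
    ⟪a t, 𝚲 (e t)⟫ = ⟪a 0, 𝚲 (e 0)⟫ := by
  have h := integral_eq_sub_of_hasDerivWithinAt_Ico (z := fun _ => (0 : ℝ)) continuousOn_const
    (fun t ht => F.hasDerivWithinAt_momentum S ht) ⟨le_rfl, ht.1.trans_lt ht.2⟩ ht
  simp only [intervalIntegral.integral_zero] at h
  linarith

/-- The increment of `u` along the flow is the derivative of the integral of `B^{1/2} a`. -/
lemma Flow.increment_isMul (S : Setup l b ρ r c₁ c₂ c₃ c₄ p) {T : ℝ} {e a : ℝ → L2}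
    (F : Flow l b ρ p T e a) {s t : ℝ} (ht : t ∈ Ico 0 T) (hs : s ∈ Ico 0 T) :
    IsMul (fun ξ => Complex.I * (symD b ξ : ℂ)) (∫ τ in t..s, a τ) (𝐊 (e s) - 𝐊 (e t)) := by
  have h1 : 𝐒 (e s) - 𝐒 (e t) = 𝐖 (∫ τ in t..s, a τ) := by
    rw [← integral_eq_sub_of_hasDerivWithinAt_Ico
      ((ContinuousLinearMap.continuous 𝐖).comp_continuousOn F.cont_a) F.der_e ht hs]
    exact ContinuousLinearMap.intervalIntegral_comp_comm 𝐖
      (F.cont_a.mono (uIcc_subset_Ico ht hs)).intervalIntegrable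
  have h2 := (S.bSym_symS_om.isMul (∫ τ in t..s, a τ)).comp (S.bSym_k.isMul _)
  rw [← h1, ← map_sub, ← S.opS_opK] at h2
  rw [← map_sub]
  refine (h2.congr fun ξ => ?_).cancel (S.bSym_symS.isMul _) symS_ne_zero
  have h3 : (symK l b ξ * symOm l ξ : ℝ) = symD b ξ := by
    have := (S.sqrt_l_pos ξ).ne'
    rw [symK, symOm, symD]
    field_simp
  rw [← h3]
  push_cast
  ring

lemma Setup.inner_nonlinearity_of_isMul (S : Setup l b ρ r c₁ c₂ c₃ c₄ p) {A v : L2} (e : L2)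
    (h : IsMul (fun ξ => Complex.I * (symD b ξ : ℂ)) A v) :
    ⟪nonlinearity p (𝐊 e), v⟫ = -⟪forcing b p (𝐊 e), A⟫ := by
  rw [real_inner_comm, real_inner_comm A]
  exact h.inner_left_neg (S.forcing_isMul e) fun ξ => by simp

/-- Let A be the integral of a from t to s, so that u(s) - u(t) = iDA. Convexity at u(t) and at u(s)
squeezes the increment of 𝒬 between (p+1)⟨N(t), A⟩ and (p+1)⟨N(s), A⟩. Here A/(s - t) → a(t) in
norm, so weak convergence of N(s), which is bounded and continuous after K, is enough. -/
lemma Flow.hasDerivWithinAt_Q (S : Setup l b ρ r c₁ c₂ c₃ c₄ p) {T : ℝ} {e a : ℝ → L2}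
    (F : Flow l b ρ p T e a) {t : ℝ} (ht : t ∈ Ico 0 T) :
    HasDerivWithinAt (fun s => Q p (𝐊 (e s)))
      ((p + 1) * ⟪forcing b p (𝐊 (e t)), a t⟫) (Ico 0 T) t := by
  set N : ℝ → L2 := fun s => forcing b p (𝐊 (e s)) with hN
  set A : ℝ → L2 := fun s => ∫ τ in t..s, a τ with hA
  have hp1 : 0 < p + 1 := by linarith [S.hp]
  obtain ⟨C, -, hC⟩ := S.exists_sobolev
  have hlow : ∀ s ∈ Ico 0 T, (p + 1) * ⟪N t, A s⟫ ≤ Q p (𝐊 (e s)) - Q p (𝐊 (e t)) := by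
    intro s hs
    have h1 := Q_convex S.hp (AEBdd.mono (le_max_left _ (C * ‖e s‖)) (hC (e t)))
      (AEBdd.mono (le_max_right (C * ‖e t‖) _) (hC (e s)))
    rw [S.inner_nonlinearity_of_isMul (e t) (F.increment_isMul S ht hs)] at h1
    linarith
  have hup : ∀ s ∈ Ico 0 T, Q p (𝐊 (e s)) - Q p (𝐊 (e t)) ≤ (p + 1) * ⟪N s, A s⟫ := by
    intro s hs
    have h1 := Q_convex S.hp (AEBdd.mono (le_max_left _ (C * ‖e t‖)) (hC (e s)))
      (AEBdd.mono (le_max_right (C * ‖e s‖) _) (hC (e t)))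
    rw [S.inner_nonlinearity_of_isMul (e s) (F.increment_isMul S hs ht),
      intervalIntegral.integral_symm, inner_neg_right] at h1
    linarith
  have hAd : HasDerivWithinAt A (a t) (Ico 0 T) t := by
    have h1 := (hasDerivWithinAt_integral_Ico F.cont_a ht).sub_const (∫ τ in (0 : ℝ)..t, a τ)
    refine h1.congr_of_mem (fun s hs => ?_) ht
    have h0 : (0 : ℝ) ∈ Ico 0 T := ⟨le_rfl, ht.1.trans_lt ht.2⟩
    exact (intervalIntegral.integral_interval_sub_left
      ((F.cont_a.mono (uIcc_subset_Ico h0 hs)).intervalIntegrable)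
      ((F.cont_a.mono (uIcc_subset_Ico h0 ht)).intervalIntegrable)).symm
  rw [hasDerivWithinAt_iff_tendsto_slope] at hAd ⊢
  have hA0 : A t = 0 := by simp [hA]
  have hsl : slope A t = fun s => (s - t)⁻¹ • A s := by
    ext1 s; rw [slope_def_module, hA0, sub_zero]
  rw [hsl] at hAd
  obtain ⟨t', htt', hsub, hev⟩ := eventually_mem_Icc_nhdsWithin ht
  obtain ⟨D, hD0, hD⟩ := F.exists_forcing_bound S hsub
  have hle : 𝓝[Ico 0 T \ {t}] t ≤ 𝓝[Ico 0 T] t := nhdsWithin_mono _ sdiff_subset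
  have hNK : Tendsto (fun s => 𝐊 (N s)) (𝓝[Ico 0 T \ {t}] t) (𝓝 (𝐊 (N t))) := by
    simp only [hN, ← S.opJ_nonlinearity]
    exact (((ContinuousLinearMap.continuous 𝐉).comp_continuousOn
      (F.continuousOn_nonlinearity S)) t ht).mono_left hle
  have hw : Tendsto (fun s => ⟪N s, (s - t)⁻¹ • A s⟫) (𝓝[Ico 0 T \ {t}] t) (𝓝 ⟪N t, a t⟫) :=
    tendsto_inner_of_bounded 𝐊 S.inner_opK S.opK_denseRange
      (hle (hev.mono fun s hs => hD s hs)) hNK hAd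
  have hw' : Tendsto (fun s => ⟪N t, (s - t)⁻¹ • A s⟫) (𝓝[Ico 0 T \ {t}] t) (𝓝 ⟪N t, a t⟫) :=
    tendsto_const_nhds.inner hAd
  have hdiff : Tendsto (fun s => (p + 1) * |⟪N s, (s - t)⁻¹ • A s⟫ - ⟪N t, (s - t)⁻¹ • A s⟫|)
      (𝓝[Ico 0 T \ {t}] t) (𝓝 0) := by
    have := ((hw.sub hw').abs).const_mul (p + 1)
    simpa using this
  have h2 := hw'.const_mul (p + 1)
  refine h2.congr_dist (squeeze_zero' (.of_forall fun _ => dist_nonneg) ?_ hdiff)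
  filter_upwards [self_mem_nhdsWithin] with s hs
  have hst : s - t ≠ 0 := sub_ne_zero.mpr hs.2
  have e1 := hlow s hs.1
  have e2 := hup s hs.1
  rw [dist_comm, Real.dist_eq, slope_def_field, inner_smul_right, inner_smul_right,
    ← mul_sub, abs_mul, div_eq_inv_mul, ← mul_assoc, mul_comm (p + 1), mul_assoc, ← mul_sub, abs_mul,
    mul_left_comm (p + 1)]
  refine mul_le_mul_of_nonneg_left ?_ (abs_nonneg _)
  rw [← abs_of_pos hp1, ← abs_mul, abs_of_pos hp1, mul_sub]
  rw [abs_of_nonneg (by linarith), abs_of_nonneg (by linarith)]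
  linarith

/-- The work ⟨N, a⟩ of the forcing appears in both the kinetic part and 𝒬/(p+1), and cancels. -/
lemma Flow.energy_eq (S : Setup l b ρ r c₁ c₂ c₃ c₄ p) {T : ℝ} {e a : ℝ → L2}
    (F : Flow l b ρ p T e a) {t : ℝ} (ht : t ∈ Ico 0 T) :
    1 / 2 * ‖a t‖ ^ 2 + 1 / 2 * ‖e t‖ ^ 2 - 1 / (p + 1) * Q p (𝐊 (e t))
      = 1 / 2 * ‖a 0‖ ^ 2 + 1 / 2 * ‖e 0‖ ^ 2 - 1 / (p + 1) * Q p (𝐊 (e 0)) := by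
  have hp1 : p + 1 ≠ 0 := by linarith [S.hp]
  have hd : ∀ t ∈ Ico 0 T, HasDerivWithinAt (fun s => 1 / 2 * ‖a s‖ ^ 2 + 1 / 2 * ‖e s‖ ^ 2
      - 1 / (p + 1) * Q p (𝐊 (e s))) 0 (Ico 0 T) t := by
    intro t ht
    refine ((F.hasDerivWithinAt_kinetic S ht).sub
      ((F.hasDerivWithinAt_Q S ht).const_mul (1 / (p + 1)))).congr_deriv ?_
    field_simp
    ring
  have h := integral_eq_sub_of_hasDerivWithinAt_Ico (z := fun _ => (0 : ℝ)) continuousOn_const hd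
    ⟨le_rfl, ht.1.trans_lt ht.2⟩ ht
  simp only [intervalIntegral.integral_zero] at h
  linarith

end Conservation

/-! ### Sobolev spaces as images of multipliers -/

lemma integral_norm_sq_fourierL2 (u : L2) : ∫ η, ‖fourierL2 u η‖ ^ 2 = ‖u‖ ^ 2 := by
  rw [← norm_fourierL2 u, ← inner_self_eq_norm_sq (𝕜 := ℂ) (fourierL2 u), L2.inner_def,
    ← integral_re (L2.integrable_inner _ _)]
  exact integral_congr_ae (.of_forall fun η => (inner_self_eq_norm_sq (𝕜 := ℂ) _).symm)

lemma integrable_norm_sq_fourierL2 (u : L2) : Integrable (fun η => ‖fourierL2 u η‖ ^ 2) :=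
  (Lp.memLp (fourierL2 u)).integrable_norm_pow two_ne_zero

lemma hat_weight_eq (s : ℝ) (u : L2) (ξ : ℝ) : (1 + ξ ^ 2) ^ s * ‖hat u ξ‖ ^ 2
    = (fun η : ℝ => (1 + (2 * Real.pi * η) ^ 2) ^ s * ‖fourierL2 u η‖ ^ 2) (ξ / (2 * Real.pi)) := by
  have : 2 * Real.pi * (ξ / (2 * Real.pi)) = ξ := by field_simp
  simp only [this]
  rfl

lemma memH_iff (s : ℝ) (u : L2) : MemH s u ↔
    Integrable (fun η : ℝ => (1 + (2 * Real.pi * η) ^ 2) ^ s * ‖fourierL2 u η‖ ^ 2) := by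
  unfold MemH
  simp_rw [hat_weight_eq, div_eq_mul_inv]
  exact integrable_comp_mul_right_iff
    (fun η : ℝ => (1 + (2 * Real.pi * η) ^ 2) ^ s * ‖fourierL2 u η‖ ^ 2) (by positivity)

lemma normH_eq (s : ℝ) (u : L2) : normH s u =
    √(2 * Real.pi * ∫ η : ℝ, (1 + (2 * Real.pi * η) ^ 2) ^ s * ‖fourierL2 u η‖ ^ 2) := by
  unfold normH
  rw [integral_congr_ae (.of_forall (hat_weight_eq s u)), Measure.integral_comp_div
    (fun η : ℝ => (1 + (2 * Real.pi * η) ^ 2) ^ s * ‖fourierL2 u η‖ ^ 2), smul_eq_mul, abs_of_pos (by positivity)]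

section Sobolev

variable {f : ℝ → ℝ} {s c C : ℝ}

lemma weight_mul_sq_le (hpos : ∀ ξ, 0 < f ξ) (hup : ∀ ξ, f ξ ≤ C * (1 + ξ ^ 2) ^ (-s / 2)) (ξ : ℝ) :
    (1 + ξ ^ 2) ^ s * f ξ ^ 2 ≤ C ^ 2 := by
  have h0 : 0 < (1 + ξ ^ 2) ^ s := Real.rpow_pos_of_pos (bracket_pos ξ) _
  have h1 : f ξ ^ 2 ≤ (C * (1 + ξ ^ 2) ^ (-s / 2)) ^ 2 := pow_le_pow_left₀ (hpos ξ).le (hup ξ) 2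
  have h2 : ((1 + ξ ^ 2) ^ (-s / 2)) ^ 2 = ((1 + ξ ^ 2) ^ s)⁻¹ := by
    rw [← Real.rpow_natCast, ← Real.rpow_mul (bracket_pos ξ).le, ← Real.rpow_neg (bracket_pos ξ).le]
    congr 1
    push_cast
    ring
  rw [mul_pow, h2] at h1
  calc (1 + ξ ^ 2) ^ s * f ξ ^ 2 ≤ (1 + ξ ^ 2) ^ s * (C ^ 2 * ((1 + ξ ^ 2) ^ s)⁻¹) := by gcongr
    _ = C ^ 2 := by field_simp

lemma le_weight_mul_sq (hc : 0 ≤ c) (hlow : ∀ ξ, c * (1 + ξ ^ 2) ^ (-s / 2) ≤ f ξ) (ξ : ℝ) :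
    c ^ 2 ≤ (1 + ξ ^ 2) ^ s * f ξ ^ 2 := by
  have h0 : 0 < (1 + ξ ^ 2) ^ s := Real.rpow_pos_of_pos (bracket_pos ξ) _
  have h1 : (c * (1 + ξ ^ 2) ^ (-s / 2)) ^ 2 ≤ f ξ ^ 2 :=
    pow_le_pow_left₀ (mul_nonneg hc (Real.rpow_nonneg (bracket_pos ξ).le _)) (hlow ξ) 2
  have h2 : ((1 + ξ ^ 2) ^ (-s / 2)) ^ 2 = ((1 + ξ ^ 2) ^ s)⁻¹ := by
    rw [← Real.rpow_natCast, ← Real.rpow_mul (bracket_pos ξ).le, ← Real.rpow_neg (bracket_pos ξ).le]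
    congr 1
    push_cast
    ring
  rw [mul_pow, h2] at h1
  calc c ^ 2 = (1 + ξ ^ 2) ^ s * (c ^ 2 * ((1 + ξ ^ 2) ^ s)⁻¹) := by field_simp
    _ ≤ (1 + ξ ^ 2) ^ s * f ξ ^ 2 := by gcongr

lemma weight_op_ae (hf : BSym (fun ξ => (f ξ : ℂ))) (s : ℝ) (e : L2) :
    (fun η : ℝ => (1 + (2 * Real.pi * η) ^ 2) ^ s * ‖fourierL2 (op (fun ξ => (f ξ : ℂ)) e) η‖ ^ 2)
      =ᵐ[volume] fun η => (1 + (2 * Real.pi * η) ^ 2) ^ s * f (2 * Real.pi * η) ^ 2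
        * ‖fourierL2 e η‖ ^ 2 := by
  filter_upwards [hf.isMul e] with η h
  rw [h, norm_mul, Complex.norm_real, Real.norm_eq_abs, mul_pow |_|, sq_abs, ← mul_assoc]

lemma memH_op (hf : BSym (fun ξ => (f ξ : ℂ))) (hpos : ∀ ξ, 0 < f ξ)
    (hup : ∀ ξ, f ξ ≤ C * (1 + ξ ^ 2) ^ (-s / 2)) (e : L2) :
    MemH s (op (fun ξ => (f ξ : ℂ)) e) := by
  rw [memH_iff, integrable_congr (weight_op_ae hf s e)]
  have hfm : Measurable f := by
    have := Complex.measurable_re.comp hf.meas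
    simpa [Function.comp_def] using this
  refine ((integrable_norm_sq_fourierL2 e).const_mul (C ^ 2)).mono' ?_ ?_
  · have h1 : Measurable (fun η : ℝ => (1 + (2 * Real.pi * η) ^ 2) ^ s * f (2 * Real.pi * η) ^ 2) := by
      fun_prop
    exact h1.aestronglyMeasurable.mul (integrable_norm_sq_fourierL2 e).aestronglyMeasurable
  · filter_upwards with η
    have h0 := weight_mul_sq_le hpos hup (2 * Real.pi * η)
    have h1 : 0 ≤ (1 + (2 * Real.pi * η) ^ 2) ^ s * f (2 * Real.pi * η) ^ 2 :=
      mul_nonneg (Real.rpow_nonneg (bracket_pos _).le _) (sq_nonneg _)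
    rw [Real.norm_of_nonneg (by positivity)]
    gcongr

lemma exists_op_of_memH (hf : BSym (fun ξ => (f ξ : ℂ))) (hpos : ∀ ξ, 0 < f ξ) (hc : 0 < c)
    (hlow : ∀ ξ, c * (1 + ξ ^ 2) ^ (-s / 2) ≤ f ξ) {u : L2} (hu : MemH s u) :
    ∃ e, op (fun ξ => (f ξ : ℂ)) e = u := by
  have hfm : Measurable f := by
    have := Complex.measurable_re.comp hf.meas
    simpa [Function.comp_def] using this
  have heven : ∀ ξ, f (-ξ) = f ξ := fun ξ => by
    have := hf.herm ξ
    rw [Complex.conj_ofReal] at this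
    exact_mod_cast this
  rw [memH_iff] at hu
  have hM : MemLp (fun η : ℝ => (((f (2 * Real.pi * η))⁻¹ : ℝ) : ℂ) * fourierL2 u η) 2 volume := by
    have hmeas : AEStronglyMeasurable
        (fun η : ℝ => (((f (2 * Real.pi * η))⁻¹ : ℝ) : ℂ) * fourierL2 u η) volume := by
      have h1 : Measurable (fun η : ℝ => (((f (2 * Real.pi * η))⁻¹ : ℝ) : ℂ)) := by fun_prop
      exact h1.aestronglyMeasurable.mul (Lp.aestronglyMeasurable _)
    rw [memLp_two_iff_integrable_sq_norm hmeas]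
    refine (hu.const_mul (c ^ 2)⁻¹).mono' (hmeas.norm.pow 2) ?_
    filter_upwards with η
    rw [Real.norm_of_nonneg (by positivity), norm_mul, mul_pow, Complex.norm_real, Real.norm_eq_abs,
      sq_abs, ← mul_assoc]
    gcongr
    have h0 := le_weight_mul_sq hc.le hlow (2 * Real.pi * η)
    have h1 := hpos (2 * Real.pi * η)
    rw [inv_pow, inv_mul_eq_div, le_div_iff₀ (by positivity), inv_mul_le_iff₀ (by positivity), mul_comm]
    exact h0
  obtain ⟨e, he, -⟩ := exists_isMul (m := fun ξ => (((f ξ)⁻¹ : ℝ) : ℂ))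
    (Herm.ofReal fun ξ => by rw [heven]) hM
  refine ⟨e, (((he.comp (hf.isMul e)).congr fun ξ => ?_).unique (IsMul.refl u))⟩
  rw [← Complex.ofReal_mul, mul_inv_cancel₀ (hpos ξ).ne', Complex.ofReal_one]

lemma normH_op_le (hf : BSym (fun ξ => (f ξ : ℂ))) (hpos : ∀ ξ, 0 < f ξ) (hC : 0 ≤ C)
    (hup : ∀ ξ, f ξ ≤ C * (1 + ξ ^ 2) ^ (-s / 2)) (e : L2) :
    normH s (op (fun ξ => (f ξ : ℂ)) e) ≤ √(2 * Real.pi) * (C * ‖e‖) := by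
  have hint := (memH_iff _ _).mp (memH_op hf hpos hup e)
  rw [normH_eq, Real.sqrt_mul (show 0 ≤ 2 * Real.pi by positivity)]
  refine mul_le_mul_of_nonneg_left ?_ (by positivity)
  refine Real.sqrt_le_iff.mpr ⟨by positivity, ?_⟩
  rw [mul_pow, ← integral_norm_sq_fourierL2, ← integral_const_mul]
  refine integral_mono_ae hint ((integrable_norm_sq_fourierL2 e).const_mul _) ?_
  filter_upwards [weight_op_ae hf s e] with η h
  rw [h]
  gcongr
  exact weight_mul_sq_le hpos hup _

lemma le_normH_op (hf : BSym (fun ξ => (f ξ : ℂ))) (hpos : ∀ ξ, 0 < f ξ) (hc : 0 ≤ c)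
    (hlow : ∀ ξ, c * (1 + ξ ^ 2) ^ (-s / 2) ≤ f ξ)
    (hup : ∀ ξ, f ξ ≤ C * (1 + ξ ^ 2) ^ (-s / 2)) (e : L2) :
    √(2 * Real.pi) * (c * ‖e‖) ≤ normH s (op (fun ξ => (f ξ : ℂ)) e) := by
  have hint := (memH_iff _ _).mp (memH_op hf hpos hup e)
  rw [normH_eq, Real.sqrt_mul (show 0 ≤ 2 * Real.pi by positivity)]
  refine mul_le_mul_of_nonneg_left ?_ (by positivity)
  refine Real.le_sqrt_of_sq_le ?_
  rw [mul_pow, ← integral_norm_sq_fourierL2, ← integral_const_mul]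
  refine integral_mono_ae ((integrable_norm_sq_fourierL2 e).const_mul _) hint ?_
  filter_upwards [weight_op_ae hf s e] with η h
  rw [h]
  gcongr
  exact le_weight_mul_sq hc hlow _

/-- The two-sided symbol bounds make the Sobolev norm equivalent to the L² norm of the preimage, so
the solution class corresponds to continuous curves in L². -/
lemma continuousInH_op_iff (hf : BSym (fun ξ => (f ξ : ℂ))) (hpos : ∀ ξ, 0 < f ξ) (hc : 0 < c)
    (hC : 0 ≤ C) (hlow : ∀ ξ, c * (1 + ξ ^ 2) ^ (-s / 2) ≤ f ξ)
    (hup : ∀ ξ, f ξ ≤ C * (1 + ξ ^ 2) ^ (-s / 2)) {T : ℝ} {e : ℝ → L2} :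
    ContinuousInH s T (fun t => op (fun ξ => (f ξ : ℂ)) (e t)) ↔ ContinuousOn e (Ico 0 T) := by
  have hpi : 0 < √(2 * Real.pi) := by positivity
  have hkey : ∀ t, Tendsto (fun τ => normH s (op (fun ξ => (f ξ : ℂ)) (e τ)
      - op (fun ξ => (f ξ : ℂ)) (e t))) (𝓝[Ico 0 T] t) (𝓝 0) ↔ ContinuousWithinAt e (Ico 0 T) t := by
    intro t
    simp only [← map_sub]
    rw [ContinuousWithinAt, tendsto_iff_norm_sub_tendsto_zero (f := e)]
    constructor
    · intro h
      have h1 := h.const_mul (√(2 * Real.pi) * c)⁻¹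
      rw [mul_zero] at h1
      refine squeeze_zero (fun _ => norm_nonneg _) (fun τ => ?_) h1
      rw [← div_eq_inv_mul, le_div_iff₀ (by positivity)]
      have := le_normH_op hf hpos hc.le hlow hup (e τ - e t)
      linarith
    · intro h
      have h1 := h.const_mul (√(2 * Real.pi) * C)
      rw [mul_zero] at h1
      refine squeeze_zero (fun _ => Real.sqrt_nonneg _) (fun τ => ?_) h1
      have := normH_op_le hf hpos hC hup (e τ - e t)
      linarith
  constructor
  · intro h t ht
    exact (hkey t).mp (h.2 t ht)
  · intro h
    exact ⟨fun t _ => memH_op hf hpos hup (e t), fun t ht => (hkey t).mpr (h t ht)⟩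

end Sobolev

/-! ### The potential well -/

/-- Composition of a multiplier with the inverse of another one. -/
lemma IsMul.of_factor {m n q : ℝ → ℂ} {u v w : L2} (h : IsMul n w u) (h' : IsMul q w v)
    (hm : ∀ ξ, m ξ * n ξ = q ξ) : IsMul m u v := by
  filter_upwards [h, h'] with η h1 h2
  rw [h1, h2, ← mul_assoc, hm]

lemma integral_mul_eq_inner (u v : L2) : ∫ x, u x * v x = ⟪u, v⟫ := by
  rw [L2.inner_def]
  exact integral_congr_ae (.of_forall fun x => by simp [mul_comm])

lemma integral_sq_eq_norm_sq (u : L2) : ∫ x, u x ^ 2 = ‖u‖ ^ 2 := by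
  rw [← real_inner_self_eq_norm_sq, ← integral_mul_eq_inner]
  simp only [sq]

section Well

variable {l b : ℝ → ℝ} {ρ r c₁ c₂ c₃ c₄ p : ℝ}

local notation "𝐊" => op (fun ξ => (symK l b ξ : ℂ))
local notation "𝐁" => op (fun ξ => (√(b ξ) : ℂ))
local notation "𝚲" => op (fun ξ => (symLam l ξ : ℂ))

lemma Setup.invSqrtB_opB (S : Setup l b ρ r c₁ c₂ c₃ c₄ p) (a : L2) : invSqrtB b (𝐁 a) = a :=
  multiplier_eq ((S.bSym_sqrtB.isMul a).of_factor (IsMul.refl a) fun ξ => by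
    rw [← Complex.ofReal_mul, inv_mul_cancel₀ (S.sqrt_b_pos ξ).ne', Complex.ofReal_one])

lemma Setup.invSqrtB_opK (S : Setup l b ρ r c₁ c₂ c₃ c₄ p) (e : L2) :
    invSqrtB b (𝐊 e) = 𝚲 e :=
  multiplier_eq ((S.bSym_k.isMul e).of_factor (S.bSym_lam.isMul e) fun ξ => by
    have := (S.sqrt_b_pos ξ).ne'
    rw [← Complex.ofReal_mul, symK, symLam]
    congr 1
    field_simp)

lemma Setup.invSqrtBSqrtL_opK (S : Setup l b ρ r c₁ c₂ c₃ c₄ p) (e : L2) :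
    invSqrtBSqrtL l b (𝐊 e) = e :=
  multiplier_eq ((S.bSym_k.isMul e).of_factor (IsMul.refl e) fun ξ => by
    have := (S.sqrt_b_pos ξ).ne'
    have := (S.sqrt_l_pos ξ).ne'
    rw [← Complex.ofReal_mul, symK, ← Complex.ofReal_one]
    congr 1
    field_simp)

lemma Setup.energy_eq (S : Setup l b ρ r c₁ c₂ c₃ c₄ p) (e a : L2) :
    energy l b p (𝐊 e) (𝐁 a)
      = 1 / 2 * ‖a‖ ^ 2 + 1 / 2 * ‖e‖ ^ 2 - 1 / (p + 1) * Q p (𝐊 e) := by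
  rw [energy, S.invSqrtB_opB, S.invSqrtBSqrtL_opK, Q]

lemma Setup.momentum_eq (S : Setup l b ρ r c₁ c₂ c₃ c₄ p) (e a : L2) :
    momentum b (𝐊 e) (𝐁 a) = ⟪a, 𝚲 e⟫ := by
  rw [momentum, S.invSqrtB_opB, S.invSqrtB_opK, integral_mul_eq_inner]

lemma Setup.I_eq (S : Setup l b ρ r c₁ c₂ c₃ c₄ p) (γ : ℝ) (e : L2) :
    I l b γ (𝐊 e) = 1 / 2 * ‖e‖ ^ 2 - γ ^ 2 / 2 * ‖𝚲 e‖ ^ 2 := by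
  rw [I, S.invSqrtB_opK, S.invSqrtBSqrtL_opK, integral_sq_eq_norm_sq, integral_sq_eq_norm_sq]

/-- From L ≥ c₁² one has ‖𝚲e‖ ≤ ‖e‖/c₁, so the constant is (1 - γ²/c₁²)/2. -/
lemma Setup.le_I (S : Setup l b ρ r c₁ c₂ c₃ c₄ p) {γ : ℝ} (hγ : |γ| < c₁) :
    ∃ θ, 0 < θ ∧ ∀ e : L2, θ * ‖e‖ ^ 2 ≤ 1 / 2 * ‖e‖ ^ 2 - γ ^ 2 / 2 * ‖𝚲 e‖ ^ 2 := by
  have hc₁ := S.hc₁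
  have h1 : γ ^ 2 < c₁ ^ 2 := by
    rw [← sq_abs]
    exact pow_lt_pow_left₀ hγ (abs_nonneg _) two_ne_zero
  have h2 : γ ^ 2 / c₁ ^ 2 < 1 := (div_lt_one (by positivity)).mpr h1
  refine ⟨(1 - γ ^ 2 / c₁ ^ 2) / 2, by linarith, fun e => ?_⟩
  have h3 : ‖𝚲 e‖ ≤ c₁⁻¹ * ‖e‖ := (S.bSym_lam.isMul e).norm_le fun ξ => by
    rw [Complex.norm_real]
    exact S.abs_lam_le ξ
  have h4 : ‖𝚲 e‖ ^ 2 ≤ (c₁⁻¹ * ‖e‖) ^ 2 := pow_le_pow_left₀ (norm_nonneg _) h3 2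
  calc (1 - γ ^ 2 / c₁ ^ 2) / 2 * ‖e‖ ^ 2
      = 1 / 2 * ‖e‖ ^ 2 - γ ^ 2 / 2 * (c₁⁻¹ * ‖e‖) ^ 2 := by field_simp
    _ ≤ _ := by gcongr

lemma Setup.memH_opK (S : Setup l b ρ r c₁ c₂ c₃ c₄ p) (e : L2) :
    MemH (r / 2 + ρ / 2) (𝐊 e) :=
  memH_op S.bSym_k S.k_pos S.k_le e

lemma Setup.exists_opK (S : Setup l b ρ r c₁ c₂ c₃ c₄ p) {u : L2}
    (hu : MemH (r / 2 + ρ / 2) u) : ∃ e, 𝐊 e = u :=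
  exists_op_of_memH S.bSym_k S.k_pos (div_pos S.hc₃ S.hc₂) S.k_ge hu

lemma Setup.sqrt_b_le' (S : Setup l b ρ r c₁ c₂ c₃ c₄ p) (ξ : ℝ) :
    √(b ξ) ≤ c₄ * (1 + ξ ^ 2) ^ (-(r / 2) / 2) :=
  (S.sqrt_b_le ξ).trans_eq (by congr 2; ring)

lemma Setup.sqrt_b_ge' (S : Setup l b ρ r c₁ c₂ c₃ c₄ p) (ξ : ℝ) :
    c₃ * (1 + ξ ^ 2) ^ (-(r / 2) / 2) ≤ √(b ξ) :=
  (S.sqrt_b_ge ξ).trans_eq' (by congr 2; ring)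

lemma Setup.memH_opB (S : Setup l b ρ r c₁ c₂ c₃ c₄ p) (a : L2) : MemH (r / 2) (𝐁 a) :=
  memH_op S.bSym_sqrtB S.sqrt_b_pos S.sqrt_b_le' a

lemma Setup.exists_opB (S : Setup l b ρ r c₁ c₂ c₃ c₄ p) {w : L2} (hw : MemH (r / 2) w) :
    ∃ a, 𝐁 a = w :=
  exists_op_of_memH S.bSym_sqrtB S.sqrt_b_pos S.hc₃ S.sqrt_b_ge' hw

/-- Completing the square in a: for fixed e the functional is smallest at a = -γ𝚲e, where only ℐ -
𝒬/(p+1) remains. -/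
lemma energy_add_momentum (p γ q : ℝ) (e a : L2) :
    1 / 2 * ‖a‖ ^ 2 + 1 / 2 * ‖e‖ ^ 2 - 1 / (p + 1) * q + γ * ⟪a, 𝚲 e⟫
      = 1 / 2 * ‖a + γ • 𝚲 e‖ ^ 2 + (1 / 2 * ‖e‖ ^ 2 - γ ^ 2 / 2 * ‖𝚲 e‖ ^ 2)
        - 1 / (p + 1) * q := by
  rw [norm_add_sq_real, inner_smul_right, norm_smul, mul_pow, Real.norm_eq_abs, sq_abs]
  ring

lemma Setup.criticalEnergy_le (S : Setup l b ρ r c₁ c₂ c₃ c₄ p) {γ : ℝ} (hγ : |γ| < c₁) {e : L2}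
    (he : e ≠ 0) (hI : 2 * (1 / 2 * ‖e‖ ^ 2 - γ ^ 2 / 2 * ‖𝚲 e‖ ^ 2) = Q p (𝐊 e)) (a : L2) :
    criticalEnergy l b p (r / 2 + ρ / 2) (r / 2) γ
      ≤ 1 / 2 * ‖a‖ ^ 2 + 1 / 2 * ‖e‖ ^ 2 - 1 / (p + 1) * Q p (𝐊 e) + γ * ⟪a, 𝚲 e⟫ := by
  have hp := S.hp
  refine csInf_le ⟨0, ?_⟩ ⟨𝐊 e, 𝐁 a, S.memH_opK e, S.memH_opB a, ?_, ?_, ?_⟩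
  -- The set must be bounded below for its infimum to be meaningful: on the constraint 𝒬/(p+1) =
  -- 2ℐ/(p+1) ≤ ℐ, so the functional is nonnegative.
  · rintro _ ⟨u, w, hu, hw, -, hQ, rfl⟩
    obtain ⟨e', rfl⟩ := S.exists_opK hu
    obtain ⟨a', rfl⟩ := S.exists_opB hw
    rw [S.I_eq] at hQ
    rw [S.energy_eq, S.momentum_eq, energy_add_momentum]
    obtain ⟨θ, hθ, H⟩ := S.le_I hγ
    have h1 := H e'
    set J := 1 / 2 * ‖e'‖ ^ 2 - γ ^ 2 / 2 * ‖𝚲 e'‖ ^ 2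
    have h2 : 0 ≤ J := le_trans (by positivity) h1
    have h3 : 1 / (p + 1) * Q p (𝐊 e') ≤ J := by
      rw [← sub_eq_zero.mp hQ, one_div, inv_mul_le_iff₀ (by linarith)]
      nlinarith
    have h4 : 0 ≤ 1 / 2 * ‖a' + γ • 𝚲 e'‖ ^ 2 := by positivity
    linarith
  · intro h
    exact he (S.opK_injective (by rw [h, map_zero]))
  · rw [S.I_eq, hI, sub_self]
  · rw [S.energy_eq, S.momentum_eq]

/-- Scaling by c with c^{p-1} = 2ℐ/𝒬 ≤ 1 lands on the constraint, and the choice a = -γ𝚲(ce) kills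
the square. The remaining value is c² (p-1)/(p+1) ℐ. -/
lemma Setup.criticalEnergy_le_of_le (S : Setup l b ρ r c₁ c₂ c₃ c₄ p) {γ : ℝ} (hγ : |γ| < c₁)
    {e : L2} (he : e ≠ 0) (hI : 2 * (1 / 2 * ‖e‖ ^ 2 - γ ^ 2 / 2 * ‖𝚲 e‖ ^ 2) ≤ Q p (𝐊 e)) :
    criticalEnergy l b p (r / 2 + ρ / 2) (r / 2) γ
      ≤ (p - 1) / (p + 1) * (1 / 2 * ‖e‖ ^ 2 - γ ^ 2 / 2 * ‖𝚲 e‖ ^ 2) := by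
  have hp := S.hp
  obtain ⟨θ, hθ, H⟩ := S.le_I hγ
  have h1 := H e
  have hen : 0 < ‖e‖ := norm_pos_iff.mpr he
  have hJ : 0 < 1 / 2 * ‖e‖ ^ 2 - γ ^ 2 / 2 * ‖𝚲 e‖ ^ 2 := lt_of_lt_of_le (by positivity) h1
  set J := 1 / 2 * ‖e‖ ^ 2 - γ ^ 2 / 2 * ‖𝚲 e‖ ^ 2 with hJdef
  set q := Q p (𝐊 e) with hq
  have hq0 : 0 < q := by linarith
  set c : ℝ := (2 * J / q) ^ (1 / (p - 1)) with hc
  have hbase : 0 < 2 * J / q := by positivity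
  have hc0 : 0 < c := Real.rpow_pos_of_pos hbase _
  have hc1 : c ≤ 1 := Real.rpow_le_one hbase.le ((div_le_one hq0).mpr hI)
    (by rw [one_div, inv_nonneg]; linarith)
  have hcp : c ^ (p + 1) * q = c ^ 2 * (2 * J) := by
    have h2 : c ^ (p + 1) = c ^ 2 * c ^ (p - 1) := by
      rw [← Real.rpow_natCast c 2, ← Real.rpow_add hc0]
      congr 1
      push_cast
      ring
    have h3 : c ^ (p - 1) = 2 * J / q := by
      rw [hc, ← Real.rpow_mul hbase.le, one_div, inv_mul_cancel₀ (by linarith), Real.rpow_one]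
    rw [h2, h3]
    field_simp
  have hQ : Q p (𝐊 (c • e)) = c ^ 2 * (2 * J) := by
    rw [map_smul, Q_smul p hc0.le, ← hq, hcp]
  have hJc : 1 / 2 * ‖c • e‖ ^ 2 - γ ^ 2 / 2 * ‖𝚲 (c • e)‖ ^ 2 = c ^ 2 * J := by
    rw [map_smul, norm_smul, norm_smul, mul_pow, mul_pow, Real.norm_eq_abs, sq_abs, hJdef]
    ring
  have key := S.criticalEnergy_le hγ (e := c • e) (smul_ne_zero hc0.ne' he)
    (by rw [hJc, hQ]; ring) (-(γ • 𝚲 (c • e)))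
  rw [energy_add_momentum, hJc, hQ, neg_add_cancel, norm_zero] at key
  refine key.trans ?_
  have hc2 : c ^ 2 ≤ 1 := pow_le_one₀ hc0.le hc1
  have hpp : 0 < p + 1 := by linarith
  calc 1 / 2 * 0 ^ 2 + c ^ 2 * J - 1 / (p + 1) * (c ^ 2 * (2 * J))
      = c ^ 2 * ((p - 1) / (p + 1) * J) := by field_simp; ring
    _ ≤ 1 * ((p - 1) / (p + 1) * J) := by
      refine mul_le_mul_of_nonneg_right hc2 (mul_nonneg (div_nonneg ?_ hpp.le) hJ.le)
      linarith
    _ = _ := one_mul _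

/-- Below the well, a lower bound of the norm. -/
lemma Setup.exists_norm_ge (S : Setup l b ρ r c₁ c₂ c₃ c₄ p) {γ : ℝ} (hγ : |γ| < c₁) :
    ∃ δ, 0 < δ ∧ ∀ e : L2, 2 * (1 / 2 * ‖e‖ ^ 2 - γ ^ 2 / 2 * ‖𝚲 e‖ ^ 2) < Q p (𝐊 e) →
      δ ≤ ‖e‖ := by
  have hp := S.hp
  obtain ⟨θ, hθ, H⟩ := S.le_I hγ
  obtain ⟨C, hC0, hC⟩ := S.exists_sobolev
  set D : ℝ := C ^ (p - 1) * (c₄ / c₁) ^ 2 with hD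
  have hD0 : 0 ≤ D := by positivity
  -- Below this size 𝒬 ≤ D‖e‖^{p+1} ≤ θ‖e‖² ≤ ℐ, against 2ℐ < 𝒬. Using D + 1 avoids a zero
  -- denominator.
  refine ⟨(θ / (D + 1)) ^ (1 / (p - 1)), by positivity, fun e he => ?_⟩
  by_contra! hlt
  have h1 := H e
  have hQ := Q_le S.hp (hC e)
  have hk : ‖𝐊 e‖ ≤ c₄ / c₁ * ‖e‖ := (S.bSym_k.isMul e).norm_le fun ξ => by
    rw [Complex.norm_real]
    exact S.abs_k_le ξ
  have hk2 : ‖𝐊 e‖ ^ 2 ≤ (c₄ / c₁ * ‖e‖) ^ 2 := pow_le_pow_left₀ (norm_nonneg _) hk 2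
  have hpow : ‖e‖ ^ (p - 1) ≤ θ / (D + 1) := by
    have h2 := Real.rpow_le_rpow (norm_nonneg e) hlt.le (z := p - 1) (by linarith)
    rwa [← Real.rpow_mul (by positivity), one_div, inv_mul_cancel₀ (by linarith), Real.rpow_one]
      at h2
  have h3 : Q p (𝐊 e) ≤ θ * ‖e‖ ^ 2 := by
    calc Q p (𝐊 e) ≤ (C * ‖e‖) ^ (p - 1) * (c₄ / c₁ * ‖e‖) ^ 2 := hQ.trans (by gcongr)
      _ = D * ‖e‖ ^ (p - 1) * ‖e‖ ^ 2 := by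
        rw [Real.mul_rpow hC0 (norm_nonneg _), hD]
        ring
      _ ≤ θ * ‖e‖ ^ 2 := by
        gcongr
        calc D * ‖e‖ ^ (p - 1) ≤ D * (θ / (D + 1)) := by gcongr
          _ = θ * (D / (D + 1)) := by ring
          _ ≤ θ * 1 := by
            gcongr
            exact (div_le_one (by positivity)).mpr (by linarith)
          _ = θ := mul_one _
  nlinarith [sq_nonneg ‖e‖]

/-- The unstable set is invariant under the flow. -/
lemma Flow.nehari_lt (S : Setup l b ρ r c₁ c₂ c₃ c₄ p) {γ : ℝ} (hγ : |γ| < c₁) {T : ℝ}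
    {e a : ℝ → L2} (F : Flow l b ρ p T e a)
    (hd : 1 / 2 * ‖a 0‖ ^ 2 + 1 / 2 * ‖e 0‖ ^ 2 - 1 / (p + 1) * Q p (𝐊 (e 0)) + γ * ⟪a 0, 𝚲 (e 0)⟫
      < criticalEnergy l b p (r / 2 + ρ / 2) (r / 2) γ)
    (h0 : 2 * (1 / 2 * ‖e 0‖ ^ 2 - γ ^ 2 / 2 * ‖𝚲 (e 0)‖ ^ 2) < Q p (𝐊 (e 0)))
    {t : ℝ} (ht : t ∈ Ico 0 T) :
    2 * (1 / 2 * ‖e t‖ ^ 2 - γ ^ 2 / 2 * ‖𝚲 (e t)‖ ^ 2) < Q p (𝐊 (e t)) := by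
  set h : ℝ → ℝ := fun s =>
    2 * (1 / 2 * ‖e s‖ ^ 2 - γ ^ 2 / 2 * ‖𝚲 (e s)‖ ^ 2) - Q p (𝐊 (e s)) with hh
  obtain ⟨δ, hδ, hδe⟩ := S.exists_norm_ge (p := p) hγ
  have hsub : Icc 0 t ⊆ Ico 0 T := fun s hs => ⟨hs.1, hs.2.trans_lt ht.2⟩
  have hcont : ContinuousOn h (Icc 0 t) := by
    have he := F.cont_e.mono hsub
    have hΛ : ContinuousOn (fun s => 𝚲 (e s)) (Icc 0 t) :=
      (ContinuousLinearMap.continuous 𝚲).comp_continuousOn he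
    have hQ : ContinuousOn (fun s => Q p (𝐊 (e s))) (Icc 0 t) := fun s hs =>
      (F.hasDerivWithinAt_Q S (hsub hs)).continuousWithinAt.mono hsub
    exact ((((he.norm.pow 2).const_mul _).sub ((hΛ.norm.pow 2).const_mul _)).const_mul 2).sub hQ
  have hne : ∀ s ∈ Icc 0 t, e s ≠ 0 → h s ≠ 0 := by
    intro s hs hes h0
    have h1 := S.criticalEnergy_le hγ hes (sub_eq_zero.mp h0) (a s)
    rw [F.energy_eq S (hsub hs), F.momentum_eq S (hsub hs)] at h1
    linarith
  -- A zero of h with e ≠ 0 would lie on the constraint, where the conserved energy plus momentum is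
  -- at least d. So the open condition h < 0 is also closed, and it spreads over the connected
  -- interval.
  have hiff : ∀ s ∈ Icc 0 t, h s < 0 ↔ h s ≤ 0 ∧ δ ≤ ‖e s‖ := by
    intro s hs
    refine ⟨fun h1 => ⟨h1.le, hδe _ (sub_neg.mp h1)⟩, fun h1 => lt_of_le_of_ne h1.1 ?_⟩
    exact hne s hs (norm_pos_iff.mp (hδ.trans_le h1.2))
  have : PreconnectedSpace (Icc 0 t) := Subtype.preconnectedSpace isPreconnected_Icc
  have hc' : Continuous (fun s : Icc 0 t => h s) := hcont.domRestrict
  have hce : Continuous (fun s : Icc 0 t => ‖e s‖) := (F.cont_e.mono hsub).domRestrict.norm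
  have hclopen : IsClopen {s : Icc 0 t | h s < 0} := by
    refine ⟨?_, isOpen_lt hc' continuous_const⟩
    have : {s : Icc 0 t | h s < 0} = {s : Icc 0 t | h s ≤ 0} ∩ {s : Icc 0 t | δ ≤ ‖e s‖} := by
      ext s
      exact hiff s s.2
    rw [this]
    exact (isClosed_le hc' continuous_const).inter (isClosed_le continuous_const hce)
  have huniv := hclopen.eq_univ ⟨⟨0, le_rfl, ht.1⟩, sub_neg.mpr h0⟩
  have : (⟨t, ht.1, le_rfl⟩ : Icc 0 t) ∈ {s : Icc 0 t | h s < 0} := huniv ▸ mem_univ _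
  exact sub_neg.mp this

/-- A lower bound of the second derivative of the virial. -/
lemma Setup.virial_lower_bound (S : Setup l b ρ r c₁ c₂ c₃ c₄ p) {γ : ℝ} (hγ : |γ| < c₁)
    {e a : ℝ → L2}
    (hd : 1 / 2 * ‖a 0‖ ^ 2 + 1 / 2 * ‖e 0‖ ^ 2 - 1 / (p + 1) * Q p (𝐊 (e 0)) + γ * ⟪a 0, 𝚲 (e 0)⟫
      < criticalEnergy l b p (r / 2 + ρ / 2) (r / 2) γ)
    (h0 : 2 * (1 / 2 * ‖e 0‖ ^ 2 - γ ^ 2 / 2 * ‖𝚲 (e 0)‖ ^ 2) < Q p (𝐊 (e 0)))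
    (hM : 0 ≤ γ * ⟪a 0, 𝚲 (e 0)⟫) :
    ∃ δ, 0 < δ ∧ ∀ T' (_ : Flow l b ρ p T' e a), ∀ t ∈ Ico 0 T',
      (p + 3) / 2 * ‖a t‖ ^ 2 + δ ≤ ‖a t‖ ^ 2 - ‖e t‖ ^ 2 + Q p (𝐊 (e t)) := by
  have hp := S.hp
  set E₀ := 1 / 2 * ‖a 0‖ ^ 2 + 1 / 2 * ‖e 0‖ ^ 2 - 1 / (p + 1) * Q p (𝐊 (e 0)) with hE₀
  set d := criticalEnergy l b p (r / 2 + ρ / 2) (r / 2) γ with hdd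
  -- Positive because E₀ + γℳ < d and γℳ ≥ 0. By energy conservation the right side is (p+3)/2 ‖a‖²
  -- + (p-1)/2 ‖e‖² - (p+1)E₀, and the well estimate bounds the middle term below by (p+1)d.
  refine ⟨(p + 1) * (d - E₀), mul_pos (by linarith) (by linarith), fun T' F' t ht => ?_⟩
  have h1 := F'.nehari_lt S hγ hd h0 ht
  have hE := F'.energy_eq S ht
  rw [← hE₀] at hE
  obtain ⟨δ, hδ, hδe⟩ := S.exists_norm_ge (p := p) hγ
  have hne : e t ≠ 0 := norm_pos_iff.mp (hδ.trans_le (hδe _ h1))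
  have h2 := S.criticalEnergy_le_of_le hγ hne h1.le
  rw [← hdd] at h2
  have h3 : (p + 1) * d ≤ (p - 1) / 2 * ‖e t‖ ^ 2 := by
    have h4 : d ≤ (p - 1) / (p + 1) * (1 / 2 * ‖e t‖ ^ 2) := by
      refine h2.trans (mul_le_mul_of_nonneg_left ?_ (div_nonneg (by linarith) (by linarith)))
      have : 0 ≤ γ ^ 2 / 2 * ‖𝚲 (e t)‖ ^ 2 := by positivity
      linarith
    calc (p + 1) * d ≤ (p + 1) * ((p - 1) / (p + 1) * (1 / 2 * ‖e t‖ ^ 2)) :=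
          mul_le_mul_of_nonneg_left h4 (by linarith)
      _ = _ := by field_simp
  have h5 : Q p (𝐊 (e t)) = (p + 1) * (1 / 2 * ‖a t‖ ^ 2 + 1 / 2 * ‖e t‖ ^ 2 - E₀) := by
    rw [← hE]
    field_simp
    ring
  rw [h5]
  nlinarith

end Well

/-! ### The virial identity and the failure of global existence -/

/-- Because A vanishes at t, the product rule holds with a merely continuous. -/
lemma hasDerivWithinAt_inner_of_eq_zero {A a : ℝ → L2} {A' : L2} {s : Set ℝ} {t : ℝ}
    (hA : HasDerivWithinAt A A' s t) (h0 : A t = 0) (ha : ContinuousWithinAt a s t) :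
    HasDerivWithinAt (fun τ => ⟪A τ, a τ⟫) ⟪A', a t⟫ s t := by
  rw [hasDerivWithinAt_iff_tendsto_slope] at hA ⊢
  refine (hA.inner (ha.mono_left (nhdsWithin_mono _ sdiff_subset))).congr fun τ => ?_
  rw [slope_def_module, slope_def_module, h0, inner_zero_left, sub_zero, sub_zero, inner_smul_left]
  rfl

/-- The concavity argument. -/
lemma false_of_virial {H G G' x : ℝ → ℝ} {p δ : ℝ} (hp : 1 < p) (hδ : 0 < δ)
    (hH : ∀ t, 0 ≤ t → HasDerivWithinAt H (G t) (Ici 0) t)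
    (hG : ∀ t, 0 ≤ t → HasDerivWithinAt G (G' t) (Ici 0) t)
    (hG' : ∀ t, 0 ≤ t → (p + 3) / 2 * x t + δ ≤ G' t)
    (hCS : ∀ t, 0 ≤ t → G t ^ 2 ≤ 2 * H t * x t) (hx : ∀ t, 0 ≤ x t) (hH0 : ∀ t, 0 ≤ H t) :
    False := by
  -- As x ≥ 0, G' ≥ δ; so G grows linearly and stays above 1 from t₁ on.
  have hGm : MonotoneOn (fun t => G t - δ * t) (Ici 0) := by
    refine monotoneOn_of_hasDerivWithinAt_nonneg (f' := fun t => G' t - δ) (convex_Ici 0)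
      (fun t ht => ((hG t ht).continuousWithinAt).sub (by fun_prop)) (fun t ht => ?_) fun t ht => ?_
    · have h1 := (hG t (interior_subset ht)).sub
        (((hasDerivAt_id t).const_mul δ).hasDerivWithinAt (s := Ici 0))
      rw [mul_one] at h1
      exact h1.mono interior_subset
    · have h1 := hG' t (interior_subset ht)
      have h2 := mul_nonneg (show 0 ≤ (p + 3) / 2 by linarith) (hx t)
      linarith
  set t₁ : ℝ := |1 - G 0| / δ with ht₁
  have ht₁0 : 0 ≤ t₁ := by positivity
  have hG1 : ∀ t, t₁ ≤ t → 1 ≤ G t := by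
    intro t ht
    have h1 := hGm (mem_Ici.mpr le_rfl) (mem_Ici.mpr (ht₁0.trans ht)) (ht₁0.trans ht)
    simp only [mul_zero, sub_zero] at h1
    have h2 : |1 - G 0| ≤ δ * t := by
      rw [ht₁, div_le_iff₀ hδ] at ht
      linarith
    have h3 := le_abs_self (1 - G 0)
    linarith
  -- (H/G)' = 1 - HG'/G², and HG' ≥ (p+3)/2 Hx ≥ (p+3)/4 G², so H/G has slope at most -(p-1)/4.
  have hφ : AntitoneOn (fun t => H t / G t + (p - 1) / 4 * t) (Ici t₁) := by
    refine antitoneOn_of_hasDerivWithinAt_nonpos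
      (f' := fun t => (G t * G t - H t * G' t) / G t ^ 2 + (p - 1) / 4) (convex_Ici t₁)
      (fun t ht => ?_) (fun t ht => ?_) fun t ht => ?_
    · have h0 : 0 ≤ t := ht₁0.trans ht
      have h1 : G t ≠ 0 := by linarith [hG1 t ht]
      have hsub : Ici t₁ ⊆ Ici (0 : ℝ) := Ici_subset_Ici.mpr ht₁0
      exact (((hH t h0).continuousWithinAt.mono hsub).div
        ((hG t h0).continuousWithinAt.mono hsub) h1).add (by fun_prop)
    · have ht' := interior_subset ht
      have h0 : 0 ≤ t := ht₁0.trans ht'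
      have h1 : G t ≠ 0 := by linarith [hG1 t ht']
      have h2 := ((hH t h0).div (hG t h0) h1).add
        (((hasDerivAt_id t).const_mul ((p - 1) / 4)).hasDerivWithinAt (s := Ici 0))
      rw [mul_one] at h2
      exact h2.mono (interior_subset.trans (Ici_subset_Ici.mpr ht₁0))
    · have ht' := interior_subset ht
      have h0 : 0 ≤ t := ht₁0.trans ht'
      have h1 : 0 < G t := by linarith [hG1 t ht']
      have h2 := hG' t h0
      have h3 := hCS t h0
      have h4 : (p + 3) / 4 * G t ^ 2 ≤ H t * G' t := by
        have h5 : H t * ((p + 3) / 2 * x t) ≤ H t * G' t :=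
          mul_le_mul_of_nonneg_left (by linarith) (hH0 t)
        nlinarith
      have h6 : (G t * G t - H t * G' t) / G t ^ 2 ≤ -((p - 1) / 4) := by
        rw [div_le_iff₀ (by positivity)]
        nlinarith
      linarith
  -- At this time the linear bound would force H/G ≤ -1, while H ≥ 0 and G ≥ 1.
  set t₂ : ℝ := t₁ + (H t₁ / G t₁ + 1) / ((p - 1) / 4) with ht₂
  have hp4 : 0 < (p - 1) / 4 := by linarith
  have hpos : 0 ≤ H t₁ / G t₁ := div_nonneg (hH0 _) (by linarith [hG1 t₁ le_rfl])
  have ht12 : t₁ ≤ t₂ := by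
    have : 0 ≤ (H t₁ / G t₁ + 1) / ((p - 1) / 4) := by positivity
    linarith
  have h1 := hφ (mem_Ici.mpr le_rfl) (mem_Ici.mpr ht12) ht12
  have h2 : 0 ≤ H t₂ / G t₂ := div_nonneg (hH0 _) (by linarith [hG1 t₂ ht12])
  have h3 : (p - 1) / 4 * t₂ = (p - 1) / 4 * t₁ + (H t₁ / G t₁ + 1) := by
    have : p - 1 ≠ 0 := by linarith
    rw [ht₂]
    field_simp
  simp only at h1
  linarith

section Virial

variable {l b : ℝ → ℝ} {ρ r c₁ c₂ c₃ c₄ p : ℝ}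

local notation "𝐊" => op (fun ξ => (symK l b ξ : ℂ))
local notation "𝐒" => op (fun ξ => (symS ρ ξ : ℂ))
local notation "𝐖" => op (fun ξ => Complex.I * ((symS ρ ξ * symOm l ξ : ℝ) : ℂ))
local notation "𝐗" => op (fun ξ => Complex.I * ((symS ρ ξ * symD b ξ : ℝ) : ℂ))
local notation "𝚲" => op (fun ξ => (symLam l ξ : ℂ))

lemma Flow.increment_e_isMul (S : Setup l b ρ r c₁ c₂ c₃ c₄ p) {T : ℝ} {e a : ℝ → L2}
    (F : Flow l b ρ p T e a) {s t : ℝ} (ht : t ∈ Ico 0 T) (hs : s ∈ Ico 0 T) :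
    IsMul (fun ξ => Complex.I * (symOm l ξ : ℂ)) (∫ τ in t..s, a τ) (e s - e t) := by
  have h1 : 𝐒 (e s) - 𝐒 (e t) = 𝐖 (∫ τ in t..s, a τ) := by
    rw [← integral_eq_sub_of_hasDerivWithinAt_Ico
      ((ContinuousLinearMap.continuous 𝐖).comp_continuousOn F.cont_a) F.der_e ht hs]
    exact ContinuousLinearMap.intervalIntegral_comp_comm 𝐖
      (F.cont_a.mono (uIcc_subset_Ico ht hs)).intervalIntegrable
  have h2 := S.bSym_symS_om.isMul (∫ τ in t..s, a τ)
  rw [← h1, ← map_sub] at h2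
  refine (h2.congr fun ξ => ?_).cancel (S.bSym_symS.isMul _) symS_ne_zero
  push_cast
  ring

lemma Setup.isMul_opK_of_isMul (S : Setup l b ρ r c₁ c₂ c₃ c₄ p) {η e : L2}
    (h : IsMul (fun ξ => Complex.I * (symOm l ξ : ℂ)) η e) :
    IsMul (fun ξ => Complex.I * (symD b ξ : ℂ)) η (𝐊 e) := by
  refine (h.comp (S.bSym_k.isMul e)).congr fun ξ => ?_
  have h3 : (symK l b ξ * symOm l ξ : ℝ) = symD b ξ := by
    have := (S.sqrt_l_pos ξ).ne'
    rw [symK, symOm, symD]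
    field_simp
  rw [← h3]
  push_cast
  ring

/-- Integration by parts for z = iΩy + iDg, with e = iΩη and u = iDη. The two terms of z need not be
in L² separately, so the smoothing factor is cancelled pointwise under the Plancherel integral. -/
lemma Setup.inner_of_smoothed (S : Setup l b ρ r c₁ c₂ c₃ c₄ p) {η e u z y g : L2}
    (he : IsMul (fun ξ => Complex.I * (symOm l ξ : ℂ)) η e)
    (hu : IsMul (fun ξ => Complex.I * (symD b ξ : ℂ)) η u) (hz : 𝐒 z = 𝐖 y + 𝐗 g) :
    ⟪η, z⟫ = -⟪e, y⟫ - ⟪u, g⟫ := by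
  rw [inner_eq_re_integral, inner_eq_re_integral, inner_eq_re_integral, ← Complex.neg_re,
    ← Complex.sub_re, ← integral_neg, ← integral_sub
      (f := fun ξ => -inner ℂ (fourierL2 e ξ) (fourierL2 y ξ)) (integrable_inner_fourierL2 e y).neg
      (integrable_inner_fourierL2 u g)]
  congr 1
  refine integral_congr_ae ?_
  have h1 := S.bSym_symS.isMul z
  rw [hz] at h1
  filter_upwards [he, hu, h1, S.bSym_symS_om.isMul y, S.bSym_symS_d.isMul g,
    fourierL2_add_ae (𝐖 y) (𝐗 g)] with ξ e1 e2 e3 e4 e5 e6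
  rw [e6, e4, e5] at e3
  have h2 : fourierL2 z ξ = Complex.I * symOm l (2 * Real.pi * ξ) * fourierL2 y ξ
      + Complex.I * symD b (2 * Real.pi * ξ) * fourierL2 g ξ := by
    refine mul_left_cancel₀ (symS_ne_zero (ρ := ρ) (2 * Real.pi * ξ)) ?_
    rw [← e3]
    push_cast
    ring
  rw [h2, e1, e2]
  simp only [RCLike.inner_apply, map_mul, Complex.conj_ofReal, Complex.conj_I]
  ring

lemma Flow.increment_a (S : Setup l b ρ r c₁ c₂ c₃ c₄ p) {T : ℝ} {e a : ℝ → L2}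
    (F : Flow l b ρ p T e a) {s t : ℝ} (ht : t ∈ Ico 0 T) (hs : s ∈ Ico 0 T) :
    𝐒 (a s - a t) = 𝐖 (∫ τ in t..s, e τ) + 𝐗 (∫ τ in t..s, nonlinearity p (𝐊 (e τ))) := by
  have hsub := uIcc_subset_Ico ht hs
  have hN := F.continuousOn_nonlinearity S
  have hW := (ContinuousLinearMap.continuous 𝐖).comp_continuousOn F.cont_e
  have hX := (ContinuousLinearMap.continuous 𝐗).comp_continuousOn hN
  rw [map_sub, ← integral_eq_sub_of_hasDerivWithinAt_Ico (hW.add hX) F.der_a ht hs]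
  have h1 := intervalIntegral.integral_add (μ := volume) (hW.mono hsub).intervalIntegrable
    (hX.mono hsub).intervalIntegrable
  refine h1.trans ?_
  congr 1
  · exact ContinuousLinearMap.intervalIntegral_comp_comm 𝐖 (F.cont_e.mono hsub).intervalIntegrable
  · exact ContinuousLinearMap.intervalIntegral_comp_comm 𝐗 (hN.mono hsub).intervalIntegrable

/-- The integral of a continuous curve from an interior time. -/
lemma hasDerivWithinAt_integral_Ico_self {T : ℝ} {z : ℝ → L2} (hz : ContinuousOn z (Ico 0 T))
    {t : ℝ} (ht : t ∈ Ico 0 T) :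
    HasDerivWithinAt (fun s => ∫ τ in t..s, z τ) (z t) (Ico 0 T) t := by
  have h1 := (hasDerivWithinAt_integral_Ico hz ht).sub_const (∫ τ in (0 : ℝ)..t, z τ)
  refine h1.congr_of_mem (fun s hs => ?_) ht
  have h0 : (0 : ℝ) ∈ Ico 0 T := ⟨le_rfl, ht.1.trans_lt ht.2⟩
  exact (intervalIntegral.integral_interval_sub_left
    ((hz.mono (uIcc_subset_Ico h0 hs)).intervalIntegrable)
    ((hz.mono (uIcc_subset_Ico h0 ht)).intervalIntegrable)).symm

lemma Flow.isMul_primitive (S : Setup l b ρ r c₁ c₂ c₃ c₄ p) {T : ℝ} {e a : ℝ → L2}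
    (F : Flow l b ρ p T e a) {η₀ : L2} (h0 : IsMul (fun ξ => Complex.I * (symOm l ξ : ℂ)) η₀ (e 0))
    {t : ℝ} (ht : t ∈ Ico 0 T) :
    IsMul (fun ξ => Complex.I * (symOm l ξ : ℂ)) (η₀ + ∫ τ in (0 : ℝ)..t, a τ) (e t) := by
  have := h0.add (F.increment_e_isMul S ⟨le_rfl, ht.1.trans_lt ht.2⟩ ht)
  rwa [add_sub_cancel] at this

/-- The primitive at s is its value η at t plus the integral of a from t to s. The first part pairs
with the increment of a by `Setup.inner_of_smoothed`; the second vanishes at s = t, so continuity of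
a suffices. -/
lemma Flow.hasDerivWithinAt_virial (S : Setup l b ρ r c₁ c₂ c₃ c₄ p) {T : ℝ} {e a : ℝ → L2}
    (F : Flow l b ρ p T e a) {η₀ : L2} (h0 : IsMul (fun ξ => Complex.I * (symOm l ξ : ℂ)) η₀ (e 0))
    {t : ℝ} (ht : t ∈ Ico 0 T) :
    HasDerivWithinAt (fun s => ⟪η₀ + ∫ τ in (0 : ℝ)..s, a τ, a s⟫)
      (‖a t‖ ^ 2 - ‖e t‖ ^ 2 + Q p (𝐊 (e t))) (Ico 0 T) t := by
  have hmem0 : (0 : ℝ) ∈ Ico 0 T := ⟨le_rfl, ht.1.trans_lt ht.2⟩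
  have hN := F.continuousOn_nonlinearity S
  set η : L2 := η₀ + ∫ τ in (0 : ℝ)..t, a τ with hη
  have h1 : HasDerivWithinAt (fun s => ⟪∫ τ in t..s, a τ, a s⟫) ⟪a t, a t⟫ (Ico 0 T) t :=
    hasDerivWithinAt_inner_of_eq_zero (hasDerivWithinAt_integral_Ico_self F.cont_a ht)
      intervalIntegral.integral_same (F.cont_a t ht)
  have h2 : HasDerivWithinAt (fun s => ⟪e t, ∫ τ in t..s, e τ⟫) ⟪e t, e t⟫ (Ico 0 T) t :=
    (innerSL ℝ (e t)).hasFDerivAt.comp_hasDerivWithinAt t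
      (hasDerivWithinAt_integral_Ico_self F.cont_e ht)
  have h3 : HasDerivWithinAt (fun s => ⟪𝐊 (e t), ∫ τ in t..s, nonlinearity p (𝐊 (e τ))⟫)
      ⟪𝐊 (e t), nonlinearity p (𝐊 (e t))⟫ (Ico 0 T) t :=
    (innerSL ℝ (𝐊 (e t))).hasFDerivAt.comp_hasDerivWithinAt t
      (hasDerivWithinAt_integral_Ico_self hN ht)
  have h4 := ((h1.sub h2).sub h3).const_add ⟪η, a t⟫
  refine (h4.congr_deriv ?_).congr_of_mem (fun s hs => ?_) ht
  · obtain ⟨C, -, hC⟩ := S.exists_sobolev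
    rw [real_inner_comm (nonlinearity p (𝐊 (e t))) (𝐊 (e t)), inner_nonlinearity_self S.hp (hC (e t)),
      real_inner_self_eq_norm_sq, real_inner_self_eq_norm_sq]
    ring
  · have hs0 : η₀ + ∫ τ in (0 : ℝ)..s, a τ = η + ∫ τ in t..s, a τ := by
      rw [hη, add_assoc, intervalIntegral.integral_add_adjacent_intervals
        ((F.cont_a.mono (uIcc_subset_Ico hmem0 ht)).intervalIntegrable)
        ((F.cont_a.mono (uIcc_subset_Ico ht hs)).intervalIntegrable)]
    have hi := F.isMul_primitive S h0 ht
    have h5 := S.inner_of_smoothed hi (S.isMul_opK_of_isMul hi) (F.increment_a S ht hs)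
    rw [inner_sub_right, ← hη] at h5
    rw [hs0, inner_add_left]
    simp only [Pi.sub_apply]
    linarith

/-- There is no global flow starting in the unstable set. -/
theorem Setup.not_global (S : Setup l b ρ r c₁ c₂ c₃ c₄ p) {γ : ℝ} (hγ : |γ| < c₁)
    {e a : ℝ → L2} (F : ∀ T, Flow l b ρ p T e a)
    (hd : 1 / 2 * ‖a 0‖ ^ 2 + 1 / 2 * ‖e 0‖ ^ 2 - 1 / (p + 1) * Q p (𝐊 (e 0)) + γ * ⟪a 0, 𝚲 (e 0)⟫
      < criticalEnergy l b p (r / 2 + ρ / 2) (r / 2) γ)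
    (hI : 2 * (1 / 2 * ‖e 0‖ ^ 2 - γ ^ 2 / 2 * ‖𝚲 (e 0)‖ ^ 2) < Q p (𝐊 (e 0)))
    (hM : 0 ≤ γ * ⟪a 0, 𝚲 (e 0)⟫) {η₀ : L2}
    (h0 : IsMul (fun ξ => Complex.I * (symOm l ξ : ℂ)) η₀ (e 0)) : False := by
  obtain ⟨δ, hδ, hvir⟩ := S.virial_lower_bound hγ hd hI hM
  have hmem : ∀ t : ℝ, 0 ≤ t → t ∈ Ico 0 (t + 1) := fun t ht => ⟨ht, by linarith⟩
  refine false_of_virial (H := fun t => 1 / 2 * ‖η₀ + ∫ τ in (0 : ℝ)..t, a τ‖ ^ 2)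
    (G := fun t => ⟪η₀ + ∫ τ in (0 : ℝ)..t, a τ, a t⟫)
    (G' := fun t => ‖a t‖ ^ 2 - ‖e t‖ ^ 2 + Q p (𝐊 (e t))) (x := fun t => ‖a t‖ ^ 2) S.hp hδ
    (fun t ht => ?_) (fun t ht => ?_) (fun t ht => hvir (t + 1) (F _) t (hmem t ht))
    (fun t ht => ?_) (fun t => by positivity) (fun t => by positivity)
  · have h1 := (((hasDerivWithinAt_integral_Ico (F (t + 1)).cont_a (hmem t ht)).const_add
      η₀).norm_sq).const_mul (1 / 2)
    have h2 := (hasDerivWithinAt_congr_set (Ico_eventuallyEq_Ici (lt_add_one t))).mp h1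
    exact h2.congr_deriv (by ring)
  · exact (hasDerivWithinAt_congr_set (Ico_eventuallyEq_Ici (lt_add_one t))).mp
      ((F (t + 1)).hasDerivWithinAt_virial S h0 (hmem t ht))
  · have h1 := abs_real_inner_le_norm (η₀ + ∫ τ in (0 : ℝ)..t, a τ) (a t)
    have h2 := pow_le_pow_left₀ (abs_nonneg _) h1 2
    rw [sq_abs, mul_pow] at h2
    linarith

end Virial

/-! ### Multipliers on Schwartz functions -/

lemma complexSchwartz_derivCLM (φ : 𝓢(ℝ, ℝ)) (x : ℝ) :
    complexSchwartz (SchwartzMap.derivCLM ℝ ℝ φ) x = deriv (complexSchwartz φ) x := by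
  have h := (φ.hasDerivAt x).ofReal_comp
  exact h.deriv.symm

lemma testDeriv_isMul (φ : 𝓢(ℝ, ℝ)) :
    IsMul (fun ξ => Complex.I * (ξ : ℂ)) (test φ) (testDeriv φ) := by
  filter_upwards [fourierL2_toLp_ae φ, fourierL2_toLp_ae (SchwartzMap.derivCLM ℝ ℝ φ)] with η h1 h2
  have h3 : fourierL2 (testDeriv φ) η = 𝓕 (complexSchwartz (SchwartzMap.derivCLM ℝ ℝ φ)) η := h2
  have h4 : fourierL2 (test φ) η = 𝓕 (complexSchwartz φ) η := h1
  rw [h3, h4, SchwartzMap.fourier_coe, SchwartzMap.fourier_coe]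
  have hd : (complexSchwartz (SchwartzMap.derivCLM ℝ ℝ φ) : ℝ → ℂ) = deriv (complexSchwartz φ) :=
    funext (complexSchwartz_derivCLM φ)
  have hint : Integrable (deriv (complexSchwartz φ)) := by
    rw [← hd]
    exact SchwartzMap.integrable _
  rw [hd, Real.fourier_deriv (SchwartzMap.integrable _) (SchwartzMap.differentiable _) hint]
  simp only [smul_eq_mul]
  push_cast
  ring

lemma hasTemperateGrowth_bracket (s : ℝ) :
    (fun η : ℝ => (1 + (2 * Real.pi * η) ^ 2) ^ s).HasTemperateGrowth := by
  have h1 := (Function.hasTemperateGrowth_one_add_norm_sq_rpow ℝ s).comp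
    (show (fun η : ℝ => 2 * Real.pi * η).HasTemperateGrowth by fun_prop)
  simpa only [Function.comp_def, Real.norm_eq_abs, sq_abs] using h1

/-- Even symbols of polynomial growth act on Schwartz functions. -/
lemma exists_isMul_test {f : ℝ → ℝ} (hf : Continuous f) (he : ∀ ξ, f (-ξ) = f ξ) {C s : ℝ}
    (hC : ∀ ξ, |f ξ| ≤ C * (1 + ξ ^ 2) ^ s) (φ : 𝓢(ℝ, ℝ)) :
    ∃ χ, IsMul (fun ξ => (f ξ : ℂ)) (test φ) χ := by
  set G : 𝓢(ℝ, ℂ) := SchwartzMap.smulLeftCLM ℂ (fun η : ℝ => (1 + (2 * Real.pi * η) ^ 2) ^ s)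
    (𝓕 (complexSchwartz φ)) with hG
  have hM : MemLp (fun η : ℝ => (f (2 * Real.pi * η) : ℂ) * fourierL2 (test φ) η) 2 volume := by
    refine (G.memLp 2 volume).of_le_mul (c := C) ?_ ?_
    · have h1 : Continuous (fun η : ℝ => (f (2 * Real.pi * η) : ℂ)) := by fun_prop
      exact h1.aestronglyMeasurable.mul (Lp.aestronglyMeasurable _)
    · filter_upwards [fourierL2_toLp_ae φ] with η h1
      have h4 : fourierL2 (test φ) η = 𝓕 (complexSchwartz φ) η := h1
      rw [h4, hG, SchwartzMap.smulLeftCLM_apply_apply (hasTemperateGrowth_bracket s), norm_mul,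
        norm_smul, ← mul_assoc, Complex.norm_real,
        Real.norm_of_nonneg (Real.rpow_nonneg (bracket_pos _).le s)]
      exact mul_le_mul_of_nonneg_right (hC _) (norm_nonneg _)
  obtain ⟨χ, hχ, -⟩ := exists_isMul (Herm.ofReal he) hM
  exact ⟨χ, hχ⟩

/-- The smoothing operator preserves Schwartz functions. -/
lemma exists_test_eq_op {s : ℝ} (hs : BSym (fun ξ => (((1 + ξ ^ 2) ^ s : ℝ) : ℂ))) (ψ : 𝓢(ℝ, ℝ)) :
    ∃ φ : 𝓢(ℝ, ℝ), test φ = op (fun ξ => (((1 + ξ ^ 2) ^ s : ℝ) : ℂ)) (test ψ) := by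
  set G : 𝓢(ℝ, ℂ) := SchwartzMap.smulLeftCLM ℂ (fun η : ℝ => (1 + (2 * Real.pi * η) ^ 2) ^ s)
    (𝓕 (complexSchwartz ψ)) with hG
  have hM := hs.memLp (test ψ)
  have hae : hM.toLp _ = G.toLp 2 volume := by
    refine Lp.ext ?_
    filter_upwards [hM.coeFn_toLp, G.coeFn_toLp 2 volume, fourierL2_toLp_ae ψ] with η h1 h2 h3
    have h4 : fourierL2 (test ψ) η = 𝓕 (complexSchwartz ψ) η := h3
    rw [h1, h2, h4, hG, SchwartzMap.smulLeftCLM_apply_apply (hasTemperateGrowth_bracket s),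
      Complex.real_smul]
  obtain ⟨v, hv, -, hre⟩ := exists_isMul hs.herm hM
  refine ⟨(𝓕⁻ G).postcompCLM Complex.reCLM, ?_⟩
  rw [← hs.isMul_iff.mp hv, hre, hae, SchwartzMap.toLp_fourierInv_eq]
  refine Lp.ext ?_
  filter_upwards [SchwartzMap.coeFn_toLp ((𝓕⁻ G).postcompCLM Complex.reCLM) 2 volume,
    reL2_ae ((𝓕⁻ G).toLp 2 volume), (𝓕⁻ G).coeFn_toLp 2 volume] with x h1 h2 h3
  rw [h2, h3]
  exact h1

lemma IsMul.inner_eq_neg_inner {m₁ m₂ m₃ m₄ : ℝ → ℂ} {a a' b b' c d : L2}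
    (h1 : IsMul m₁ c a) (h2 : IsMul m₂ d b) (h3 : IsMul m₃ c a') (h4 : IsMul m₄ d b')
    (hm : ∀ ξ, starRingEnd ℂ (m₁ ξ) * m₂ ξ = -(starRingEnd ℂ (m₃ ξ) * m₄ ξ)) :
    ⟪a, b⟫ = -⟪a', b'⟫ := by
  have h4' : IsMul (fun ξ => -m₄ ξ) d ((-1 : ℝ) • b') := by
    filter_upwards [h4, fourierL2_smul_ae (-1) b'] with η e1 e2
    rw [e2, e1]
    simp
  have := h1.inner_eq_inner h2 h3 h4' fun ξ => by rw [hm]; ring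
  rw [this, inner_smul_right, neg_one_mul]

lemma eq_zero_of_inner_test {x : L2} (h : ∀ ψ : 𝓢(ℝ, ℝ), ⟪x, test ψ⟫ = 0) : x = 0 := by
  rw [← inner_self_eq_zero (𝕜 := ℝ)]
  refine denseRange_toLp.induction_on (p := fun y => ⟪x, y⟫ = 0) x ?_ h
  exact isClosed_eq (continuous_const.inner continuous_id) continuous_const

/-! ### From distributional identities to multiplier relations -/

section Testing

variable {l b : ℝ → ℝ} {ρ r c₁ c₂ c₃ c₄ p : ℝ}

local notation "𝐊" => op (fun ξ => (symK l b ξ : ℂ))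
local notation "𝐁" => op (fun ξ => (√(b ξ) : ℂ))
local notation "𝐒" => op (fun ξ => (symS ρ ξ : ℂ))
local notation "𝐖" => op (fun ξ => Complex.I * ((symS ρ ξ * symOm l ξ : ℝ) : ℂ))
local notation "𝐗" => op (fun ξ => Complex.I * ((symS ρ ξ * symD b ξ : ℝ) : ℂ))

lemma Setup.abs_symS_mul_le_one (S : Setup l b ρ r c₁ c₂ c₃ c₄ p) (ξ : ℝ) :
    |ξ * symS ρ ξ| ≤ 1 := by
  have hρ := S.hρ
  rw [abs_mul, abs_of_pos (symS_pos ξ)]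
  calc |ξ| * symS ρ ξ ≤ (1 + ξ ^ 2) ^ (1 / 2 : ℝ) * (1 + ξ ^ 2) ^ (-(2 + ρ)) :=
        mul_le_mul_of_nonneg_right (abs_le_bracket ξ) (symS_pos ξ).le
    _ = (1 + ξ ^ 2) ^ (1 / 2 + -(2 + ρ)) := (Real.rpow_add (bracket_pos ξ) _ _).symm
    _ ≤ 1 := bracket_rpow_le_one ξ (by linarith)

lemma Setup.bSym_symS_deriv (S : Setup l b ρ r c₁ c₂ c₃ c₄ p) :
    BSym (fun ξ => Complex.I * ((ξ * symS ρ ξ : ℝ) : ℂ)) :=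
  bSym_imag (by have : Continuous (symS ρ) := Setup.cont_symS
                exact (continuous_id.mul this).measurable)
    (fun ξ => by rw [Setup.even_symS, neg_mul]) S.abs_symS_mul_le_one

/-- Smoothed Schwartz functions are admissible tests, so the distributional equations can be read as
equations between smoothed L² functions. -/
lemma Setup.exists_test_opS (S : Setup l b ρ r c₁ c₂ c₃ c₄ p) (ψ : 𝓢(ℝ, ℝ)) :
    ∃ φ : 𝓢(ℝ, ℝ), test φ = 𝐒 (test ψ) ∧
      IsMul (fun ξ => Complex.I * ((ξ * symS ρ ξ : ℝ) : ℂ)) (test ψ) (testDeriv φ) := by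
  obtain ⟨φ, hφ⟩ := exists_test_eq_op (s := -(2 + ρ)) S.bSym_symS ψ
  refine ⟨φ, hφ, ?_⟩
  have h1 := testDeriv_isMul φ
  rw [hφ] at h1
  refine ((S.bSym_symS.isMul (test ψ)).comp h1).congr fun ξ => ?_
  push_cast
  ring

/-- Testing with smoothed functions identifies the smoothed u, and the nonvanishing smoothing symbol
cancels. -/
lemma Setup.isMul_of_isWeakDeriv (S : Setup l b ρ r c₁ c₂ c₃ c₄ p) {v u : L2}
    (h : IsWeakDeriv v u) : IsMul (fun ξ => Complex.I * (ξ : ℂ)) v u := by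
  have h1 : 𝐒 u = op (fun ξ => Complex.I * ((ξ * symS ρ ξ : ℝ) : ℂ)) v := by
    rw [← sub_eq_zero]
    refine eq_zero_of_inner_test fun ψ => ?_
    obtain ⟨φ, hφ, hφ'⟩ := S.exists_test_opS ψ
    rw [inner_sub_left, S.bSym_symS.inner_real, ← hφ, h φ,
      (S.bSym_symS_deriv.isMul v).inner_left_neg hφ' fun ξ => by simp]
    ring
  have h2 := S.bSym_symS_deriv.isMul v
  rw [← h1] at h2
  refine (h2.congr fun ξ => ?_).cancel (S.bSym_symS.isMul u) symS_ne_zero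
  push_cast
  ring

/-- The primitive of the initial datum, in the variable of `Flow`. -/
lemma Setup.exists_primitive (S : Setup l b ρ r c₁ c₂ c₃ c₄ p) {v e : L2}
    (h : IsWeakDeriv v (𝐊 e)) : ∃ η, IsMul (fun ξ => Complex.I * (symOm l ξ : ℂ)) η e := by
  have hv := S.isMul_of_isWeakDeriv h
  have hc₁ := S.hc₁
  have hc₃ := S.hc₃
  have hr := S.hr
  have heq : ∀ᵐ η, fourierL2 e η = Complex.I * symOm l (2 * Real.pi * η)
      * (((√(b (2 * Real.pi * η)))⁻¹ : ℝ) * fourierL2 v η) := by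
    filter_upwards [hv, S.bSym_k.isMul e] with η h1 h2
    have hk : (symK l b (2 * Real.pi * η) : ℂ) ≠ 0 := by exact_mod_cast (S.k_pos _).ne'
    refine mul_left_cancel₀ hk ?_
    rw [← h2, h1]
    have h3 : (symK l b (2 * Real.pi * η) : ℂ) * symOm l (2 * Real.pi * η)
        * ((√(b (2 * Real.pi * η)))⁻¹ : ℝ) = (2 * Real.pi * η : ℝ) := by
      have e1 := (S.sqrt_b_pos (2 * Real.pi * η)).ne'
      have e2 := (S.sqrt_l_pos (2 * Real.pi * η)).ne'
      rw [← Complex.ofReal_mul, ← Complex.ofReal_mul, symK, symOm]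
      congr 1
      field_simp
    linear_combination (-Complex.I * fourierL2 v η) * h3
  -- The primitive is B^{-1/2}v. For |ξ| ≥ 1 it is at most |ê|/c₁, since |ξ|√l ≥ c₁; for |ξ| < 1 the
  -- symbol b is bounded below and v ∈ L² suffices.
  have hM : MemLp (fun η : ℝ => (((√(b (2 * Real.pi * η)))⁻¹ : ℝ) : ℂ) * fourierL2 v η) 2
      volume := by
    have hb : MemLp (fun η => c₁⁻¹ * ‖fourierL2 e η‖ + c₃⁻¹ * 2 ^ (r / 4) * ‖fourierL2 v η‖) 2
        volume :=
      ((Lp.memLp (fourierL2 e)).norm.const_mul _).add ((Lp.memLp (fourierL2 v)).norm.const_mul _)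
    refine hb.mono ?_ ?_
    · have h1 : Continuous (fun η : ℝ => (((√(b (2 * Real.pi * η)))⁻¹ : ℝ) : ℂ)) := by
        have h2 : Continuous (fun ξ => (√(b ξ))⁻¹) :=
          S.cont_sqrt_b.inv₀ fun ξ => (S.sqrt_b_pos ξ).ne'
        exact Complex.continuous_ofReal.comp (h2.comp (by fun_prop))
      exact h1.aestronglyMeasurable.mul (Lp.aestronglyMeasurable _)
    · filter_upwards [heq] with η h1
      rw [Real.norm_of_nonneg (by positivity)]
      set ξ := 2 * Real.pi * η with hξ
      have hb0 := S.sqrt_b_pos ξ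
      by_cases h : 1 ≤ |ξ|
      · have h2 : ‖fourierL2 e η‖ = |symOm l ξ| * ‖(((√(b ξ))⁻¹ : ℝ) : ℂ) * fourierL2 v η‖ := by
          rw [h1, norm_mul, norm_mul, Complex.norm_I, one_mul, Complex.norm_real, Real.norm_eq_abs]
        have h3 : c₁ ≤ |symOm l ξ| := by
          rw [symOm, abs_mul, abs_of_pos (S.sqrt_l_pos ξ)]
          have h4 := S.sqrt_l_ge ξ
          have h5 : 1 ≤ (1 + ξ ^ 2) ^ (ρ / 4) :=
            Real.one_le_rpow (one_le_bracket ξ) (by linarith [S.hρ])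
          nlinarith [S.sqrt_l_pos ξ]
        have h6 : ‖(((√(b ξ))⁻¹ : ℝ) : ℂ) * fourierL2 v η‖ ≤ c₁⁻¹ * ‖fourierL2 e η‖ := by
          rw [inv_mul_eq_div, le_div_iff₀ hc₁, h2, mul_comm]
          exact mul_le_mul_of_nonneg_right h3 (norm_nonneg _)
        have h7 : 0 ≤ c₃⁻¹ * 2 ^ (r / 4) * ‖fourierL2 v η‖ := by positivity
        linarith
      · have h2 : (√(b ξ))⁻¹ ≤ c₃⁻¹ * 2 ^ (r / 4) := by
          have h3 := S.sqrt_b_ge ξ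
          have h4 : (1 + ξ ^ 2) ^ (-r / 4) = ((1 + ξ ^ 2) ^ (r / 4))⁻¹ := by
            rw [← Real.rpow_neg (bracket_pos ξ).le, neg_div]
          have h5 : (1 + ξ ^ 2) ^ (r / 4) ≤ 2 ^ (r / 4) := by
            refine Real.rpow_le_rpow (bracket_pos ξ).le ?_ (by linarith)
            have := (sq_lt_one_iff_abs_lt_one ξ).mpr (not_le.mp h)
            linarith
          have h6 : 0 < (1 + ξ ^ 2) ^ (r / 4) := Real.rpow_pos_of_pos (bracket_pos ξ) _
          rw [h4] at h3
          calc (√(b ξ))⁻¹ ≤ (c₃ * ((1 + ξ ^ 2) ^ (r / 4))⁻¹)⁻¹ := by gcongr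
            _ = c₃⁻¹ * (1 + ξ ^ 2) ^ (r / 4) := by rw [mul_inv, inv_inv]
            _ ≤ _ := by gcongr
        have h7 : ‖(((√(b ξ))⁻¹ : ℝ) : ℂ) * fourierL2 v η‖
            ≤ c₃⁻¹ * 2 ^ (r / 4) * ‖fourierL2 v η‖ := by
          rw [norm_mul, Complex.norm_real, Real.norm_of_nonneg (by positivity)]
          gcongr
        have h8 : 0 ≤ c₁⁻¹ * ‖fourierL2 e η‖ := by positivity
        linarith
  obtain ⟨η₀, hη₀, -⟩ := exists_isMul (m := fun ξ => (((√(b ξ))⁻¹ : ℝ) : ℂ))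
    (Herm.ofReal fun ξ => by rw [S.even_b]) hM
  refine ⟨η₀, ?_⟩
  filter_upwards [heq, hη₀] with η h1 h2
  rw [h1, h2]

end Testing

/-! ### Solutions of the Cauchy problem and flows -/

lemma ContinuousInH.congr {s T : ℝ} {u v : ℝ → L2} (h : ContinuousInH s T u)
    (huv : ∀ t ∈ Ico 0 T, v t = u t) : ContinuousInH s T v := by
  refine ⟨fun t ht => (huv t ht).symm ▸ h.1 t ht, fun t ht => (h.2 t ht).congr' ?_⟩
  filter_upwards [self_mem_nhdsWithin] with τ hτ
  rw [huv t ht, huv τ hτ]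

section Solution

variable {l b : ℝ → ℝ} {ρ r c₁ c₂ c₃ c₄ p : ℝ}

local notation "𝐊" => op (fun ξ => (symK l b ξ : ℂ))
local notation "𝐁" => op (fun ξ => (√(b ξ) : ℂ))
local notation "𝐒" => op (fun ξ => (symS ρ ξ : ℂ))
local notation "𝐖" => op (fun ξ => Complex.I * ((symS ρ ξ * symOm l ξ : ℝ) : ℂ))
local notation "𝐗" => op (fun ξ => Complex.I * ((symS ρ ξ * symD b ξ : ℝ) : ℂ))

lemma Setup.bSym_b (S : Setup l b ρ r c₁ c₂ c₃ c₄ p) : BSym (fun ξ => (b ξ : ℂ)) := by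
  refine bSym_real S.cont_b.measurable S.even_b (C := c₄ ^ 2) fun ξ => ?_
  rw [abs_of_pos (S.b_pos ξ)]
  refine (S.hb ξ).2.trans (mul_le_of_le_one_right (sq_nonneg _) (bracket_rpow_le_one ξ ?_))
  linarith [S.hr]

lemma Setup.opB_injective (S : Setup l b ρ r c₁ c₂ c₃ c₄ p) : Function.Injective 𝐁 :=
  S.bSym_sqrtB.op_injective fun ξ => by exact_mod_cast (S.sqrt_b_pos ξ).ne'

lemma Setup.exists_multiplier_l (S : Setup l b ρ r c₁ c₂ c₃ c₄ p) (φ : 𝓢(ℝ, ℝ)) :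
    IsMul (fun ξ => (l ξ : ℂ)) (testDeriv φ) (multiplier l (testDeriv φ)) := by
  obtain ⟨χ, hχ⟩ := exists_isMul_test S.cont_l S.even_l (C := c₂ ^ 2) (s := ρ / 2)
    (fun ξ => by rw [abs_of_pos (S.l_pos ξ)]; exact (S.hl ξ).2) (SchwartzMap.derivCLM ℝ ℝ φ)
  have h : IsMul (fun ξ => (l ξ : ℂ)) (testDeriv φ) χ := hχ
  rwa [multiplier_eq h]

lemma Setup.isMul_multiplier_b (S : Setup l b ρ r c₁ c₂ c₃ c₄ p) (g : L2) :
    IsMul (fun ξ => (b ξ : ℂ)) g (multiplier b g) := by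
  have h := S.bSym_b.isMul g
  rwa [multiplier_eq h]

/-- Dividing by the smoothing symbol costs only polynomial growth, which Schwartz functions absorb.
It lets an equation known after smoothing be tested with an arbitrary φ. -/
lemma Setup.exists_div_symS (S : Setup l b ρ r c₁ c₂ c₃ c₄ p) {f : ℝ → ℝ} (hf : Continuous f)
    (he : ∀ ξ, f (-ξ) = f ξ) {C : ℝ} (hC : ∀ ξ, |f ξ| ≤ C) (φ : 𝓢(ℝ, ℝ)) :
    ∃ χ, IsMul (fun ξ => ((f ξ / symS ρ ξ : ℝ) : ℂ)) (test φ) χ := by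
  have hρ := S.hρ
  refine exists_isMul_test (f := fun ξ => f ξ / symS ρ ξ) (hf.div Setup.cont_symS fun ξ => (Setup.symS_pos ξ).ne')
    (fun ξ => by rw [he, Setup.even_symS]) (C := C) (s := 2 + ρ) (fun ξ => ?_) φ
  rw [abs_div, abs_of_pos (Setup.symS_pos ξ), symS, Real.rpow_neg (bracket_pos ξ).le, div_inv_eq_mul]
  exact mul_le_mul_of_nonneg_right (hC ξ) (Real.rpow_nonneg (bracket_pos ξ).le _)

lemma Setup.abs_sqrt_b_le (S : Setup l b ρ r c₁ c₂ c₃ c₄ p) (ξ : ℝ) : |√(b ξ)| ≤ c₄ := by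
  rw [abs_of_pos (S.sqrt_b_pos ξ)]
  refine (S.sqrt_b_le ξ).trans (mul_le_of_le_one_right S.hc₄.le (bracket_rpow_le_one ξ ?_))
  linarith [S.hr]

lemma Setup.sqrt_l_mul (S : Setup l b ρ r c₁ c₂ c₃ c₄ p) (ξ : ℝ) : (√(l ξ) : ℂ) * √(l ξ) = l ξ := by
  rw [← Complex.ofReal_mul, Real.mul_self_sqrt (S.l_pos ξ).le]

lemma Setup.sqrt_b_mul (S : Setup l b ρ r c₁ c₂ c₃ c₄ p) (ξ : ℝ) : (√(b ξ) : ℂ) * √(b ξ) = b ξ := by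
  rw [← Complex.ofReal_mul, Real.mul_self_sqrt (S.b_pos ξ).le]

lemma Setup.k_mul_sqrt_l (S : Setup l b ρ r c₁ c₂ c₃ c₄ p) (ξ : ℝ) :
    (symK l b ξ : ℂ) * √(l ξ) = √(b ξ) := by
  have := (S.sqrt_l_pos ξ).ne'
  rw [← Complex.ofReal_mul]
  congr 1
  rw [symK]
  field_simp

lemma Setup.k_mul_l (S : Setup l b ρ r c₁ c₂ c₃ c₄ p) (ξ : ℝ) :
    (symK l b ξ : ℂ) * l ξ = √(l ξ) * √(b ξ) := by
  rw [← S.sqrt_l_mul, ← mul_assoc, S.k_mul_sqrt_l, mul_comm]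

/-- The smoothed equations are paired with φ multiplied by K or B^{1/2} and divided by the smoothing
symbol; what remains are the symbol identities K√l = √b, Kl = √l√b and √b√b = b. -/
lemma Flow.isSolution (S : Setup l b ρ r c₁ c₂ c₃ c₄ p) {T : ℝ} (hT : 0 < T) {e a : ℝ → L2}
    (F : Flow l b ρ p T e a) :
    IsSolution l b p (r / 2 + ρ / 2) (r / 2) (𝐊 (e 0)) (𝐁 (a 0)) T (fun t => 𝐊 (e t))
      (fun t => 𝐁 (a t)) := by
  have hS : ∀ ξ, (symS ρ ξ : ℂ) ≠ 0 := symS_ne_zero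
  refine ⟨hT, ?_, ?_, fun φ t ht => ?_, fun φ t ht => ?_, rfl, rfl⟩
  · exact (continuousInH_op_iff S.bSym_k S.k_pos (div_pos S.hc₃ S.hc₂)
      (div_pos S.hc₄ S.hc₁).le S.k_ge S.k_le).mpr F.cont_e
  · exact (continuousInH_op_iff S.bSym_sqrtB S.sqrt_b_pos S.hc₃ S.hc₄.le S.sqrt_b_ge'
      S.sqrt_b_le').mpr F.cont_a
  · obtain ⟨χ, hχ⟩ := S.exists_div_symS S.cont_k S.even_k S.abs_k_le φ
    have h1 := (F.der_e t ht).inner ℝ (hasDerivWithinAt_const t (Ico 0 T) χ)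
    refine (h1.congr_deriv ?_).congr_of_mem (fun s _ => ?_) ht
    · rw [inner_zero_right, zero_add]
      refine (S.bSym_symS_om.isMul (a t)).inner_eq_neg_inner hχ (S.bSym_sqrtB.isMul (a t))
        (testDeriv_isMul φ) fun ξ => ?_
      have h2 := hS ξ
      simp only [symOm, map_mul, Complex.conj_I, Complex.conj_ofReal]
      push_cast
      field_simp
      linear_combination (-ξ : ℂ) * S.k_mul_sqrt_l ξ
    · refine (S.bSym_k.isMul (e s)).inner_eq_inner (IsMul.refl _) (S.bSym_symS.isMul (e s)) hχ
        fun ξ => ?_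
      have h2 := hS ξ
      simp only [Complex.conj_ofReal]
      push_cast
      field_simp
  · obtain ⟨χ, hχ⟩ := S.exists_div_symS S.cont_sqrt_b (fun ξ => by rw [S.even_b]) S.abs_sqrt_b_le φ
    have h1 := (F.der_a t ht).inner ℝ (hasDerivWithinAt_const t (Ico 0 T) χ)
    refine (h1.congr_deriv ?_).congr_of_mem (fun s _ => ?_) ht
    · rw [inner_zero_right, zero_add, inner_add_left, sub_eq_add_neg]
      have hd := testDeriv_isMul φ
      congr 1
      · refine (S.bSym_symS_om.isMul (e t)).inner_eq_neg_inner hχ (S.bSym_k.isMul (e t))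
          (hd.comp (S.exists_multiplier_l φ)) fun ξ => ?_
        have h2 := hS ξ
        simp only [symOm, map_mul, Complex.conj_I, Complex.conj_ofReal]
        push_cast
        field_simp
        linear_combination (ξ : ℂ) * S.k_mul_l ξ
      · refine (S.bSym_symS_d.isMul _).inner_eq_neg_inner hχ (S.isMul_multiplier_b _) hd fun ξ => ?_
        have h2 := hS ξ
        simp only [symD, map_mul, Complex.conj_I, Complex.conj_ofReal]
        push_cast
        field_simp
        linear_combination (-ξ : ℂ) * S.sqrt_b_mul ξ
    · refine (S.bSym_sqrtB.isMul (a s)).inner_eq_inner (IsMul.refl _) (S.bSym_symS.isMul (a s)) hχ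
        fun ξ => ?_
      have h2 := hS ξ
      simp only [Complex.conj_ofReal]
      push_cast
      field_simp

/-- Transfers uniqueness and maximality to all distributional solutions. Tests with smoothed
functions yield the equations after K and B^{1/2}; both are injective, and the continuity of the
right sides allows removing them. -/
lemma Setup.exists_flow_of_isSolution (S : Setup l b ρ r c₁ c₂ c₃ c₄ p) {T : ℝ} {u₀ w₀ : L2}
    {u w : ℝ → L2} (H : IsSolution l b p (r / 2 + ρ / 2) (r / 2) u₀ w₀ T u w) :
    ∃ e a, Flow l b ρ p T e a ∧ ∀ t ∈ Ico 0 T, 𝐊 (e t) = u t ∧ 𝐁 (a t) = w t := by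
  have he : ∀ t, ∃ e, t ∈ Ico 0 T → 𝐊 e = u t := by
    intro t
    by_cases ht : t ∈ Ico 0 T
    · obtain ⟨e, he⟩ := S.exists_opK (H.continuous_u.1 t ht)
      exact ⟨e, fun _ => he⟩
    · exact ⟨0, fun h => absurd h ht⟩
  have ha : ∀ t, ∃ a, t ∈ Ico 0 T → 𝐁 a = w t := by
    intro t
    by_cases ht : t ∈ Ico 0 T
    · obtain ⟨a, ha⟩ := S.exists_opB (H.continuous_w.1 t ht)
      exact ⟨a, fun _ => ha⟩
    · exact ⟨0, fun h => absurd h ht⟩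
  choose e he using he
  choose a ha using ha
  have hec : ContinuousOn e (Ico 0 T) :=
    (continuousInH_op_iff S.bSym_k S.k_pos (div_pos S.hc₃ S.hc₂)
      (div_pos S.hc₄ S.hc₁).le S.k_ge S.k_le).mp (H.continuous_u.congr he)
  have hac : ContinuousOn a (Ico 0 T) :=
    (continuousInH_op_iff S.bSym_sqrtB S.sqrt_b_pos S.hc₃ S.hc₄.le S.sqrt_b_ge'
      S.sqrt_b_le').mp (H.continuous_w.congr ha)
  refine ⟨e, a, ⟨hec, hac, fun t ht => ?_, fun t ht => ?_⟩, fun t ht => ⟨he t ht, ha t ht⟩⟩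
  · refine hasDerivWithinAt_of_separating (fun ψ : 𝓢(ℝ, ℝ) => innerSL ℝ (𝐊 (test ψ)))
      (fun v hv => ?_) (z := fun t => 𝐖 (a t))
      ((ContinuousLinearMap.continuous 𝐖).comp_continuousOn hac) (fun ψ t ht => ?_) ht
    · refine S.opK_injective ((eq_zero_of_inner_test fun ψ => ?_).trans (map_zero 𝐊).symm)
      rw [S.inner_opK, real_inner_comm]
      exact hv ψ
    · obtain ⟨φ, hφ, hφ'⟩ := S.exists_test_opS ψ
      refine ((H.eq_u φ t ht).congr_deriv ?_).congr_of_mem (fun s hs => ?_) ht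
      · rw [← ha t ht, innerSL_apply_apply, real_inner_comm _ (𝐊 (test ψ))]
        refine ((S.bSym_symS_om.isMul (a t)).inner_eq_neg_inner (S.bSym_k.isMul (test ψ))
          (S.bSym_sqrtB.isMul (a t)) hφ' fun ξ => ?_).symm
        simp only [symOm, map_mul, Complex.conj_I, Complex.conj_ofReal]
        push_cast
        linear_combination (-Complex.I * ξ * symS ρ ξ) * S.k_mul_sqrt_l ξ
      · rw [← he s hs, hφ, innerSL_apply_apply, real_inner_comm]
        refine (S.bSym_symS.isMul (e s)).inner_eq_inner (S.bSym_k.isMul (test ψ))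
          (S.bSym_k.isMul (e s)) (S.bSym_symS.isMul (test ψ)) fun ξ => ?_
        simp only [Complex.conj_ofReal]
        ring
  · refine hasDerivWithinAt_of_separating (fun ψ : 𝓢(ℝ, ℝ) => innerSL ℝ (𝐁 (test ψ)))
      (fun v hv => ?_) (z := fun t => 𝐖 (e t) + 𝐗 (nonlinearity p (𝐊 (e t))))
      (((ContinuousLinearMap.continuous 𝐖).comp_continuousOn hec).add
        ((ContinuousLinearMap.continuous 𝐗).comp_continuousOn
          (S.continuous_nonlinearity_opK.comp_continuousOn hec))) (fun ψ t ht => ?_) ht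
    · refine S.opB_injective ((eq_zero_of_inner_test fun ψ => ?_).trans (map_zero 𝐁).symm)
      rw [S.bSym_sqrtB.inner_real, real_inner_comm]
      exact hv ψ
    · obtain ⟨φ, hφ, hφ'⟩ := S.exists_test_opS ψ
      refine ((H.eq_w φ t ht).congr_deriv ?_).congr_of_mem (fun s hs => ?_) ht
      · rw [← he t ht, innerSL_apply_apply, real_inner_comm _ (𝐁 (test ψ)), inner_add_left, sub_eq_add_neg]
        congr 1
        · refine ((S.bSym_symS_om.isMul (e t)).inner_eq_neg_inner (S.bSym_sqrtB.isMul (test ψ))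
            (S.bSym_k.isMul (e t)) (hφ'.comp (S.exists_multiplier_l φ)) fun ξ => ?_).symm
          simp only [symOm, map_mul, Complex.conj_I, Complex.conj_ofReal]
          push_cast
          linear_combination (Complex.I * ξ * symS ρ ξ) * S.k_mul_l ξ
        · refine ((S.bSym_symS_d.isMul _).inner_eq_neg_inner (S.bSym_sqrtB.isMul (test ψ))
            (S.isMul_multiplier_b _) hφ' fun ξ => ?_).symm
          simp only [symD, map_mul, Complex.conj_I, Complex.conj_ofReal]
          push_cast
          linear_combination (-Complex.I * ξ * symS ρ ξ) * S.sqrt_b_mul ξ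
      · rw [← ha s hs, hφ, innerSL_apply_apply, real_inner_comm]
        refine (S.bSym_symS.isMul (a s)).inner_eq_inner (S.bSym_sqrtB.isMul (test ψ))
          (S.bSym_sqrtB.isMul (a s)) (S.bSym_symS.isMul (test ψ)) fun ξ => ?_
        simp only [Complex.conj_ofReal]
        ring

/-- Blow-up in finite time for data in the unstable set. -/
theorem Setup.blowsUp (S : Setup l b ρ r c₁ c₂ c₃ c₄ p) {γ : ℝ} (hγ : |γ| < c₁)
    {u₀ w₀ v₀ : L2} (hmem : (u₀, w₀) ∈ SigmaMinus l b p (r / 2 + ρ / 2) (r / 2) γ)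
    (hv₀ : IsWeakDeriv v₀ u₀) (hM : 0 ≤ γ * momentum b u₀ w₀) :
    BlowsUpInFiniteTime l b p (r / 2 + ρ / 2) (r / 2) u₀ w₀ := by
  obtain ⟨hu, hw, hE, hI⟩ := hmem
  simp only at hu hw hE hI
  obtain ⟨e₀, rfl⟩ := S.exists_opK hu
  obtain ⟨a₀, rfl⟩ := S.exists_opB hw
  rw [S.energy_eq, S.momentum_eq] at hE
  rw [S.I_eq, sub_neg] at hI
  rw [S.momentum_eq] at hM
  obtain ⟨η₀, hη₀⟩ := S.exists_primitive hv₀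
  obtain ⟨e, a, rfl, rfl, hglob | ⟨T, hT, F, hmax, hblow⟩⟩ := S.exists_maximal_flow (p := p) e₀ a₀
  · exact (S.not_global hγ hglob hE hI hM hη₀).elim
  refine ⟨T, _, _, F.isSolution S hT, fun T' u' w' H => ?_, ?_⟩
  · obtain ⟨e', a', F', h'⟩ := S.exists_flow_of_isSolution H
    have h0 := h' 0 ⟨le_rfl, H.pos⟩
    have he : e' 0 = e 0 := S.opK_injective (h0.1.trans H.init_u)
    have ha : a' 0 = a 0 := S.opB_injective (h0.2.trans H.init_w)
    have hT' := hmax T' e' a' F' he ha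
    refine ⟨hT', fun t ht => ?_⟩
    have h1 := F'.unique S (F.mono hT') he ha ht
    rw [← (h' t ht).1, ← (h' t ht).2, h1.1, h1.2]
    exact ⟨rfl, rfl⟩
  · have hpi : 0 < √(2 * Real.pi) := by positivity
    have hc : 0 < c₃ / c₂ := div_pos S.hc₃ S.hc₂
    -- Only lower bounds of the Sobolev norms by ‖e‖ and ‖a‖ are needed to transfer the blow-up; c
    -- is the worse of the two constants.
    set c := min (c₃ / c₂) c₃ with hcdef
    have hc0 : 0 < c := lt_min hc S.hc₃
    refine tendsto_atTop_mono (fun t => ?_) (hblow.const_mul_atTop (mul_pos hpi hc0))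
    have h1 := le_normH_op S.bSym_k S.k_pos hc.le S.k_ge S.k_le (e t)
    have h2 := le_normH_op S.bSym_sqrtB S.sqrt_b_pos S.hc₃.le S.sqrt_b_ge' S.sqrt_b_le' (a t)
    have h3 : c * ‖e t‖ ≤ c₃ / c₂ * ‖e t‖ :=
      mul_le_mul_of_nonneg_right (min_le_left _ _) (norm_nonneg _)
    have h4 : c * ‖a t‖ ≤ c₃ * ‖a t‖ :=
      mul_le_mul_of_nonneg_right (min_le_right _ _) (norm_nonneg _)
    have h5 := mul_le_mul_of_nonneg_left (add_le_add h3 h4) hpi.le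
    linarith

end Solution

end DoublyDispersive

end

theorem theorem4p4
    (l b : ℝ → ℝ) (ρ r c₁ c₂ c₃ c₄ p γ : ℝ)
    (hl_smooth : ContDiff ℝ ∞ l) (hb_smooth : ContDiff ℝ ∞ b)
    (hl_even : ∀ ξ, l (-ξ) = l ξ) (hb_even : ∀ ξ, b (-ξ) = b ξ)
    (hρ : 0 ≤ ρ) (hr : 0 ≤ r) (hrρ : 1 ≤ r + ρ / 2) (hne : (ρ, r) ≠ (0, 1))
    (hc₁ : 0 < c₁) (hc₂ : 0 < c₂) (hc₃ : 0 < c₃) (hc₄ : 0 < c₄)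
    (hl : ∀ ξ, c₁ ^ 2 * (1 + ξ ^ 2) ^ (ρ / 2) ≤ l ξ ∧ l ξ ≤ c₂ ^ 2 * (1 + ξ ^ 2) ^ (ρ / 2))
    (hb : ∀ ξ, c₃ ^ 2 * (1 + ξ ^ 2) ^ (-r / 2) ≤ b ξ ∧ b ξ ≤ c₄ ^ 2 * (1 + ξ ^ 2) ^ (-r / 2))
    (hp : 1 < p) (hγ : |γ| < c₁)
    (s₀ : ℝ) (hs₀ : s₀ = r / 2 + ρ / 2)
    (u₀ w₀ v₀ : DoublyDispersive.L2)
    (hSigma : (u₀, w₀) ∈ DoublyDispersive.SigmaMinus l b p s₀ (s₀ - ρ / 2) γ)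
    (hv₀ : DoublyDispersive.IsWeakDeriv v₀ u₀)
    (hM : 0 ≤ γ * DoublyDispersive.momentum b u₀ w₀) :
    DoublyDispersive.BlowsUpInFiniteTime l b p s₀ (s₀ - ρ / 2) u₀ w₀ := by
  -- If r + ρ ≤ 1 ≤ r + ρ/2 then ρ = 0 and r = 1, the excluded pair.
  have hs : 1 / 2 < r / 2 + ρ / 2 := by
    by_contra! h
    have h1 : ρ = 0 := by linarith
    have h2 : r = 1 := by linarith
    exact hne (by rw [h1, h2])
  have S : DoublyDispersive.Setup l b ρ r c₁ c₂ c₃ c₄ p :=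
    ⟨hl_smooth.continuous, hb_smooth.continuous, hl_even, hb_even, hρ, hr, hrρ, hs, hc₁, hc₂, hc₃,
      hc₄, hl, hb, hp⟩
  have hσ : s₀ - ρ / 2 = r / 2 := by rw [hs₀]; ring
  rw [hσ, hs₀] at hSigma ⊢
  exact S.blowsUp hγ hSigma hv₀ hM
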